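/- Let $k$ be an algebraically closed field of characteristic $0$, let $a,b,c$ be positive integers with $\gcd(a,b,c)=1$, and let $\mathbb{P}(a,b,c)=\operatorname{Proj} k[x,y,z]$ with $\deg x=a$, $\deg y=b$, $\deg z=c$. Let $t_0=[1:1:1]$ be the identity point of its torus. Let $(e,f,-g)$ be a relation for $\mathbb{P}(a,b,c)$, that is, $e,f,g$ are positive integers with $\gcd(e,f,g)=1$ and $ae+bf=cg$. Suppose that the following two conditions hold. (1) $w=\dfrac{g^2c}{ab}<1$. (2) Let $n$ be the number of integers $\delta\le 0$ such that both components of $(b,a)+\delta(e,-f)$ are non-negative and divisible by $g$. Then there are exactly $n$ integers $\gamma\ge 0$ such that both components of $(n-1)(b,a)+\gamma(e,-f)$ are non-negative and divisible by $g$; moreover, $n(b,a)\not\equiv(0,0)\pmod g$. Let $X=\mathrm{Bl}_{t_0}\mathbb{P}(a,b,c)$ be the blowup of $\mathbb{P}(a,b,c)$ at the point $t_0$. Then $X$ is a Noetherian integral scheme, regular in codimension one, with finitely generated divisor class group $\mathrm{Cl}(X)$, and $X$ does not have a finitely generated Cox ring: for all Weil divisors $D_1,\dots,D_r$ on $X$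 whose classes span $\mathrm{Cl}(X)\otimes\mathbb{Q}$, the $k$-algebra $$R(X;D_1,\dots,D_r)=\bigoplus_{(m_1,\dots,m_r)\in\mathbb{Z}^r}H^0\bigl(X,\mathcal{O}_X(m_1D_1+\cdots+m_rD_r)\bigr)$$ is not finitely generated. -/

import Mathlib

open CategoryTheory AlgebraicGeometry

universe u

noncomputable section

namespace BlowupCox

/-! ### Projective spectra over a base ring -/

section ProjOver

variable {R A : Type u} [CommRing R] [CommRing A] [Algebra R A]
  (𝒜 : ℕ → Submodule R A) [GradedAlgebra 𝒜]

/-- The structure morphism `Proj 𝒜 ⟶ Spec R` of the projective spectrum of a graded `R`-algebra. -/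
def projToSpec : Proj 𝒜 ⟶ Spec (.of R) :=
  Proj.toSpecZero 𝒜 ≫ Spec.map (CommRingCat.ofHom (algebraMap R (𝒜 0)))

end ProjOver

/-! ### Weighted projective planes -/

section WeightedPlane

variable (k : Type u) [Field k] (a b c : ℕ)

/-- The grading of `k[x, y, z]` in which `x`, `y`, `z` have degrees `a`, `b`, `c`. -/
abbrev wGrading : ℕ → Submodule k (MvPolynomial (Fin 3) k) :=
  MvPolynomial.weightedHomogeneousSubmodule k ![a, b, c]

instance wGradedAlgebra : GradedAlgebra (wGrading k a b c) :=
  MvPolynomial.weightedGradedAlgebra k ![a, b, c]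

/-- The weighted projective plane `ℙ(a, b, c) = Proj k[x, y, z]`. -/
abbrev weightedPlane : Scheme.{u} := Proj (wGrading k a b c)

/-- The ideal of all polynomials in `k[x, y, z]` that vanish at `(1, 1, 1)`. -/
def idealOne : Ideal (MvPolynomial (Fin 3) k) :=
  RingHom.ker (MvPolynomial.eval (fun _ : Fin 3 => (1 : k)))

instance idealOne_isPrime : (idealOne k).IsPrime := RingHom.ker_isPrime _

variable {a}

/-- The identity `t₀ = [1 : 1 : 1]` of the torus of `ℙ(a, b, c)`: its homogeneous prime ideal is
generated by the homogeneous polynomials that vanish at `(1, 1, 1)`. -/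
def t₀ (ha : 0 < a) : weightedPlane k a b c where
  asHomogeneousIdeal := (idealOne k).homogeneousCore (wGrading k a b c)
  isPrime := (idealOne_isPrime k).homogeneousCore
  not_irrelevant_le h := by
    have hx : (MvPolynomial.X 0 : MvPolynomial (Fin 3) k) ∈ wGrading k a b c a := by
      simpa using MvPolynomial.isWeightedHomogeneous_X k ![a, b, c] (0 : Fin 3)
    have h1 := Ideal.toIdeal_homogeneousCore_le (wGrading k a b c) (idealOne k)
      (h (HomogeneousIdeal.mem_irrelevant_of_mem (wGrading k a b c) ha hx))
    simp [idealOne, RingHom.mem_ker] at h1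

end WeightedPlane

/-! ### Blowups -/

section Rees

variable {A : Type u} [CommRing A] (I : Ideal A)

open Polynomial

/-- The degree `n` part `Iⁿ tⁿ` of the Rees algebra `⨁ₙ Iⁿ tⁿ ⊆ A[t]`. -/
def reesGrading (n : ℕ) : Submodule A (reesAlgebra I) :=
  (LinearMap.range (monomial n : A →ₗ[A] A[X])).comap (reesAlgebra I).val.toLinearMap

variable {I}

lemma mem_reesGrading {n : ℕ} {p : reesAlgebra I} :
    p ∈ reesGrading I n ↔ monomial n ((p : A[X]).coeff n) = (p : A[X]) := by
  constructor
  · rintro ⟨x, hx⟩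
    have hx' : monomial n x = (p : A[X]) := hx
    rw [← hx', coeff_monomial_same]
  · intro h
    exact ⟨_, h⟩

/-- The homogeneous component of degree `n` of an element of the Rees algebra. -/
def reesComponent (p : reesAlgebra I) (n : ℕ) : reesGrading I n :=
  ⟨⟨monomial n ((p : A[X]).coeff n), reesAlgebra.monomial_mem.2 (p.2 n)⟩, ⟨_, rfl⟩⟩

/-- The decomposition of an element of the Rees algebra into its homogeneous components. -/
def reesDecompose (p : reesAlgebra I) : DirectSum ℕ fun n => reesGrading I n :=
  ∑ n ∈ (p : A[X]).support, DirectSum.of (fun n => reesGrading I n) n (reesComponent p n)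

lemma coe_reesDecompose (p : reesAlgebra I) :
    DirectSum.coeAddMonoidHom (reesGrading I) (reesDecompose p) = p := by
  rw [reesDecompose, map_sum]
  apply Subtype.ext
  rw [AddSubmonoidClass.coe_finsetSum]
  simp only [DirectSum.coeAddMonoidHom_of]
  exact ((p : A[X]).as_sum_support).symm

lemma coeff_coe_directSum (x : DirectSum ℕ fun n => reesGrading I n) (n : ℕ) :
    ((DirectSum.coeAddMonoidHom (reesGrading I) x : reesAlgebra I) : A[X]).coeff n =
      ((x n : reesAlgebra I) : A[X]).coeff n := by
  induction x using DirectSum.induction_on with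
  | zero => simp
  | of i y =>
    rw [DirectSum.coeAddMonoidHom_of]
    by_cases h : i = n
    · subst h
      rw [DirectSum.of_eq_same]
    · rw [DirectSum.of_eq_of_ne _ _ _ (Ne.symm h), ← mem_reesGrading.1 y.2, coeff_monomial,
        if_neg h]
      simp
  | add x y hx hy =>
    rw [map_add, DirectSum.add_apply]
    simp only [AddMemClass.coe_add, coeff_add, hx, hy]

lemma coe_directSum_injective :
    Function.Injective (DirectSum.coeAddMonoidHom (reesGrading I)) := by
  intro x y hxy
  apply DFinsupp.ext
  intro n
  apply Subtype.ext
  apply Subtype.ext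
  rw [← mem_reesGrading.1 (x n).2, ← mem_reesGrading.1 (y n).2, ← coeff_coe_directSum,
    ← coeff_coe_directSum, hxy]

variable (I)

instance reesGradedAlgebra : GradedAlgebra (reesGrading I) where
  one_mem := mem_reesGrading.2 (by simp)
  mul_mem := by
    intro i j p q hp hq
    rw [mem_reesGrading] at hp hq ⊢
    rw [MulMemClass.coe_mul, ← hp, ← hq, monomial_mul_monomial, coeff_monomial_same]
  decompose' := reesDecompose
  left_inv := coe_reesDecompose
  right_inv x := coe_directSum_injective (coe_reesDecompose _)

/-- The projective spectrum `Proj (⨁ₙ Iⁿ)`, the blowup of `Spec A` along the ideal `I`. -/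
abbrev affineBlowup : Scheme.{u} := Proj (reesGrading I)

end Rees

section Blowup

variable {X Y : Scheme.{u}}

/-- `π : X ⟶ Y` is the blowup of `Y` along the closed subscheme with ideal sheaf `I`, that is, the
relative `Proj` of `⨁ₙ Iⁿ`: over every affine open subset `U` of `Y`, it is isomorphic to
`Proj (⨁ₙ I(U)ⁿ) ⟶ Spec Γ(Y, U) ≅ U`. (An automorphism of a blowup over its base is the identity,
so these isomorphisms are unique and compatible with each other, and `X` is determined
up to a unique isomorphism over `Y`.) -/
def IsBlowup (π : X ⟶ Y) (I : Y.IdealSheafData) : Prop :=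
  ∀ U : Y.affineOpens, ∃ φ : (π ⁻¹ᵁ U.1).toScheme ≅ affineBlowup (I.ideal U),
    φ.hom ≫ projToSpec (reesGrading (I.ideal U)) = (π ∣_ U.1) ≫ U.2.isoSpec.hom

/-- `π : X ⟶ Y` is the blowup of `Y` at the (reduced) closed point `y`. -/
def IsBlowupAt (π : X ⟶ Y) (y : Y) : Prop :=
  IsBlowup π (Scheme.IdealSheafData.vanishingIdeal (TopologicalSpace.Closeds.closure {y}))

end Blowup

/-! ### Weil divisors and Cox rings -/

/-- A Noetherian integral scheme that is regular in codimension one (for instance a normal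
variety). These are the schemes on which Weil divisors are considered. -/
class RegularInCodimOne (X : Scheme.{u}) : Prop extends IsIntegral X, IsNoetherian X where
  isDiscreteValuationRing : ∀ z : X, Order.coheight z = 1 →
    IsDiscreteValuationRing (X.presheaf.stalk z)

section Weil

variable (X : Scheme.{u})

/-- The prime divisors of `X`, represented by their generic points: the points of codimension
one. -/
def PrimeDivisor : Type u := {z : X // Order.coheight z = 1}

/-- The group of Weil divisors on `X`. -/
abbrev WeilDivisor : Type u := PrimeDivisor X →₀ ℤ

variable {X}

/-- The combination `m₁ D₁ + ⋯ + mᵣ Dᵣ`. -/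
def divisorComb {r : ℕ} (D : Fin r → WeilDivisor X) (m : Fin r → ℤ) : WeilDivisor X :=
  ∑ i, m i • D i

lemma divisorComb_add {r : ℕ} (D : Fin r → WeilDivisor X) (m m' : Fin r → ℤ) :
    divisorComb D (m + m') = divisorComb D m + divisorComb D m' := by
  simp [divisorComb, add_smul, Finset.sum_add_distrib]

variable [RegularInCodimOne X]

lemma ord_one (z : X) : Scheme.ord (1 : X.functionField) z = 0 := by
  have h := Scheme.ord_mul (x := z) (one_ne_zero (α := X.functionField)) one_ne_zero
  rw [mul_one] at h
  omega

variable (X)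

/-- The group of principal divisors: `D = div f` for some nonzero rational function `f`. -/
def principalDivisors : AddSubgroup (WeilDivisor X) where
  carrier := {D | ∃ f : X.functionField, f ≠ 0 ∧ ∀ z : PrimeDivisor X, D z = Scheme.ord f z.1}
  zero_mem' := ⟨1, one_ne_zero, fun z => by rw [Finsupp.zero_apply, ord_one]⟩
  add_mem' := by
    rintro D E ⟨f, hf, hD⟩ ⟨g, hg, hE⟩
    exact ⟨f * g, mul_ne_zero hf hg, fun z => by
      rw [Finsupp.add_apply, hD, hE, Scheme.ord_mul hf hg]⟩
  neg_mem' := by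
    rintro D ⟨f, hf, hD⟩
    refine ⟨f⁻¹, inv_ne_zero hf, fun z => ?_⟩
    have h2 := Scheme.ord_mul (x := z.1) hf (inv_ne_zero hf)
    rw [mul_inv_cancel₀ hf, ord_one] at h2
    rw [Finsupp.neg_apply, hD]; omega

/-- The divisor class group `Cl(X)`: Weil divisors modulo principal divisors. -/
abbrev DivisorClassGroup : Type u := WeilDivisor X ⧸ principalDivisors X

variable {X}

/-- The group of global sections `H⁰(X, 𝒪(D))`, that is, the rational functions `f` with `f = 0`
or `div f + D ≥ 0`. -/
def divisorSections (D : WeilDivisor X) : AddSubgroup X.functionField where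
  carrier := {f | f ≠ 0 → ∀ z : PrimeDivisor X, 0 ≤ Scheme.ord f z.1 + D z}
  zero_mem' h := absurd rfl h
  add_mem' := by
    intro f g hf hg hfg z
    by_cases hf0 : f = 0
    · subst hf0; rw [zero_add] at hfg ⊢; exact hg hfg z
    by_cases hg0 : g = 0
    · subst hg0; rw [add_zero] at hfg ⊢; exact hf hfg z
    have := RegularInCodimOne.isDiscreteValuationRing z.1 z.2
    have h := Scheme.ord_add (x := z.1) hfg
    have h1 := hf hf0 z
    have h2 := hg hg0 z
    rcases min_le_iff.1 h with h | h <;> omega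
  neg_mem' := by
    intro f hf hf0 z
    have hm : (-1 : X.functionField) ≠ 0 := neg_ne_zero.2 one_ne_zero
    have h2 := Scheme.ord_mul (x := z.1) hm hm
    rw [neg_mul_neg, mul_one, ord_one] at h2
    have hf1 : f ≠ 0 := by simpa using hf0
    have h3 := Scheme.ord_mul (x := z.1) hm hf1
    rw [neg_one_mul] at h3
    have := hf hf1 z
    omega

lemma one_mem_divisorSections : (1 : X.functionField) ∈ divisorSections (0 : WeilDivisor X) :=
  fun _ z => by simp [ord_one]

lemma mul_mem_divisorSections {D E : WeilDivisor X} {f g : X.functionField}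
    (hf : f ∈ divisorSections D) (hg : g ∈ divisorSections E) :
    f * g ∈ divisorSections (D + E) := by
  intro hfg z
  have hf0 := left_ne_zero_of_mul hfg
  have hg0 := right_ne_zero_of_mul hfg
  have h1 := hf hf0 z
  have h2 := hg hg0 z
  rw [Scheme.ord_mul hf0 hg0, Finsupp.add_apply]
  omega

/-- The ring `R(X; D₁, …, Dᵣ) = ⨁ₘ H⁰(X, 𝒪(m₁ D₁ + ⋯ + mᵣ Dᵣ))`, `m ∈ ℤʳ`, whose multiplication is
that of rational functions; the summand of degree `m` is placed at the monomial `tᵐ` in the ring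
of Laurent polynomials in `t₁, …, tᵣ` over the function field. -/
def sectionRing {r : ℕ} (D : Fin r → WeilDivisor X) :
    Subring (AddMonoidAlgebra X.functionField (Fin r → ℤ)) where
  carrier := {F | ∀ m, F.coeff m ∈ divisorSections (divisorComb D m)}
  zero_mem' m := by simp [zero_mem]
  one_mem' m := by
    classical
    rw [AddMonoidAlgebra.one_def, AddMonoidAlgebra.coeff_single, Finsupp.single_apply]
    split_ifs with h
    · subst h
      simpa [divisorComb] using one_mem_divisorSections
    · exact zero_mem _
  add_mem' hF hG m := by simpa using add_mem (hF m) (hG m)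
  neg_mem' hF m := by simpa using neg_mem (hF m)
  mul_mem' := by
    classical
    intro F G hF hG m
    rw [AddMonoidAlgebra.coeff_mul]
    refine sum_mem fun m₁ _ => sum_mem fun m₂ _ => ?_
    dsimp only
    split_ifs with h
    · rw [← h, divisorComb_add]
      exact mul_mem_divisorSections (hF m₁) (hG m₂)
    · exact zero_mem _

/-- The divisors `D₁, …, Dᵣ` have classes that span `Cl(X) ⊗ ℚ`. -/
def SpansClassGroup {r : ℕ} (D : Fin r → WeilDivisor X) : Prop :=
  Submodule.span ℚ (Set.range fun i =>
    TensorProduct.tmul ℤ (1 : ℚ) (QuotientAddGroup.mk (D i) : DivisorClassGroup X)) = ⊤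

variable {k : Type u} [Field k]

/-- The constants in the function field of a scheme `X` over `k`. -/
def constants (s : X ⟶ Spec (.of k)) : k →+* X.functionField :=
  haveI : Nonempty (⊤ : X.Opens) := ⟨⟨genericPoint X, trivial⟩⟩
  (X.germToFunctionField ⊤).hom.comp (s.appTop.hom.comp (Scheme.ΓSpecIso (.of k)).inv.hom)

/-- The `k`-algebra structure of `R(X; D₁, …, Dᵣ)`. -/
def constantsToSectionRing (s : X ⟶ Spec (.of k)) {r : ℕ} (D : Fin r → WeilDivisor X) :
    k →+* sectionRing D :=
  (AddMonoidAlgebra.singleZeroRingHom.comp (constants s)).codRestrict (sectionRing D) (by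
    classical
    intro x m
    have : Nonempty (⊤ : X.Opens) := ⟨⟨genericPoint X, trivial⟩⟩
    change (AddMonoidAlgebra.single 0 (constants s x)).coeff m ∈ _
    rw [AddMonoidAlgebra.coeff_single, Finsupp.single_apply]
    split_ifs with h
    · subst h
      intro hx z
      have hx0 : x ≠ 0 := by rintro rfl; exact hx (map_zero _)
      have hu : IsUnit ((s.appTop.hom.comp (Scheme.ΓSpecIso (.of k)).inv.hom) x) :=
        (IsUnit.mk0 x hx0).map _
      have h0 : Scheme.ord (constants s x) z.1 = 0 :=
        Scheme.ord_of_isUnit (U := ⊤) hu trivial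
      rw [h0]
      simp [divisorComb]
    · exact zero_mem _)

/-- Some Cox ring of `X` (over `k`) is a finitely generated `k`-algebra; a Cox ring is any ring
`R(X; D₁, …, Dᵣ)` where the classes of `D₁, …, Dᵣ` span `Cl(X) ⊗ ℚ`. -/
def HasFinitelyGeneratedCoxRing (s : X ⟶ Spec (.of k)) : Prop :=
  ∃ (r : ℕ) (D : Fin r → WeilDivisor X),
    SpansClassGroup D ∧ (constantsToSectionRing s D).FiniteType

end Weil

end BlowupCox

end

/-! Let h = x^e y^f - z^g and let C be the strict transform of its zero locus. The self-intersection
of C on X is w - 1 < 0, and the class of forms of degree d = mab/g with multiplicity m at t₀ is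
orthogonal to C. The theorem rests on two facts about the forms of this degree that vanish to order
m at (1,1,1), for m in a suitable arithmetic progression: h divides all of them, but for some T
independent of m not all are divisible by h^T (`exists_multiple_curve_dvd`). If a Cox ring were
finitely generated, Gordan's lemma would write the sections of a high multiple of the class as sums
of products of many sections of bounded positive multiples (`exists_mem_of_finiteType`). Each of
these is divisible by h, so the power of h dividing all sections would grow without bound
(`PlaneModel.not_hasFinitelyGeneratedCoxRing`).

Both facts come from a duality: F vanishes to order m at (1,...,1) exactly when its coefficients, as
a functional on functions of the exponent, kill all polynomial functions of degree below m
(`VanishesToOrder.moment_eq_zero`, `exists_isPolyFun_of_forall_moment_eq_zero`). The monomials of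
degree d lie on m + 1 lines parallel to (e,f,-g), the columns p = 0,...,m, and h divides F exactly
when every column sum of coefficients is zero. Column p = 0 has at most one monomial. A polynomial
of degree m - 1 that is nonzero there and zero on all other columns shows that its coefficient is
zero, and Lagrange interpolation in p then kills the other m column sums (`curve_dvd_of_isPolyFun`).
Condition (2) is what permits the construction of this polynomial from binomial coefficients
(`curve_dvd_of_vanishesToOrder`).

For the second fact, if h^T always divided F, then the function equal to l^(T-1) on one column (l
the exponent of z) and zero on the others would agree with a polynomial of degree below m. The
inequality w < 1 gives enough long columns to force the coefficients of l^i with i ≥ T - 1 to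
vanish, a contradiction (`exists_not_curve_pow_dvd`).

The geometry enters through `PlaneModel`: the function field of X embeds in Frac k[x,y,z], the prime
divisors are the exceptional divisor E and the homogeneous primes of k[x,y,z], and the order along E
is proportional to the order of vanishing at (1,1,1) (`IsBlowupAt.exists_planeModel`). The local
ring at E is read off from the Rees algebra, once the powers of the ideal of t₀ on the torus are
known to be given by that order of vanishing (`TorusChart.adicValuation`). -/

noncomputable section

namespace BlowupCox

set_option linter.unusedSectionVars false

/-! ### Order of vanishing at (1, …, 1) and polynomial functions of the exponent. -/

section Moments

open MvPolynomial

variable {σ : Type*} [Fintype σ] {k : Type*} [Field k]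

/-- The substitution `Xᵢ ↦ Xᵢ + 1`, the Taylor expansion at `(1, …, 1)`. -/
def taylorOne : MvPolynomial σ k →ₐ[k] MvPolynomial σ k := aeval fun i => X i + 1

/-- The linear functional on polynomials with the prescribed values on monomials. -/
def moment (φ : (σ →₀ ℕ) → k) : MvPolynomial σ k →ₗ[k] k :=
  (MvPolynomial.basisMonomials σ k).constr k φ

lemma moment_monomial (φ : (σ →₀ ℕ) → k) (α : σ →₀ ℕ) (r : k) :
    moment φ (monomial α r) = r * φ α := by
  have h : monomial α r = r • MvPolynomial.basisMonomials σ k α := by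
    simp [MvPolynomial.smul_monomial]
  rw [h, map_smul, moment, Module.Basis.constr_basis, smul_eq_mul]

lemma moment_eq_sum (φ : (σ →₀ ℕ) → k) (F : MvPolynomial σ k) :
    moment φ F = ∑ α ∈ F.support, coeff α F * φ α := by
  conv_lhs => rw [F.as_sum]
  rw [map_sum]
  exact Finset.sum_congr rfl fun α _ => moment_monomial _ _ _

lemma moment_congr {φ ψ : (σ →₀ ℕ) → k} {F : MvPolynomial σ k}
    (h : ∀ α ∈ F.support, φ α = ψ α) : moment φ F = moment ψ F := by
  rw [moment_eq_sum, moment_eq_sum]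
  exact Finset.sum_congr rfl fun α hα => by rw [h α hα]

lemma coeff_taylorOne_monomial (α β : σ →₀ ℕ) (r : k) :
    coeff β (taylorOne (monomial α r)) = r * ∏ i, ((α i).choose (β i) : k) := by
  classical
  have h1 : taylorOne (monomial α r) = C r * ∏ i, (X i + 1 : MvPolynomial σ k) ^ α i := by
    rw [taylorOne, aeval_monomial, Finsupp.prod_fintype _ _ (by simp)]
    rfl
  have h2 : ∏ i, (X i + 1 : MvPolynomial σ k) ^ α i =
      ∑ p ∈ Fintype.piFinset fun i => Finset.range (α i + 1),
        monomial (Finsupp.equivFunOnFinite.symm p) (∏ i, ((α i).choose (p i) : k)) := by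
    simp_rw [add_pow, one_pow, mul_one]
    rw [Finset.prod_univ_sum]
    refine Finset.sum_congr rfl fun p _ => ?_
    rw [Finset.prod_mul_distrib, monomial_eq, Finsupp.prod_fintype _ _ (by simp), mul_comm,
      map_prod]
    simp
  rw [h1, coeff_C_mul, h2, coeff_sum]
  congr 1
  simp only [coeff_monomial]
  by_cases hβ : (β : σ → ℕ) ∈ Fintype.piFinset fun i => Finset.range (α i + 1)
  · rw [Finset.sum_eq_single (β : σ → ℕ)]
    · rw [if_pos (by ext; simp)]
    · intro p _ hp
      rw [if_neg]
      rintro rfl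
      exact hp (by ext; simp)
    · exact fun h => absurd hβ h
  · rw [Finset.sum_eq_zero]
    · simp only [Fintype.mem_piFinset, not_forall, Finset.mem_range, not_lt] at hβ
      obtain ⟨i, hi⟩ := hβ
      rw [Finset.prod_eq_zero (Finset.mem_univ i)]
      rw [Nat.choose_eq_zero_of_lt (by omega), Nat.cast_zero]
    · intro p hp
      rw [if_neg]
      rintro rfl
      exact hβ (by simpa using hp)

/-- Vanishing to a given order thereby becomes a family of linear conditions on the coefficients,
the binomial moments. -/
lemma coeff_taylorOne (β : σ →₀ ℕ) (F : MvPolynomial σ k) :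
    coeff β (taylorOne F) = moment (fun α => ∏ i, ((α i).choose (β i) : k)) F := by
  conv_lhs => rw [F.as_sum]
  rw [map_sum, coeff_sum, moment_eq_sum]
  exact Finset.sum_congr rfl fun α _ => coeff_taylorOne_monomial _ _ _

/-- `F` vanishes to order at least `m` at `(1, …, 1)`. -/
def VanishesToOrder (m : ℕ) (F : MvPolynomial σ k) : Prop :=
  ∀ β : σ →₀ ℕ, β.degree < m → coeff β (taylorOne F) = 0

lemma ringChoose_eq_prod [CharZero k] (x : k) (n : ℕ) :
    Ring.choose x n = (n.factorial : k)⁻¹ * ∏ j ∈ Finset.range n, (x - j) := by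
  rw [Ring.choose_eq_smul, smul_eq_mul, ← descPochhammer_eval_eq_prod_range,
    Polynomial.eval_eq_smeval, ← descPochhammer_map (Int.castRingHom k),
    ← Polynomial.eval_eq_smeval, Polynomial.eval_map, ← Polynomial.aeval_eq_smeval]
  rfl

/-- Functions on exponents given by a polynomial of degree at most `d`. -/
def IsPolyFun (d : ℕ) (φ : (σ →₀ ℕ) → k) : Prop :=
  ∃ G : MvPolynomial σ k, G.totalDegree ≤ d ∧ ∀ α, φ α = eval (fun i => (α i : k)) G

namespace IsPolyFun

lemma const (r : k) : IsPolyFun 0 (fun _ : σ →₀ ℕ => r) := ⟨C r, by simp, by simp⟩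

lemma mono {d d' : ℕ} (h : d ≤ d') {φ : (σ →₀ ℕ) → k} (hφ : IsPolyFun d φ) : IsPolyFun d' φ :=
  let ⟨G, h1, h2⟩ := hφ; ⟨G, h1.trans h, h2⟩

lemma coord (i : σ) : IsPolyFun 1 (fun α : σ →₀ ℕ => (α i : k)) :=
  ⟨X i, by simp, by simp⟩

lemma add {d : ℕ} {φ ψ : (σ →₀ ℕ) → k} (hφ : IsPolyFun d φ) (hψ : IsPolyFun d ψ) :
    IsPolyFun d (fun α => φ α + ψ α) :=
  let ⟨G, h1, h2⟩ := hφ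
  let ⟨H, h3, h4⟩ := hψ
  ⟨G + H, (totalDegree_add _ _).trans (max_le h1 h3), fun α => by simp only [h2, h4, map_add]⟩

lemma mul {d d' : ℕ} {φ ψ : (σ →₀ ℕ) → k} (hφ : IsPolyFun d φ) (hψ : IsPolyFun d' ψ) :
    IsPolyFun (d + d') (fun α => φ α * ψ α) :=
  let ⟨G, h1, h2⟩ := hφ
  let ⟨H, h3, h4⟩ := hψ
  ⟨G * H, (totalDegree_mul _ _).trans (add_le_add h1 h3), fun α => by simp only [h2, h4, map_mul]⟩

lemma const_mul {d : ℕ} (r : k) {φ : (σ →₀ ℕ) → k} (hφ : IsPolyFun d φ) :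
    IsPolyFun d (fun α => r * φ α) := by
  simpa using (const r).mul hφ

lemma sum {ι : Type*} {d : ℕ} (s : Finset ι) {φ : ι → (σ →₀ ℕ) → k}
    (h : ∀ i ∈ s, IsPolyFun d (φ i)) : IsPolyFun d (fun α => ∑ i ∈ s, φ i α) := by
  classical
  induction s using Finset.induction_on with
  | empty => simpa using (const (σ := σ) (0 : k)).mono (Nat.zero_le d)
  | insert a s ha ih =>
    simp only [Finset.sum_insert ha]
    exact (h a (Finset.mem_insert_self _ _)).add
      (ih fun i hi => h i (Finset.mem_insert_of_mem hi))

lemma prod {ι : Type*} (s : Finset ι) {φ : ι → (σ →₀ ℕ) → k}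
    (h : ∀ i ∈ s, IsPolyFun 1 (φ i)) : IsPolyFun s.card (fun α => ∏ i ∈ s, φ i α) := by
  classical
  induction s using Finset.induction_on with
  | empty => simpa using const (σ := σ) (1 : k)
  | insert a s ha ih =>
    simp only [Finset.prod_insert ha]
    rw [Finset.card_insert_of_notMem ha, add_comm]
    exact (h a (Finset.mem_insert_self _ _)).mul
      (ih fun i hi => h i (Finset.mem_insert_of_mem hi))

lemma choose [CharZero k] {φ : (σ →₀ ℕ) → k} (h : IsPolyFun 1 φ) (n : ℕ) :
    IsPolyFun n (fun α => Ring.choose (φ α) n) := by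
  have h1 : (fun α => Ring.choose (φ α) n) =
      fun α => (n.factorial : k)⁻¹ * ∏ j ∈ Finset.range n, (φ α - j) :=
    funext fun α => ringChoose_eq_prod _ _
  rw [h1]
  have h2 := prod (Finset.range n) (φ := fun j α => φ α - (j : k)) fun j _ => by
    simpa [sub_eq_add_neg] using h.add ((const (-(j : k))).mono zero_le_one)
  rw [Finset.card_range] at h2
  exact h2.const_mul _

end IsPolyFun

/-- From x C(x,s) = s C(x,s) + (s+1) C(x,s+1). Multiplying a product of binomials by a coordinate
raises its degree by at most one, so powers of coordinates can be traded for binomials. -/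
lemma chooseProd_mul_mem (i : σ) (β : σ →₀ ℕ) (α : σ →₀ ℕ) :
    (α i : k) * ∏ j, ((α j).choose (β j) : k) = (β i : k) * ∏ j, ((α j).choose (β j) : k) +
      (β i + 1 : k) * ∏ j, ((α j).choose ((β + Finsupp.single i 1 : σ →₀ ℕ) j) : k) := by
  classical
  have h : ∀ γ : σ →₀ ℕ, ∏ j, ((α j).choose (γ j) : k) =
      (α i).choose (γ i) * ∏ j ∈ Finset.univ.erase i, ((α j).choose (γ j) : k) := fun γ =>
    (Finset.mul_prod_erase _ _ (Finset.mem_univ i)).symm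
  have h2 : ∏ j ∈ Finset.univ.erase i, ((α j).choose ((β + Finsupp.single i 1 : σ →₀ ℕ) j) : k) =
      ∏ j ∈ Finset.univ.erase i, ((α j).choose (β j) : k) :=
    Finset.prod_congr rfl fun j hj => by
      rw [Finsupp.add_apply, Finsupp.single_eq_of_ne (Finset.ne_of_mem_erase hj), add_zero]
  rw [h, h (β + _), h2]
  have h3 : (α i : k) * (α i).choose (β i) = (β i) * (α i).choose (β i) +
      (β i + 1) * (α i).choose ((β + Finsupp.single i 1 : σ →₀ ℕ) i) := by
    rw [Finsupp.add_apply, Finsupp.single_eq_same]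
    have h4 := Nat.choose_succ_right_eq (α i) (β i)
    rcases le_or_gt (β i) (α i) with h5 | h5
    · obtain ⟨t, ht⟩ := Nat.exists_eq_add_of_le h5
      rw [ht] at h4 ⊢
      rw [Nat.add_sub_cancel_left] at h4
      have h6 := congrArg (Nat.cast : ℕ → k) h4
      push_cast at h6 ⊢
      linear_combination -h6
    · rw [Nat.choose_eq_zero_of_lt h5, Nat.choose_eq_zero_of_lt (by omega)]
      simp
  linear_combination (∏ j ∈ Finset.univ.erase i, ((α j).choose (β j) : k)) * h3

lemma moment_add (φ ψ : (σ →₀ ℕ) → k) (F : MvPolynomial σ k) :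
    moment (fun α => φ α + ψ α) F = moment φ F + moment ψ F := by
  simp [moment_eq_sum, mul_add, Finset.sum_add_distrib]

lemma moment_const_mul (r : k) (φ : (σ →₀ ℕ) → k) (F : MvPolynomial σ k) :
    moment (fun α => r * φ α) F = r * moment φ F := by
  simp [moment_eq_sum, Finset.mul_sum, mul_left_comm]

/-- Induction on the degree of γ: one coordinate is absorbed into the binomials at a time, which
never increases the sum of the two degrees. -/
lemma VanishesToOrder.moment_monomial_mul {F : MvPolynomial σ k} (γ : σ →₀ ℕ) :
    ∀ {m : ℕ}, VanishesToOrder m F → ∀ β : σ →₀ ℕ, β.degree + γ.degree < m →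
      moment (fun α => (∏ i, (α i : k) ^ γ i) * ∏ j, ((α j).choose (β j) : k)) F = 0 := by
  classical
  induction h : γ.degree generalizing γ with
  | zero =>
    intro m hF β hβ
    have : γ = 0 := (Finsupp.degree_eq_zero_iff γ).1 h
    subst this
    simpa [coeff_taylorOne] using hF β hβ
  | succ n ih =>
    intro m hF β hβ
    have : γ ≠ 0 := by rintro rfl; simp at h
    obtain ⟨i, hi⟩ := Finsupp.ne_iff.1 this
    have h1 : γ = (γ - Finsupp.single i 1) + Finsupp.single i 1 := by
      rw [tsub_add_cancel_of_le]
      rw [Finsupp.single_le_iff]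
      exact Nat.one_le_iff_ne_zero.2 hi
    set γ' := γ - Finsupp.single i 1
    have hγ' : γ'.degree = n := by
      rw [h1, map_add, Finsupp.degree_single] at h
      omega
    have h2 : ∀ α : σ →₀ ℕ, (∏ j, (α j : k) ^ γ j) * ∏ j, ((α j).choose (β j) : k) =
        (β i : k) * ((∏ j, (α j : k) ^ γ' j) * ∏ j, ((α j).choose (β j) : k)) +
        (β i + 1 : k) * ((∏ j, (α j : k) ^ γ' j) *
          ∏ j, ((α j).choose ((β + Finsupp.single i 1 : σ →₀ ℕ) j) : k)) := by
      intro α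
      have h3 : ∏ j, (α j : k) ^ γ j = (∏ j, (α j : k) ^ γ' j) * α i := by
        rw [h1]
        simp only [Finsupp.add_apply, pow_add, Finset.prod_mul_distrib]
        congr 1
        rw [Finset.prod_eq_single i]
        · simp
        · intro j _ hj; rw [Finsupp.single_eq_of_ne hj, pow_zero]
        · simp
      rw [h3, mul_assoc, chooseProd_mul_mem]
      ring
    rw [moment_congr fun α _ => h2 α, moment_add, moment_const_mul, moment_const_mul,
      ih γ' hγ' hF β (by omega), ih γ' hγ' hF _ (by
        rw [map_add, Finsupp.degree_single]; omega)]
    simp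

/-- One half of the duality: every monomial in the exponents of degree below m has, by the preceding
lemma, a moment that involves only Taylor coefficients of order below m. -/
lemma VanishesToOrder.moment_eq_zero {m d : ℕ} {F : MvPolynomial σ k} (hF : VanishesToOrder m F)
    {φ : (σ →₀ ℕ) → k} (hφ : IsPolyFun d φ) (hd : d < m) : moment φ F = 0 := by
  obtain ⟨G, h1, h2⟩ := hφ
  have h3 : φ = fun α => ∑ γ ∈ G.support, coeff γ G * ∏ i, (α i : k) ^ γ i := by
    funext α
    rw [h2, eval_eq']
  have h4 : moment φ F = ∑ γ ∈ G.support, coeff γ G *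
      moment (fun α => ∏ i, (α i : k) ^ γ i) F := by
    rw [h3]
    simp only [moment_eq_sum, Finset.mul_sum]
    rw [Finset.sum_comm]
    exact Finset.sum_congr rfl fun γ _ => Finset.sum_congr rfl fun α _ => by ring
  rw [h4]
  refine Finset.sum_eq_zero fun γ hγ => ?_
  have h5 := hF.moment_monomial_mul γ 0 (by
    have := le_totalDegree hγ
    have : γ.degree ≤ G.totalDegree := this
    simp; omega)
  simp at h5
  rw [h5, mul_zero]

/-- The converse half of the duality. On the finite-dimensional space of polynomials supported in T,
a functional that kills the common kernel of finitely many functionals is in their span; here these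
are the binomial moments of order below m, which in characteristic zero are given by polynomials of
degree below m. -/
lemma exists_isPolyFun_of_forall_moment_eq_zero [CharZero k] {m : ℕ} (hm : 0 < m)
    (T : Finset (σ →₀ ℕ)) (χ : (σ →₀ ℕ) → k)
    (h : ∀ F : MvPolynomial σ k, F.support ⊆ T → VanishesToOrder m F → moment χ F = 0) :
    ∃ φ, IsPolyFun (m - 1) φ ∧ ∀ α ∈ T, χ α = φ α := by
  classical
  let B : Type _ := {β : σ →₀ ℕ // β.degree < m}
  have hB : Finite B := by
    exact Set.Finite.to_subtype (Finsupp.finite_of_degree_lt (σ := σ) m)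
  let emb : (T → k) →ₗ[k] MvPolynomial σ k := ∑ α : T, (monomial α.1).comp (LinearMap.proj α)
  have hemb : ∀ c, (emb c).support ⊆ T := by
    intro c
    simp only [emb, LinearMap.sum_apply, LinearMap.comp_apply, LinearMap.proj_apply]
    refine (support_sum).trans ?_
    intro β hβ
    simp only [Finset.mem_biUnion] at hβ
    obtain ⟨α, -, hα⟩ := hβ
    have := support_monomial_subset hα
    simp at this
    rw [this]; exact α.2
  let L : B → (T → k) →ₗ[k] k := fun β =>
    (moment fun α => ∏ i, ((α i).choose (β.1 i) : k)).comp emb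
  let K : (T → k) →ₗ[k] k := (moment χ).comp emb
  have h1 : ⨅ β, LinearMap.ker (L β) ≤ LinearMap.ker K := by
    intro c hc
    simp only [Submodule.mem_iInf, LinearMap.mem_ker] at hc ⊢
    exact h _ (hemb c) fun β hβ => by rw [coeff_taylorOne]; exact hc ⟨β, hβ⟩
  have h2 := mem_span_of_iInf_ker_le_ker h1
  have := Fintype.ofFinite B
  obtain ⟨w, hw⟩ := (Submodule.mem_span_range_iff_exists_fun k).1 h2
  refine ⟨fun α => ∑ β : B, w β * ∏ i, ((α i).choose (β.1 i) : k), ?_, ?_⟩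
  · refine IsPolyFun.sum _ fun β _ => IsPolyFun.const_mul _ ?_
    have h3 : ∀ s : Finset σ, IsPolyFun (∑ i ∈ s, β.1 i)
        (fun α : σ →₀ ℕ => ∏ i ∈ s, ((α i).choose (β.1 i) : k)) := by
      intro s
      induction s using Finset.induction_on with
      | empty => simpa using IsPolyFun.const (σ := σ) (1 : k)
      | insert a s ha ih =>
        simp only [Finset.prod_insert ha, Finset.sum_insert ha]
        refine IsPolyFun.mul ?_ ih
        have h4 := (IsPolyFun.coord (k := k) a).choose (β.1 a)
        simp only [Ring.choose_natCast] at h4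
        exact h4
    refine (h3 Finset.univ).mono ?_
    have := β.2
    rw [Finsupp.degree_eq_sum] at this
    omega
  · intro α hα
    have h4 : emb (Pi.single ⟨α, hα⟩ 1) = monomial α 1 := by
      simp only [emb, LinearMap.sum_apply, LinearMap.comp_apply, LinearMap.proj_apply]
      rw [Finset.sum_eq_single ⟨α, hα⟩]
      · simp
      · intro β _ hβ; simp [Pi.single_eq_of_ne hβ]
      · simp
    have h5 := LinearMap.congr_fun hw (Pi.single ⟨α, hα⟩ 1)
    simp only [LinearMap.sum_apply, LinearMap.smul_apply, L, K, LinearMap.comp_apply, h4,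
      moment_monomial, one_mul, smul_eq_mul] at h5
    exact h5.symm

end Moments

/-! ### Divisibility by the binomial x^e y^f - z^g in terms of moments. -/

section Binomial

open MvPolynomial

variable {k : Type*} [Field k] (e f g : ℕ)

/-- The exponent of the monomial `x ^ i * y ^ j * z ^ l`. -/
def expo (i j l : ℕ) : Fin 3 →₀ ℕ := Finsupp.equivFunOnFinite.symm ![i, j, l]

@[simp] lemma expo_zero (i j l : ℕ) : expo i j l 0 = i := rfl
@[simp] lemma expo_one (i j l : ℕ) : expo i j l 1 = j := rfl
@[simp] lemma expo_two (i j l : ℕ) : expo i j l 2 = l := rfl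

lemma expo_ext {α β : Fin 3 →₀ ℕ} (h0 : α 0 = β 0) (h1 : α 1 = β 1) (h2 : α 2 = β 2) : α = β := by
  ext i
  fin_cases i <;> assumption

lemma monomial_expo (i j l : ℕ) :
    (monomial (expo i j l) 1 : MvPolynomial (Fin 3) k) = X 0 ^ i * X 1 ^ j * X 2 ^ l := by
  rw [monomial_eq, Finsupp.prod_fintype _ _ (by simp), Fin.prod_univ_three]
  simp

variable (k) in
/-- The binomial `x ^ e * y ^ f - z ^ g`. -/
def curve : MvPolynomial (Fin 3) k := X 0 ^ e * X 1 ^ f - X 2 ^ g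

/-- Multiplication by the binomial is adjoint to taking differences of the test function. -/
lemma moment_curve_mul (φ : (Fin 3 →₀ ℕ) → k) (F : MvPolynomial (Fin 3) k) :
    moment φ (curve k e f g * F) =
      moment (fun α => φ (α + expo e f 0) - φ (α + expo 0 0 g)) F := by
  have h : curve k e f g = monomial (expo e f 0) 1 - monomial (expo 0 0 g) 1 := by
    rw [monomial_expo, monomial_expo, curve]; simp
  induction F using MvPolynomial.induction_on' with
  | monomial α r =>
    rw [h, sub_mul, monomial_mul, monomial_mul, map_sub, moment_monomial, moment_monomial,
      moment_monomial, add_comm, add_comm (expo 0 0 g)]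
    ring
  | add p q hp hq => rw [mul_add, map_add, hp, hq, map_add]

/-- The two arguments of χ do not change when x^e y^f is traded for z^g, so they label the column of
a monomial. Along a column each factor of the binomial turns P into a difference of P with step g,
which lowers its degree; v differences kill every P of degree below v. -/
lemma moment_eq_zero_of_curve_pow_dvd {v : ℕ} : ∀ {F : MvPolynomial (Fin 3) k},
    curve k e f g ^ v ∣ F → ∀ (P : Polynomial k), P.degree < v → ∀ χ : ℕ → ℕ → k,
      moment (fun α => χ (g * α 0 + e * α 2) (g * α 1 + f * α 2) * P.eval (α 2 : k)) F = 0 := by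
  induction v with
  | zero =>
    intro F _ P hP χ
    have : P = 0 := by
      by_contra h
      exact absurd hP (by simp [h])
    simp [this, moment_eq_sum]
  | succ v ih =>
    rintro _ ⟨H, rfl⟩ P hP χ
    rw [pow_succ', mul_assoc, moment_curve_mul]
    have h1 : (P - P.comp (Polynomial.X + Polynomial.C (g : k))).degree < v := by
      by_cases hP0 : P.natDegree = 0
      · rw [Polynomial.eq_C_of_natDegree_eq_zero hP0]
        simp only [Polynomial.C_comp, sub_self, Polynomial.degree_zero]
        exact WithBot.bot_lt_coe v
      · have hne : P ≠ 0 := by rintro rfl; simp at hP0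
        have hnd : (P.comp (Polynomial.X + Polynomial.C (g : k))).natDegree = P.natDegree := by
          rw [Polynomial.natDegree_comp, Polynomial.natDegree_X_add_C, mul_one]
        have hc0 : P.comp (Polynomial.X + Polynomial.C (g : k)) ≠ 0 := by
          intro h; rw [h] at hnd; simp at hnd; exact hP0 hnd.symm
        have h2 : (P - P.comp (Polynomial.X + Polynomial.C (g : k))).degree < P.degree := by
          refine Polynomial.degree_sub_lt_left ?_ hne ?_
          · rw [Polynomial.degree_eq_natDegree hne, Polynomial.degree_eq_natDegree hc0, hnd]
          · rw [Polynomial.leadingCoeff_comp (by rw [Polynomial.natDegree_X_add_C]; simp),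
              Polynomial.leadingCoeff_X_add_C, one_pow, mul_one]
        have h3 : P.degree ≤ v := Polynomial.degree_le_of_natDegree_le
          (Nat.lt_succ_iff.1 ((Polynomial.natDegree_lt_iff_degree_lt hne).2 hP))
        exact lt_of_lt_of_le h2 h3
    -- Both terms of the binomial move the column label by the same vector (ge, gf), which is
    -- absorbed into χ.
    have := ih (F := curve k e f g ^ v * H) ⟨H, rfl⟩ _ h1 fun q q' => χ (q + g * e) (q' + g * f)
    rw [← this]
    refine moment_congr fun α _ => ?_
    simp only [Finsupp.add_apply, expo_zero, expo_one, expo_two, Polynomial.eval_sub,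
      Polynomial.eval_comp, Polynomial.eval_add, Polynomial.eval_X, Polynomial.eval_C, add_zero]
    rw [show g * (α 0 + e) + e * α 2 = g * α 0 + e * α 2 + g * e by ring,
      show g * (α 1 + f) + f * α 2 = g * α 1 + f * α 2 + g * f by ring,
      show g * α 0 + e * (α 2 + g) = g * α 0 + e * α 2 + g * e by ring,
      show g * α 1 + f * (α 2 + g) = g * α 1 + f * α 2 + g * f by ring]
    push_cast
    ring

variable {e f g}

lemma dvd_of_dvd_mul_of_gcd (hefg : Nat.gcd (Nat.gcd e f) g = 1) {x : ℤ}
    (h1 : (g : ℤ) ∣ e * x) (h2 : (g : ℤ) ∣ f * x) : (g : ℤ) ∣ x := by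
  have h3 : (g : ℤ) ∣ (Nat.gcd e f : ℤ) * x := by
    rw [Nat.gcd_eq_gcd_ab, add_mul]
    refine dvd_add ?_ ?_
    · rw [mul_assoc, mul_left_comm]; simpa [mul_comm, mul_left_comm] using h1.mul_left (e.gcdA f)
    · simpa [mul_comm, mul_left_comm] using h2.mul_left (e.gcdB f)
  refine IsCoprime.dvd_of_dvd_mul_left ?_ h3
  rw [Nat.isCoprime_iff_coprime]
  exact (Nat.coprime_iff_gcd_eq_one.2 hefg).symm

/-- Modulo the binomial, each monomial reduces to a normal form `nf` with exponent of z below g.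
Since gcd(e,f,g) = 1, two monomials have the same normal form exactly when they lie in the same
column, so the coefficients of the normal form of F are its column sums. -/
lemma curve_dvd_of_forall_moment_eq_zero (hg : 0 < g) (hefg : Nat.gcd (Nat.gcd e f) g = 1)
    {F : MvPolynomial (Fin 3) k} (h : ∀ q q' : ℕ, moment (fun α =>
      if g * α 0 + e * α 2 = q ∧ g * α 1 + f * α 2 = q' then 1 else 0) F = 0) :
    curve k e f g ∣ F := by
  classical
  let nf : (Fin 3 →₀ ℕ) → (Fin 3 →₀ ℕ) := fun α =>
    expo (α 0 + e * (α 2 / g)) (α 1 + f * (α 2 / g)) (α 2 % g)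
  have hnf : ∀ α γ, nf α = γ ↔ γ 2 < g ∧
      (g * α 0 + e * α 2 = g * γ 0 + e * γ 2 ∧ g * α 1 + f * α 2 = g * γ 1 + f * γ 2) := by
    intro α γ
    have hdm := Nat.div_add_mod (α 2) g
    have hml := Nat.mod_lt (α 2) hg
    set t := α 2 / g
    set r := α 2 % g
    constructor
    · rintro rfl
      refine ⟨hml, ?_, ?_⟩
      · change g * α 0 + e * α 2 = g * (α 0 + e * t) + e * r
        clear_value t r; rw [← hdm]; ring
      · change g * α 1 + f * α 2 = g * (α 1 + f * t) + f * r
        clear_value t r; rw [← hdm]; ring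
    · rintro ⟨h1, h2, h3⟩
      -- The products of this difference with e and with f are both multiples of g; coprimality then
      -- gives the claim.
      have h4 : (g : ℤ) ∣ ((r : ℤ) - γ 2) := by
        refine dvd_of_dvd_mul_of_gcd hefg ⟨γ 0 - α 0 - e * t, ?_⟩ ⟨γ 1 - α 1 - f * t, ?_⟩
        · rw [← hdm] at h2; zify at h2; linear_combination h2
        · rw [← hdm] at h3; zify at h3; linear_combination h3
      have h5 : r = γ 2 := by
        have h7 := Int.eq_zero_of_abs_lt_dvd h4 (by rw [abs_lt]; omega)
        omega
      refine expo_ext ?_ ?_ ?_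
      · change α 0 + e * t = γ 0
        refine Nat.eq_of_mul_eq_mul_left hg ?_
        rw [← hdm, h5] at h2; linarith
      · change α 1 + f * t = γ 1
        refine Nat.eq_of_mul_eq_mul_left hg ?_
        rw [← hdm, h5] at h3; linarith
      · exact h5
  have h1 : ∀ α r, curve k e f g ∣ monomial α r - monomial (nf α) r := by
    intro α r
    have h2 : (monomial α r : MvPolynomial (Fin 3) k) - monomial (nf α) r =
        C r * (monomial α 1 - monomial (nf α) 1) := by
      rw [mul_sub, C_mul_monomial, C_mul_monomial, mul_one]
    rw [h2]
    refine Dvd.dvd.mul_left ?_ _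
    have h3 : α = expo (α 0) (α 1) (α 2) := expo_ext rfl rfl rfl
    have h7 : (monomial α 1 : MvPolynomial (Fin 3) k) = _ :=
      (congrArg (fun β => monomial β 1) h3).trans (monomial_expo _ _ _)
    rw [h7, monomial_expo]
    have h4 : curve k e f g ∣ (X 0 ^ e * X 1 ^ f) ^ (α 2 / g) - (X 2 ^ g) ^ (α 2 / g) :=
      sub_dvd_pow_sub_pow _ _ _
    have h5 := h4.mul_left (-(X 0 ^ α 0 * X 1 ^ α 1 * X 2 ^ (α 2 % g)) : MvPolynomial (Fin 3) k)
    have h6 : (X 2 : MvPolynomial (Fin 3) k) ^ α 2 = (X 2 ^ g) ^ (α 2 / g) * X 2 ^ (α 2 % g) := by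
      rw [← pow_mul, ← pow_add, Nat.div_add_mod]
    convert h5 using 1
    rw [h6, pow_add, pow_add, pow_mul, pow_mul]
    ring
  have h2 : ∑ α ∈ F.support, monomial (nf α) (coeff α F) = 0 := by
    ext γ
    rw [coeff_sum, coeff_zero]
    by_cases hγ : γ 2 < g
    · rw [← h (g * γ 0 + e * γ 2) (g * γ 1 + f * γ 2), moment_eq_sum]
      refine Finset.sum_congr rfl fun α _ => ?_
      rw [coeff_monomial, mul_ite, mul_one, mul_zero]
      exact if_congr ((hnf α γ).trans (by simp [hγ])) rfl rfl
    · refine Finset.sum_eq_zero fun α _ => ?_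
      rw [coeff_monomial, if_neg]
      rw [hnf]
      exact fun h => hγ h.1
  have h3 : F = ∑ α ∈ F.support, (monomial α (coeff α F) - monomial (nf α) (coeff α F)) := by
    rw [Finset.sum_sub_distrib, h2, sub_zero]
    exact F.as_sum
  rw [h3]
  exact Finset.dvd_sum fun α _ => h1 α _

end Binomial

/-! ### Binomial identities and the interpolating polynomial. -/

section RingChoose

variable {k : Type*} [Field k] [CharZero k]

lemma succ_mul_ringChoose_succ (x : k) (n : ℕ) :
    (n + 1 : k) * Ring.choose x (n + 1) = (x - n) * Ring.choose x n := by
  rw [ringChoose_eq_prod, ringChoose_eq_prod, Finset.prod_range_succ, Nat.factorial_succ]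
  have h1 : (n + 1 : k) ≠ 0 := by exact_mod_cast Nat.succ_ne_zero n
  have h2 : (n.factorial : k) ≠ 0 := by exact_mod_cast n.factorial_ne_zero
  push_cast
  field_simp

lemma succ_mul_ringChoose_succ' (x : k) (n : ℕ) :
    (n + 1 : k) * Ring.choose x (n + 1) = x * Ring.choose (x - 1) n := by
  rw [ringChoose_eq_prod, ringChoose_eq_prod, Finset.prod_range_succ', Nat.factorial_succ]
  have h1 : (n + 1 : k) ≠ 0 := by exact_mod_cast Nat.succ_ne_zero n
  have h2 : (n.factorial : k) ≠ 0 := by exact_mod_cast n.factorial_ne_zero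
  have h3 : ∏ j ∈ Finset.range n, (x - ((j + 1 : ℕ) : k)) =
      ∏ j ∈ Finset.range n, (x - 1 - (j : k)) :=
    Finset.prod_congr rfl fun j _ => by push_cast; ring
  rw [h3]
  push_cast
  field_simp
  ring

lemma ringChoose_neg_one (n : ℕ) : Ring.choose (-1 : k) n = (-1) ^ n := by
  induction n with
  | zero => simp
  | succ n ih =>
    have h1 : (n + 1 : k) ≠ 0 := by exact_mod_cast Nat.succ_ne_zero n
    refine mul_left_cancel₀ h1 ?_
    rw [succ_mul_ringChoose_succ, ih]
    ring

lemma ringChoose_neg_two (n : ℕ) : Ring.choose (-2 : k) n = (-1) ^ n * (n + 1) := by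
  induction n with
  | zero => simp
  | succ n ih =>
    have h1 : (n + 1 : k) ≠ 0 := by exact_mod_cast Nat.succ_ne_zero n
    refine mul_left_cancel₀ h1 ?_
    rw [succ_mul_ringChoose_succ, ih]
    push_cast
    ring

/-- The absorption identity i C(x,i) = x C(x-1,i-1), followed by Vandermonde. -/
lemma sum_antidiagonal_mul_ringChoose (x y : k) (n : ℕ) :
    ∑ i ∈ Finset.HasAntidiagonal.antidiagonal (n + 1),
      (i.2 : k) * (Ring.choose y i.1 * Ring.choose x i.2) = x * Ring.choose (y + (x - 1)) n := by
  rw [Finset.Nat.sum_antidiagonal_succ', Ring.add_choose_eq n (Commute.all _ _), Finset.mul_sum]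
  simp only [Nat.cast_zero, zero_mul, zero_add, Nat.cast_add, Nat.cast_one]
  refine Finset.sum_congr rfl fun i _ => ?_
  linear_combination (Ring.choose y i.1) * succ_mul_ringChoose_succ' x i.2

/-- The polynomial of degree `n` in `(q, t)` that vanishes for integers `0 ≤ t ≤ q < n` and
restricts to `C(t + y, n)` for `q = M`. -/
def interpolant (n : ℕ) (M y q t : k) : k :=
  ∑ i ∈ Finset.HasAntidiagonal.antidiagonal n, (Ring.choose (M - i.2) i.1)⁻¹ * Ring.choose y i.1 *
    (Ring.choose t i.2 * Ring.choose (q - i.2) i.1)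

/-- Each summand contains C(t,i₂) C(q-i₂,i₁) with i₁ + i₂ = n. Either t < i₂, or 0 ≤ q - i₂ < i₁;
one of the two binomials is zero. -/
lemma interpolant_eq_zero {n : ℕ} (M y : k) {q t : ℕ} (h1 : t ≤ q) (h2 : q < n) :
    interpolant n M y (q : k) (t : k) = 0 := by
  refine Finset.sum_eq_zero fun i hi => ?_
  rw [Finset.HasAntidiagonal.mem_antidiagonal] at hi
  rcases lt_or_ge t i.2 with h | h
  · rw [Ring.choose_natCast, Nat.choose_eq_zero_of_lt h]; simp
  · rw [← Nat.cast_sub (h.trans h1), Ring.choose_natCast (q - i.2),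
      Nat.choose_eq_zero_of_lt (by omega)]
    simp

lemma ringChoose_sub_ne_zero {n M : ℕ} (hM : n ≤ M) {i : ℕ × ℕ}
    (hi : i ∈ Finset.HasAntidiagonal.antidiagonal n) : Ring.choose ((M : k) - i.2) i.1 ≠ 0 := by
  rw [Finset.HasAntidiagonal.mem_antidiagonal] at hi
  rw [← Nat.cast_sub (by omega), Ring.choose_natCast, Nat.cast_ne_zero]
  exact (Nat.choose_pos (by omega)).ne'

/-- At q = M the normalising factors cancel and Vandermonde's identity remains. -/
lemma interpolant_self {n M : ℕ} (hM : n ≤ M) (y t : k) :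
    interpolant n (M : k) y M t = Ring.choose (y + t) n := by
  rw [Ring.add_choose_eq n (Commute.all _ _)]
  refine Finset.sum_congr rfl fun i hi => ?_
  have := ringChoose_sub_ne_zero (k := k) hM hi
  field_simp

/-- One column further, C(M+1-i₂,i₁) / C(M-i₂,i₁) = (M+1-i₂)/(M+1-n) is linear in i₂. For y = -1 - t
the two resulting Vandermonde sums collapse to multiples of C(-1,n) and C(-2,n-1). -/
lemma interpolant_succ {n M : ℕ} (hM : n ≤ M) (t : k) :
    interpolant n (M : k) (-1 - t) (M + 1 : ℕ) t * ((M + 1 : ℕ) - n) =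
      (-1) ^ n * ((M + 1 : ℕ) + n * t) := by
  have h1 : interpolant n (M : k) (-1 - t) (M + 1 : ℕ) t * ((M + 1 : ℕ) - n) =
      ∑ i ∈ Finset.HasAntidiagonal.antidiagonal n,
        ((M + 1 : ℕ) - (i.2 : k)) * (Ring.choose (-1 - t) i.1 * Ring.choose t i.2) := by
    rw [interpolant, Finset.sum_mul]
    refine Finset.sum_congr rfl fun i hi => ?_
    have h2 := ringChoose_sub_ne_zero (k := k) hM hi
    rw [Finset.HasAntidiagonal.mem_antidiagonal] at hi
    have h3 : Ring.choose (((M + 1 : ℕ) : k) - i.2) i.1 * ((M + 1 : ℕ) - n) =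
        ((M + 1 : ℕ) - (i.2 : k)) * Ring.choose ((M : k) - i.2) i.1 := by
      rw [← Nat.cast_sub (by omega), ← Nat.cast_sub (by omega), ← Nat.cast_sub (by omega),
        Ring.choose_natCast, Ring.choose_natCast, ← Nat.cast_mul, ← Nat.cast_mul]
      congr 1
      have := Nat.choose_mul_succ_eq (M - i.2) i.1
      rw [show M + 1 - i.2 = M - i.2 + 1 by omega, mul_comm (M - i.2 + 1), this,
        show M - i.2 + 1 - i.1 = M + 1 - n by omega]
    field_simp
    linear_combination (Ring.choose (-1 - t) i.1 * Ring.choose t i.2) * h3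
  rw [h1]
  simp only [sub_mul, Finset.sum_sub_distrib, ← Finset.mul_sum]
  rw [← Ring.add_choose_eq n (Commute.all _ _), sub_add_cancel, ringChoose_neg_one]
  cases n with
  | zero => simp
  | succ n =>
    rw [sum_antidiagonal_mul_ringChoose, show (-1 - t + (t - 1) : k) = -2 by ring,
      ringChoose_neg_two]
    push_cast
    ring

lemma isPolyFun_interpolant {σ : Type*} [Fintype σ] (n : ℕ) (M y : k) {q t : (σ →₀ ℕ) → k}
    (hq : IsPolyFun 1 q) (ht : IsPolyFun 1 t) :
    IsPolyFun n fun α => interpolant n M y (q α) (t α) := by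
  refine IsPolyFun.sum _ fun i hi => IsPolyFun.const_mul _ ?_
  rw [Finset.HasAntidiagonal.mem_antidiagonal] at hi
  have h : IsPolyFun 1 fun α => q α - (i.2 : k) := by
    simpa [sub_eq_add_neg] using hq.add ((IsPolyFun.const (-(i.2 : k))).mono zero_le_one)
  exact ((ht.choose i.2).mul (h.choose i.1)).mono (by omega)

end RingChoose

/-! ### The columns of monomials of degree mab/g. -/

section Columns

open MvPolynomial

variable {a b c e f g : ℕ}

/-- Both a and c times the right-hand side are divisible by b, by the relation ae + bf = cg; then
gcd(a,b,c) = 1 applies. -/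
lemma dvd_of_weight_eq (habc : Nat.gcd (Nat.gcd a b) c = 1) (hrel : a * e + b * f = c * g)
    {i j l : ℤ} (h : (b : ℤ) ∣ a * i + b * j + c * l) : (b : ℤ) ∣ g * i + e * l := by
  have hrel' : (a * e + b * f : ℤ) = c * g := by exact_mod_cast hrel
  obtain ⟨s, hs⟩ := h
  have ha : (b : ℤ) ∣ a * (g * i + e * l) :=
    ⟨g * s - g * j - f * l, by linear_combination (g : ℤ) * hs + l * hrel'⟩
  have hc : (b : ℤ) ∣ c * (g * i + e * l) :=
    ⟨e * s - e * j + f * i, by linear_combination (e : ℤ) * hs - i * hrel'⟩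
  have habc' : Nat.gcd (Nat.gcd a c) b = 1 := by
    rw [Nat.gcd_assoc, Nat.gcd_comm c b, ← Nat.gcd_assoc]; exact habc
  exact dvd_of_dvd_mul_of_gcd habc' ha hc

/-- The relation gives a(gi+el) + b(gj+fl) = gd = mab, and b divides gi+el. The quotient p numbers
the lines in direction (e,f,-g) that carry the monomials. -/
lemma exists_column (ha : 0 < a) (hb : 0 < b) (habc : Nat.gcd (Nat.gcd a b) c = 1)
    (hrel : a * e + b * f = c * g) {m d : ℕ} (hd : d * g = m * a * b) (hbd : b ∣ d) {i j l : ℕ}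
    (h : a * i + b * j + c * l = d) :
    ∃ p ≤ m, g * i + e * l = p * b ∧ g * j + f * l = (m - p) * a := by
  have h1 : (b : ℤ) ∣ g * i + e * l := by
    apply dvd_of_weight_eq habc hrel (j := j)
    have : ((a * i + b * j + c * l : ℕ) : ℤ) = d := by rw [h]
    push_cast at this
    rw [this]
    exact_mod_cast hbd
  obtain ⟨p, hp⟩ : b ∣ g * i + e * l := by exact_mod_cast h1
  have h2 : a * (g * i + e * l) + b * (g * j + f * l) = m * a * b := by
    rw [← hd, ← h]
    linear_combination l * hrel
  have h3 : p ≤ m := by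
    rw [hp] at h2
    have : (a * b) * p ≤ (a * b) * m := by
      rw [show a * b * m = m * a * b by ring, ← h2, mul_assoc]; exact Nat.le_add_right _ _
    exact Nat.le_of_mul_le_mul_left this (by positivity)
  refine ⟨p, h3, by rw [hp, mul_comm], ?_⟩
  obtain ⟨q, rfl⟩ := Nat.exists_eq_add_of_le h3
  rw [Nat.add_sub_cancel_left]
  rw [hp] at h2
  have : b * (g * j + f * l) = b * (q * a) := by
    have h4 : a * (b * p) + b * (g * j + f * l) = a * (b * p) + b * (q * a) := by
      rw [h2]; ring
    exact Nat.add_left_cancel h4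
  exact Nat.eq_of_mul_eq_mul_left hb this

lemma weight_eq_of_mem_support {k : Type*} [CommSemiring k] {F : MvPolynomial (Fin 3) k} {d : ℕ}
    (hF : F.IsWeightedHomogeneous ![a, b, c] d) {α : Fin 3 →₀ ℕ} (hα : α ∈ F.support) :
    a * α 0 + b * α 1 + c * α 2 = d := by
  have h := hF (mem_support_iff.1 hα)
  rw [Finsupp.weight_apply, Finsupp.sum_fintype _ _ (by simp), Fin.sum_univ_three] at h
  simpa [mul_comm] using h

variable {k : Type*} [Field k] [CharZero k]

/-- Reduces divisibility to the existence of one test function φ. The m + 1 columns are one too many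
for interpolation by polynomials of degree m - 1 in p; φ disposes of column 0, which has at most one
monomial, a power of y. -/
lemma curve_dvd_of_isPolyFun (ha : 0 < a) (hb : 0 < b) (hg : 0 < g)
    (habc : Nat.gcd (Nat.gcd a b) c = 1) (hefg : Nat.gcd (Nat.gcd e f) g = 1) (he : 0 < e)
    (hrel : a * e + b * f = c * g) {m d : ℕ} (hm : 0 < m) (hd : d * g = m * a * b) (hbd : b ∣ d)
    {φ : (Fin 3 →₀ ℕ) → k} (hφ : IsPolyFun (m - 1) φ)
    (hφ0 : ∀ α : Fin 3 →₀ ℕ, ∀ p ≤ m, 0 < p → g * α 0 + e * α 2 = p * b →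
      g * α 1 + f * α 2 = (m - p) * a → φ α = 0)
    (hφ1 : ∀ α : Fin 3 →₀ ℕ, α 0 = 0 → α 2 = 0 → g * α 1 = m * a → φ α ≠ 0)
    {F : MvPolynomial (Fin 3) k} (hF : F.IsWeightedHomogeneous ![a, b, c] d)
    (hF' : VanishesToOrder m F) : curve k e f g ∣ F := by
  classical
  have hcol : ∀ α ∈ F.support, ∃ p ≤ m, g * α 0 + e * α 2 = p * b ∧
      g * α 1 + f * α 2 = (m - p) * a := fun α hα =>
    exists_column ha hb habc hrel hd hbd (weight_eq_of_mem_support hF hα)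
  have hp0 : ∀ α ∈ F.support, g * α 0 + e * α 2 ≠ 0 := by
    intro α hα h0
    obtain ⟨p, hp, h1, h2⟩ := hcol α hα
    have h3 : α 0 = 0 := by
      rcases Nat.mul_eq_zero.1 (Nat.eq_zero_of_add_eq_zero_right h0) with h | h <;> omega
    have h4 : α 2 = 0 := by
      rcases Nat.mul_eq_zero.1 (Nat.eq_zero_of_add_eq_zero_left h0) with h | h <;> omega
    have h5 : p = 0 := by
      rw [h0, eq_comm, Nat.mul_eq_zero] at h1; omega
    subst h5
    rw [h4, mul_zero, add_zero, Nat.sub_zero] at h2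
    -- Only the monomial of column 0 contributes to this moment.
    have h6 := hF'.moment_eq_zero hφ (by omega)
    rw [moment_eq_sum, Finset.sum_eq_single α] at h6
    · exact mul_ne_zero (mem_support_iff.1 hα) (hφ1 α h3 h4 h2) h6
    · intro β hβ hβα
      obtain ⟨p, hp, h7, h8⟩ := hcol β hβ
      rcases Nat.eq_zero_or_pos p with rfl | hp0
      · exfalso
        rw [zero_mul] at h7
        have h9 : β 0 = 0 := by
          rcases Nat.mul_eq_zero.1 (Nat.eq_zero_of_add_eq_zero_right h7) with h | h <;>
            omega
        have h10 : β 2 = 0 := by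
          rcases Nat.mul_eq_zero.1 (Nat.eq_zero_of_add_eq_zero_left h7) with h | h <;>
            omega
        rw [h10, mul_zero, add_zero, Nat.sub_zero, ← h2] at h8
        exact hβα (expo_ext (h9.trans h3.symm) (Nat.eq_of_mul_eq_mul_left hg h8)
          (h10.trans h4.symm))
      · rw [hφ0 β p hp hp0 h7 h8, mul_zero]
    · exact fun h => absurd hα h
  have hb' : (b : k) ≠ 0 := by exact_mod_cast hb.ne'
  refine curve_dvd_of_forall_moment_eq_zero hg hefg fun q q' => ?_
  by_cases hq : ∃ p ≤ m, 0 < p ∧ q = p * b ∧ q' = (m - p) * a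
  · obtain ⟨p, hp, hp1, rfl, rfl⟩ := hq
    -- The Lagrange polynomial for column p on the nodes 1, …, m, in the column number (gα₀ +
    -- eα₂)/b.
    have h1 : IsPolyFun (m - 1) fun α : Fin 3 →₀ ℕ =>
        ∏ s ∈ (Finset.Icc 1 m).erase p, ((b : k)⁻¹ * (g * α 0 + e * α 2) + -(s : k)) := by
      have h2 := IsPolyFun.prod (σ := Fin 3) (k := k) ((Finset.Icc 1 m).erase p)
        (φ := fun s α => (b : k)⁻¹ * (g * α 0 + e * α 2) + -(s : k)) fun s _ =>
          (IsPolyFun.const_mul _ (((IsPolyFun.coord 0).const_mul _).add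
            ((IsPolyFun.coord 2).const_mul _))).add ((IsPolyFun.const _).mono zero_le_one)
      rwa [Finset.card_erase_of_mem (by simp; omega), Nat.card_Icc, Nat.add_sub_cancel] at h2
    have h3 := hF'.moment_eq_zero h1 (by omega)
    have h4 : ∏ s ∈ (Finset.Icc 1 m).erase p, ((p : k) + -(s : k)) ≠ 0 := by
      rw [Finset.prod_ne_zero_iff]
      intro s hs
      rw [← sub_eq_add_neg, sub_ne_zero]
      exact_mod_cast (Finset.ne_of_mem_erase hs).symm
    have h5 : ∀ α ∈ F.support, ∏ s ∈ (Finset.Icc 1 m).erase p,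
        ((b : k)⁻¹ * (g * α 0 + e * α 2) + -(s : k)) =
        (∏ s ∈ (Finset.Icc 1 m).erase p, ((p : k) + -(s : k))) *
          (if g * α 0 + e * α 2 = p * b ∧ g * α 1 + f * α 2 = (m - p) * a then 1 else 0) := by
      intro α hα
      obtain ⟨r, hr, h6, h7⟩ := hcol α hα
      have h8 : (b : k)⁻¹ * (g * α 0 + e * α 2) = r := by
        have : ((g * α 0 + e * α 2 : ℕ) : k) = r * b := by rw [h6]; push_cast; ring
        push_cast at this
        rw [this]; field_simp
      rw [h8]
      by_cases hrp : r = p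
      · subst hrp
        rw [if_pos ⟨h6, h7⟩, mul_one]
      · rw [if_neg, mul_zero]
        · refine Finset.prod_eq_zero (i := r) ?_ (by ring)
          have : r ≠ 0 := by
            rintro rfl
            rw [zero_mul] at h6
            exact hp0 α hα h6
          simp [hrp]; omega
        · rintro ⟨h9, -⟩
          exact hrp (Nat.eq_of_mul_eq_mul_right hb (h6.symm.trans h9))
    rw [moment_congr h5, moment_const_mul] at h3
    exact (mul_eq_zero.1 h3).resolve_left h4
  · rw [moment_eq_sum]
    refine Finset.sum_eq_zero fun α hα => ?_
    rw [if_neg, mul_zero]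
    rintro ⟨rfl, rfl⟩
    obtain ⟨p, hp, h6, h7⟩ := hcol α hα
    refine hq ⟨p, hp, Nat.pos_of_ne_zero ?_, h6, h7⟩
    rintro rfl
    rw [zero_mul] at h6
    exact hp0 α hα h6

/-- The congruences er ≡ -b and fr ≡ a modulo g are compatible because ae + bf ≡ 0. The residue r
determines the exponents of z that occur in each column. -/
lemma exists_residue (hg : 0 < g) (hefg : Nat.gcd (Nat.gcd e f) g = 1)
    (hrel : a * e + b * f = c * g) :
    ∃ r < g, (g : ℤ) ∣ e * r + b ∧ (g : ℤ) ∣ f * r - a := by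
  have hrel' : (a * e + b * f : ℤ) = c * g := by exact_mod_cast hrel
  have h1 := Nat.gcd_eq_gcd_ab e f
  have h2 := Nat.gcd_eq_gcd_ab (Nat.gcd e f) g
  rw [hefg, h1] at h2
  push_cast at h2
  set s := (e.gcdA f) * (e.gcd f).gcdA g
  set t := (e.gcdB f) * (e.gcd f).gcdA g
  have h3 : (1 : ℤ) = e * s + f * t + g * (e.gcd f).gcdB g := by
    rw [h2]; simp only [s, t]; ring
  set u := (e.gcd f).gcdB g
  have hg' : (0 : ℤ) < g := by exact_mod_cast hg
  -- With 1 = es + ft + gu, a solution is ta - sb; it is reduced modulo g.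
  obtain ⟨r, hr⟩ := Int.eq_ofNat_of_zero_le (Int.emod_nonneg (t * a - s * b) hg'.ne')
  have hr' : (t * a - s * b) = g * ((t * a - s * b) / g) + r := by
    rw [← hr]; exact (Int.mul_ediv_add_emod _ _).symm
  set w := (t * a - s * b) / (g : ℤ)
  refine ⟨r, ?_, ⟨t * c + u * b - e * w, ?_⟩, ⟨-s * c - u * a - f * w, ?_⟩⟩
  · have := Int.emod_lt_of_pos (t * a - s * b) hg'
    omega
  · linear_combination -(e : ℤ) * hr' + t * hrel' + b * h3
  · linear_combination -(f : ℤ) * hr' - s * hrel' - a * h3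

end Columns

/-! ### Condition (2) yields the test function, so the binomial divides every form. -/

section Interpolation

open MvPolynomial

variable {a b c e f g : ℕ}

/-- In the column q = m - p all exponents of z are congruent to qr modulo g; divisibility of m by g
makes the conditions coming from x and from y agree. -/
lemma dvd_sub_of_column (hefg : Nat.gcd (Nat.gcd e f) g = 1) {r : ℤ} (hr1 : (g : ℤ) ∣ e * r + b)
    (hr2 : (g : ℤ) ∣ f * r - a) {m p q i j l : ℕ} (hm : g ∣ m) (hpq : p + q = m)
    (h1 : g * i + e * l = p * b) (h2 : g * j + f * l = q * a) : (g : ℤ) ∣ l - q * r := by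
  obtain ⟨s, hs⟩ := hr1
  obtain ⟨t, ht⟩ := hr2
  obtain ⟨m', rfl⟩ := hm
  zify at hpq h1 h2
  refine dvd_of_dvd_mul_of_gcd hefg ⟨m' * b - i - q * s, ?_⟩ ⟨-j - q * t, ?_⟩
  · linear_combination h1 - q * hs + b * hpq
  · linear_combination h2 - q * ht

variable {k : Type*} [Field k] [CharZero k]

/-- Columns are numbered here by q = m - p, so the column to be separated is q = m = M + 1 and the
test function, of degree M, has to vanish for q = 0, …, M. Linear factors in q kill most columns;
the few short columns near q = 0, and in the second case also q = M, are handled by a factor that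
involves the exponent of z. -/
lemma curve_dvd_of_vanishesToOrder (ha : 0 < a) (hb : 0 < b) (hg : 0 < g) (he : 0 < e) (hf : 0 < f)
    (habc : Nat.gcd (Nat.gcd a b) c = 1) (hefg : Nat.gcd (Nat.gcd e f) g = 1)
    (hrel : a * e + b * f = c * g) {r n : ℕ} (hr : r < g) (hr1 : (g : ℤ) ∣ e * r + b)
    (hr2 : (g : ℤ) ∣ f * r - a) (hleft : ∀ l : ℕ, e * l ≤ b → (g : ℤ) ∣ l + r →
      ∃ t < n, l + r = g * (1 + t))
    (hright : f * (r + g) ≤ a → ∀ q < n, ∀ l : ℕ, f * l ≤ q * a → (g : ℤ) ∣ l - q * r →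
      ∃ t ≤ q, l = q * r + g * t) (hnr : ¬ g ∣ n * r)
    {m d : ℕ} (hgm : g ∣ m) (hm : n + 2 ≤ m) (hd : d * g = m * a * b) (hbd : b ∣ d)
    {F : MvPolynomial (Fin 3) k} (hF : F.IsWeightedHomogeneous ![a, b, c] d)
    (hF' : VanishesToOrder m F) : curve k e f g ∣ F := by
  have ha' : (a : k) ≠ 0 := by exact_mod_cast ha.ne'
  have hg' : (g : k) ≠ 0 := by exact_mod_cast hg.ne'
  have hr0 : r ≠ 0 := by rintro rfl; exact hnr ⟨0, by ring⟩
  have hQ : IsPolyFun 1 fun α : Fin 3 →₀ ℕ => (a : k)⁻¹ * (g * α 1 + f * α 2) :=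
    IsPolyFun.const_mul _ (((IsPolyFun.coord 1).const_mul _).add
            ((IsPolyFun.coord 2).const_mul _))
  have hL : IsPolyFun 1 fun α : Fin 3 →₀ ℕ =>
      (α 2 : k) + -(r : k) * ((a : k)⁻¹ * (g * α 1 + f * α 2)) :=
    (IsPolyFun.coord 2).add (hQ.const_mul _)
  have hQi : ∀ i : ℕ, IsPolyFun 1 fun α : Fin 3 →₀ ℕ =>
      (a : k)⁻¹ * (g * α 1 + f * α 2) + -(i : k) := fun i =>
    hQ.add ((IsPolyFun.const _).mono zero_le_one)
  have hQe : ∀ (α : Fin 3 →₀ ℕ) (q : ℕ), g * α 1 + f * α 2 = q * a →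
      (a : k)⁻¹ * (g * α 1 + f * α 2) = q := by
    intro α q h
    have : ((g * α 1 + f * α 2 : ℕ) : k) = q * a := by rw [h]; push_cast; ring
    push_cast at this
    rw [this]; field_simp
  have hprod : ∀ (q : ℕ) (s : Finset ℕ), q ∈ s → ∏ i ∈ s, ((q : k) + -(i : k)) = 0 :=
    fun q s h => Finset.prod_eq_zero h (by ring)
  have hprod' : ∀ (q : ℕ) (s : Finset ℕ), q ∉ s → ∏ i ∈ s, ((q : k) + -(i : k)) ≠ 0 := by
    intro q s h
    rw [Finset.prod_ne_zero_iff]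
    intro i hi
    rw [← sub_eq_add_neg, sub_ne_zero]
    exact_mod_cast fun h' : q = i => h (h' ▸ hi)
  obtain ⟨M, rfl⟩ : ∃ M, m = M + 1 := ⟨m - 1, by omega⟩
  have hMa : ∀ α : Fin 3 →₀ ℕ, α 2 = 0 → g * α 1 = (M + 1) * a →
      g * α 1 + f * α 2 = (M + 1) * a := fun α h1 h2 => by rw [h1, h2, mul_zero, add_zero]
  rcases lt_or_ge a (f * (r + g)) with hcase | hcase
  -- Here column q = 1 is too short to contain an exponent of z other than r, so the linear form l -
  -- rq kills columns 0 and 1, and M - 1 linear factors kill columns 2, …, M.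
  · have hφ : IsPolyFun (M + 1 - 1) fun α : Fin 3 →₀ ℕ =>
        ((α 2 : k) + -(r : k) * ((a : k)⁻¹ * (g * α 1 + f * α 2))) *
          ∏ i ∈ Finset.Ico 2 (M + 1), ((a : k)⁻¹ * (g * α 1 + f * α 2) + -(i : k)) := by
      have := hL.mul (IsPolyFun.prod (Finset.Ico 2 (M + 1)) fun i _ => hQi i)
      rw [Nat.card_Ico] at this
      exact this.mono (by omega)
    refine curve_dvd_of_isPolyFun ha hb hg habc hefg he hrel (by omega) hd hbd hφ ?_ ?_ hF hF'
    · intro α p hp hp0 h1 h2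
      obtain ⟨q, hpq⟩ := Nat.exists_eq_add_of_le hp
      rw [show M + 1 - p = q by omega] at h2
      rw [hQe α q h2]
      have h3 := dvd_sub_of_column hefg hr1 hr2 hgm hpq.symm h1 h2
      have h4 : f * α 2 ≤ q * a := by rw [← h2]; exact Nat.le_add_left _ _
      rcases Nat.lt_or_ge q 2 with hq | hq
      · suffices h : (α 2 : k) + -(r : k) * q = 0 by rw [h, zero_mul]
        have h5 : α 2 = r * q := by
          interval_cases q
          · have : f * α 2 = 0 := by omega
            rcases Nat.mul_eq_zero.1 this with h | h <;> omega
          · obtain ⟨t, ht⟩ := h3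
            have h6 : α 2 < r + g := by
              refine Nat.lt_of_mul_lt_mul_left (a := f) ?_
              omega
            have h7 : t < 1 := by
              by_contra! h
              have : (g : ℤ) * 1 ≤ g * t := mul_le_mul_of_nonneg_left h (by positivity)
              push_cast at ht; omega
            have h8 : -1 < t := by
              by_contra! h
              have : (g : ℤ) * t ≤ g * (-1) := mul_le_mul_of_nonneg_left h (by positivity)
              push_cast at ht; omega
            have h9 : t = 0 := by omega
            rw [h9] at ht
            push_cast at ht
            omega
        rw [h5]; push_cast; ring
      · rw [hprod q _ (by simp; omega), mul_zero]
    · intro α h0 h1 h2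
      rw [hQe α _ (hMa α h1 h2), h1]
      refine mul_ne_zero ?_ (hprod' _ _ (by simp))
      simp only [Nat.cast_zero, zero_add, neg_mul, neg_ne_zero]
      exact mul_ne_zero (by exact_mod_cast hr0) (by exact_mod_cast Nat.succ_ne_zero M)
  · obtain ⟨m', hm'⟩ := hgm
    -- The interpolant, of degree n, is evaluated at t = (l - rq)/g. It kills columns q < n, where 0
    -- ≤ t ≤ q, and the linear factors kill n ≤ q < M. The parameter y = rm' - 1, where m = gm',
    -- serves the columns M and M + 1 at once.
    have hφ : IsPolyFun (M + 1 - 1) fun α : Fin 3 →₀ ℕ =>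
        interpolant n (M : k) (-1 - -(r * m' : k)) ((a : k)⁻¹ * (g * α 1 + f * α 2))
          ((g : k)⁻¹ * ((α 2 : k) + -(r : k) * ((a : k)⁻¹ * (g * α 1 + f * α 2)))) *
          ∏ i ∈ Finset.Ico n M, ((a : k)⁻¹ * (g * α 1 + f * α 2) + -(i : k)) := by
      have := (isPolyFun_interpolant n (M : k) (-1 - -(r * m' : k)) hQ (hL.const_mul (g : k)⁻¹)).mul
        (IsPolyFun.prod (Finset.Ico n M) fun i _ => hQi i)
      rw [Nat.card_Ico] at this
      exact this.mono (by omega)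
    refine curve_dvd_of_isPolyFun ha hb hg habc hefg he hrel (by omega) hd hbd hφ ?_ ?_ hF hF'
    · intro α p hp hp0 h1 h2
      obtain ⟨q, hpq⟩ := Nat.exists_eq_add_of_le hp
      rw [show M + 1 - p = q by omega] at h2
      simp only [hQe α q h2]
      have h3 := dvd_sub_of_column hefg hr1 hr2 ⟨m', hm'⟩ hpq.symm h1 h2
      have h4 : f * α 2 ≤ q * a := by rw [← h2]; exact Nat.le_add_left _ _
      rcases Nat.lt_or_ge q n with hq | hq
      · obtain ⟨t, ht, h5⟩ := hright hcase q hq _ h4 h3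
        have h6 : (g : k)⁻¹ * ((α 2 : k) + -(r : k) * q) = t := by
          rw [h5]; push_cast; field_simp; ring
        rw [h6, interpolant_eq_zero _ _ ht hq, zero_mul]
      rcases Nat.lt_or_ge q M with hq' | hq'
      · rw [hprod q _ (by simp; omega), mul_zero]
      · have hqM : q = M := by omega
        have hp1 : p = 1 := by omega
        subst hqM hp1
        obtain ⟨t, ht, h5⟩ := hleft (α 2) (by
          rw [one_mul] at h1; rw [← h1]; exact Nat.le_add_left _ _) (by
            have : (α 2 : ℤ) + r = (α 2 - q * r) + g * (m' * r) := by
              zify at hm'; linear_combination (r : ℤ) * hm'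
            rw [this]
            exact dvd_add h3 ⟨_, rfl⟩)
        -- In column M the value y + (l - rq)/g is the index of the point, an integer in [0, n), so
        -- C(y + t, n) vanishes.
        have h6 : (-1 - -(r * m' : k)) + (g : k)⁻¹ * ((α 2 : k) + -(r : k) * q) = t := by
          have h7 : ((α 2 : k) + r) = g * (1 + t) := by
            exact_mod_cast congrArg (Nat.cast (R := k)) h5
          have h8 : (q + 1 : k) = g * m' := by exact_mod_cast congrArg (Nat.cast (R := k)) hm'
          field_simp
          linear_combination h7 - (r : k) * h8
        rw [interpolant_self (by omega), h6, Ring.choose_natCast, Nat.choose_eq_zero_of_lt ht]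
        simp
    · intro α h0 h1 h2
      simp only [hQe α _ (hMa α h1 h2)]
      rw [h1]
      refine mul_ne_zero ?_ (hprod' _ _ (by simp))
      have h8 : (M + 1 : k) = g * m' := by exact_mod_cast congrArg (Nat.cast (R := k)) hm'
      have h6 : (g : k)⁻¹ * (((0 : ℕ) : k) + -(r : k) * (M + 1 : ℕ)) = -(r * m') := by
        push_cast
        rw [h8]; field_simp; ring
      rw [h6]
      intro h
      -- In column M + 1 the only point has l = 0, hence t = -rm' and y = -1 - t. The value is, up
      -- to a nonzero factor, m'(g - nr), and g = nr would contradict the last part of condition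
      -- (2).
      have h9 := interpolant_succ (k := k) (n := n) (M := M) (by omega) (-(r * m' : k))
      rw [h, zero_mul, eq_comm] at h9
      rcases mul_eq_zero.1 h9 with h10 | h10
      · exact absurd h10 (pow_ne_zero _ (by norm_num))
      · push_cast at h10
        rw [h8] at h10
        have hm0 : (m' : k) ≠ 0 := by
          intro h; rw [h, mul_zero] at h8
          exact absurd h8 (by exact_mod_cast Nat.succ_ne_zero M)
        have h11 : (m' : k) * (g - n * r) = 0 := by linear_combination h10
        have h12 := (mul_eq_zero.1 h11).resolve_left hm0
        rw [sub_eq_zero] at h12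
        exact hnr ⟨1, by rw [mul_one]; exact_mod_cast h12.symm⟩

end Interpolation

/-! ### The multiplicity of the binomial is bounded for some forms. -/

section NotDivisible

open MvPolynomial

section BivariateDegree

variable {k : Type*} [Field k]

/-- `P ∈ k[X][Y]` has total degree at most `d`. -/
def BivariateDegreeLE (d : ℕ) (P : Polynomial (Polynomial k)) : Prop :=
  ∀ i j, d < i + j → (P.coeff i).coeff j = 0

namespace BivariateDegreeLE

lemma mono {d d' : ℕ} (h : d ≤ d') {P : Polynomial (Polynomial k)} (hP : BivariateDegreeLE d P) :
    BivariateDegreeLE d' P := fun i j hij => hP i j (by omega)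

lemma add {d : ℕ} {P Q : Polynomial (Polynomial k)} (hP : BivariateDegreeLE d P)
    (hQ : BivariateDegreeLE d Q) : BivariateDegreeLE d (P + Q) := fun i j hij => by
  rw [Polynomial.coeff_add, Polynomial.coeff_add, hP i j hij, hQ i j hij, add_zero]

lemma mul {d d' : ℕ} {P Q : Polynomial (Polynomial k)} (hP : BivariateDegreeLE d P)
    (hQ : BivariateDegreeLE d' Q) : BivariateDegreeLE (d + d') (P * Q) := fun i j hij => by
  rw [Polynomial.coeff_mul, Polynomial.finsetSum_coeff]
  refine Finset.sum_eq_zero fun x hx => ?_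
  rw [Polynomial.coeff_mul]
  refine Finset.sum_eq_zero fun y hy => ?_
  rw [Finset.HasAntidiagonal.mem_antidiagonal] at hx hy
  rcases lt_or_ge d (x.1 + y.1) with h | h
  · rw [hP _ _ h, zero_mul]
  · rw [hQ _ _ (by omega), mul_zero]

lemma const (r : k) : BivariateDegreeLE 0 (Polynomial.C (Polynomial.C r)) := fun i j hij => by
  rw [Polynomial.coeff_C]
  split_ifs with h
  · rw [Polynomial.coeff_C, if_neg (by omega)]
  · rw [Polynomial.coeff_zero]

lemma X : BivariateDegreeLE 1 (Polynomial.X : Polynomial (Polynomial k)) := fun i j hij => by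
  rw [Polynomial.coeff_X]
  split_ifs with h
  · rw [Polynomial.coeff_one, if_neg (by omega)]
  · rw [Polynomial.coeff_zero]

lemma C_X : BivariateDegreeLE 1 (Polynomial.C Polynomial.X : Polynomial (Polynomial k)) :=
  fun i j hij => by
  rw [Polynomial.coeff_C]
  split_ifs with h
  · rw [Polynomial.coeff_X, if_neg (by omega)]
  · rw [Polynomial.coeff_zero]

lemma pow {P : Polynomial (Polynomial k)} (hP : BivariateDegreeLE 1 P) (n : ℕ) :
    BivariateDegreeLE n (P ^ n) := by
  induction n with
  | zero => simpa using const (1 : k)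
  | succ n ih => rw [pow_succ]; exact ih.mul hP

lemma sum {ι : Type*} (s : Finset ι) {d : ℕ} {P : ι → Polynomial (Polynomial k)}
    (h : ∀ i ∈ s, BivariateDegreeLE d (P i)) : BivariateDegreeLE d (∑ i ∈ s, P i) :=
  fun i j hij => by
  rw [Polynomial.finsetSum_coeff, Polynomial.finsetSum_coeff]
  exact Finset.sum_eq_zero fun x hx => h x hx i j hij

lemma prod {ι : Type*} (s : Finset ι) {d : ι → ℕ} {P : ι → Polynomial (Polynomial k)}
    (h : ∀ i ∈ s, BivariateDegreeLE (d i) (P i)) :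
    BivariateDegreeLE (∑ i ∈ s, d i) (∏ i ∈ s, P i) := by
  classical
  induction s using Finset.induction_on with
  | empty => simpa using const (1 : k)
  | insert a s ha ih =>
    rw [Finset.prod_insert ha, Finset.sum_insert ha]
    exact (h a (Finset.mem_insert_self _ _)).mul
      (ih fun i hi => h i (Finset.mem_insert_of_mem hi))

lemma eval₂ {σ : Type*} [Fintype σ] {v : σ → Polynomial (Polynomial k)}
    (hv : ∀ i, BivariateDegreeLE 1 (v i)) {G : MvPolynomial σ k} {d : ℕ} (hG : G.totalDegree ≤ d) :
    BivariateDegreeLE d (MvPolynomial.eval₂ (Polynomial.C.comp Polynomial.C) v G) := by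
  rw [MvPolynomial.eval₂_eq']
  refine sum _ fun γ hγ => ?_
  have h1 := (const (coeff γ G)).mul (prod Finset.univ fun i _ => (hv i).pow (γ i))
  refine h1.mono ?_
  have h2 : γ.degree ≤ G.totalDegree := le_totalDegree hγ
  rw [Finsupp.degree_eq_sum] at h2
  omega

end BivariateDegreeLE

end BivariateDegree

variable {a b c e f g : ℕ}

/-- The exponents of z allowed in column q form a progression of step g starting at ρ = qr mod g <
g, so room for gt units of z leaves t points. -/
lemma exists_points (hg : 0 < g) {r : ℕ} (hr1 : (g : ℤ) ∣ e * r + b)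
    (hr2 : (g : ℤ) ∣ f * r - a) (hrel : a * e + b * f = c * g) {m d p q t : ℕ} (hgm : g ∣ m)
    (hd : d * g = m * a * b) (hpq : p + q = m) (h1 : e * g * t ≤ p * b) (h2 : f * g * t ≤ q * a) :
    ∃ ρ, ∀ s < t, ∃ i j, g * i + e * (ρ + g * s) = p * b ∧ g * j + f * (ρ + g * s) = q * a ∧
      a * i + b * j + c * (ρ + g * s) = d := by
  have hdm := Nat.div_add_mod (q * r) g
  have hml := Nat.mod_lt (q * r) hg
  refine ⟨(q * r) % g, fun s hs => ?_⟩
  set ρ := (q * r) % g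
  set w := (q * r) / g
  have h3 : ρ + g * s ≤ g * t := by
    have : g * (s + 1) ≤ g * t := Nat.mul_le_mul_left _ hs
    rw [mul_add] at this; omega
  have h4 : e * (ρ + g * s) ≤ p * b := by
    refine le_trans ?_ h1; rw [mul_assoc]; exact Nat.mul_le_mul_left _ h3
  have h5 : f * (ρ + g * s) ≤ q * a := by
    refine le_trans ?_ h2; rw [mul_assoc]; exact Nat.mul_le_mul_left _ h3
  obtain ⟨m', rfl⟩ := hgm
  obtain ⟨u, hu⟩ := hr1
  obtain ⟨v, hv⟩ := hr2
  have hdm' : (g * w + ρ : ℤ) = q * r := by exact_mod_cast hdm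
  have hpq' : (p + q : ℤ) = g * m' := by exact_mod_cast hpq
  have h6 : g ∣ p * b - e * (ρ + g * s) := by
    zify [h4]
    exact ⟨m' * b - q * u + e * w - e * s, by
      linear_combination b * hpq' - q * hu - e * hdm'⟩
  have h7 : g ∣ q * a - f * (ρ + g * s) := by
    zify [h5]
    exact ⟨- q * v + f * w - f * s, by linear_combination - q * hv - f * hdm'⟩
  obtain ⟨i, hi⟩ := h6
  obtain ⟨j, hj⟩ := h7
  have h8 : g * i + e * (ρ + g * s) = p * b := by omega
  have h9 : g * j + f * (ρ + g * s) = q * a := by omega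
  refine ⟨i, j, h8, h9, Nat.eq_of_mul_eq_mul_right hg ?_⟩
  rw [hd, ← hpq]
  zify at h8 h9 hrel ⊢
  linear_combination a * h8 + b * h9 - (ρ + g * s) * hrel

lemma exists_ceil (x : ℕ) {y : ℕ} (hy : 0 < y) : ∃ z, x ≤ z * y ∧ z * y < x + y := by
  refine ⟨(x + y - 1) / y, ?_, ?_⟩
  · have h1 := Nat.div_add_mod (x + y - 1) y
    have h2 := Nat.mod_lt (x + y - 1) hy
    rw [mul_comm]; omega
  · have := Nat.div_mul_le_self (x + y - 1) y
    omega

/-- Column p has t points once egt/b ≤ p ≤ m - fgt/a. The two excluded lengths add up to g²ct/(ab),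
which by w < 1 is at most t - t/(ab); the bound t ≥ 2ab absorbs the rounding at both ends. -/
lemma exists_columns (ha : 0 < a) (hb : 0 < b) (hrel : a * e + b * f = c * g)
    (hw : g ^ 2 * c < a * b) {m t : ℕ} (ht : 2 * (a * b) ≤ t) (htm : t ≤ m) :
    ∃ C : Finset ℕ, m - t + 2 ≤ C.card ∧ ∀ p ∈ C, p ≤ m ∧ e * g * t ≤ p * b ∧
      f * g * t ≤ (m - p) * a := by
  obtain ⟨A, hA1, hA2⟩ := exists_ceil (e * g * t) hb
  obtain ⟨B, hB1, hB2⟩ := exists_ceil (f * g * t) ha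
  have h1 : (a * b) * (A + B) < (a * b) * t := by
    have h2 : (g ^ 2 * c + 1) * t ≤ a * b * t := Nat.mul_le_mul_right _ hw
    have h3 : a * (e * g * t) + b * (f * g * t) = g ^ 2 * c * t := by
      linear_combination (g * t) * hrel
    have h4 : a * (A * b) < a * (e * g * t + b) := Nat.mul_lt_mul_of_pos_left hA2 ha
    have h5 : b * (B * a) < b * (f * g * t + a) := Nat.mul_lt_mul_of_pos_left hB2 hb
    have h6 : a * b * (A + B) = a * (A * b) + b * (B * a) := by ring
    have h7 : a * (e * g * t + b) + b * (f * g * t + a) = g ^ 2 * c * t + 2 * (a * b) := by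
      rw [← h3]; ring
    have h8 : (g ^ 2 * c + 1) * t = g ^ 2 * c * t + t := by ring
    omega
  have h2 : A + B < t := Nat.lt_of_mul_lt_mul_left h1
  refine ⟨Finset.Icc A (m - B), ?_, ?_⟩
  · rw [Nat.card_Icc]; omega
  · intro p hp
    rw [Finset.mem_Icc] at hp
    refine ⟨by omega, hA1.trans (Nat.mul_le_mul_right _ hp.1),
      hB1.trans (Nat.mul_le_mul_right _ (by omega))⟩

variable {k : Type*} [Field k] [CharZero k]

/-- By contradiction: put t₁ = 2ab and take a column p₀ with t₁ + 1 points. Divisibility of all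
forms by the power t₁ + 1 makes them orthogonal to the function equal to l^t₁ on column p₀ and zero
elsewhere. By duality this function agrees with a polynomial of degree below m, and counting zeros
on long columns rules that out. -/
lemma exists_not_curve_pow_dvd (ha : 0 < a) (hb : 0 < b) (hg : 0 < g)
    (hrel : a * e + b * f = c * g) (hc : 0 < c)
    (hw : g ^ 2 * c < a * b) {r : ℕ} (hr1 : (g : ℤ) ∣ e * r + b)
    (hr2 : (g : ℤ) ∣ f * r - a)
    {m d : ℕ} (hgm : g ∣ m) (hm : 2 * (a * b) + 1 ≤ m) (hd : d * g = m * a * b) :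
    ∃ F : MvPolynomial (Fin 3) k, F.IsWeightedHomogeneous ![a, b, c] d ∧ VanishesToOrder m F ∧
      ¬ curve k e f g ^ (2 * (a * b) + 1) ∣ F := by
  classical
  by_contra! hcon
  set t₁ := 2 * (a * b) with ht₁
  have hfin : {α : Fin 3 →₀ ℕ | a * α 0 + b * α 1 + c * α 2 = d}.Finite := by
    refine (Finsupp.finite_of_degree_le (σ := Fin 3) d).subset ?_
    intro α hα
    simp only [Set.mem_ofPred_eq] at hα ⊢
    rw [Finsupp.degree_eq_sum, Fin.sum_univ_three, ← hα]
    exact add_le_add (add_le_add (Nat.le_mul_of_pos_left _ ha) (Nat.le_mul_of_pos_left _ hb))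
      (Nat.le_mul_of_pos_left _ hc)
  obtain ⟨C₀, hC₀, hC₀'⟩ := exists_columns (e := e) (f := f) ha hb hrel hw (m := m) (t := t₁ + 1)
    (by omega) hm
  obtain ⟨p₀, hp₀⟩ : C₀.Nonempty := Finset.card_pos.1 (by omega)
  obtain ⟨hp₀m, hp₀1, hp₀2⟩ := hC₀' p₀ hp₀
  obtain ⟨φ, ⟨G, hGd, hG⟩, hφ⟩ := exists_isPolyFun_of_forall_moment_eq_zero (k := k) (m := m)
    (by omega) hfin.toFinset
    (fun α => (if g * α 0 + e * α 2 = p₀ * b ∧ g * α 1 + f * α 2 = (m - p₀) * a then 1 else 0) *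
      (Polynomial.X ^ t₁ : Polynomial k).eval (α 2 : k)) (by
      intro F hF hF'
      have hFd : F.IsWeightedHomogeneous ![a, b, c] d := by
        intro α hα
        have := hF (mem_support_iff.2 hα)
        simp only [Set.Finite.mem_toFinset, Set.mem_ofPred_eq] at this
        rw [Finsupp.weight_apply, Finsupp.sum_fintype _ _ (by simp), Fin.sum_univ_three, ← this]
        simp [mul_comm]
      exact moment_eq_zero_of_curve_pow_dvd e f g (hcon F hFd hF') (Polynomial.X ^ t₁)
        (by rw [Polynomial.degree_X_pow]; exact_mod_cast Nat.lt_succ_self t₁)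
        (fun q q' => if q = p₀ * b ∧ q' = (m - p₀) * a then 1 else 0))
  have hg' : (g : k) ≠ 0 := by exact_mod_cast hg.ne'
  -- In degree d the three exponents are affine in the column number p (inner variable) and the
  -- exponent of z (outer variable), so G becomes a bivariate polynomial P of total degree at most m
  -- - 1.
  let v : Fin 3 → Polynomial (Polynomial k) :=
    ![Polynomial.C (Polynomial.C (b / g : k)) * Polynomial.C Polynomial.X +
        Polynomial.C (Polynomial.C (-e / g : k)) * Polynomial.X,
      Polynomial.C (Polynomial.C (m * a / g : k)) + (Polynomial.C (Polynomial.C (-a / g : k)) *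
        Polynomial.C Polynomial.X + Polynomial.C (Polynomial.C (-f / g : k)) * Polynomial.X),
      Polynomial.X]
  have hv : ∀ i, BivariateDegreeLE 1 (v i) := by
    have h1 : ∀ x y : k, BivariateDegreeLE 1 (Polynomial.C (Polynomial.C x) *
        Polynomial.C Polynomial.X + Polynomial.C (Polynomial.C y) * Polynomial.X) := fun x y =>
      (((BivariateDegreeLE.const x).mul BivariateDegreeLE.C_X).mono (zero_add 1).le).add
        (((BivariateDegreeLE.const y).mul BivariateDegreeLE.X).mono (zero_add 1).le)
    intro i
    fin_cases i
    · exact h1 _ _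
    · exact ((BivariateDegreeLE.const _).mono zero_le_one).add (h1 _ _)
    · exact BivariateDegreeLE.X
  set P := MvPolynomial.eval₂ (Polynomial.C.comp Polynomial.C) v G with hPdef
  have hP : BivariateDegreeLE (m - 1) P := BivariateDegreeLE.eval₂ hv hGd
  have hPe : ∀ (α : Fin 3 →₀ ℕ) (p : ℕ), p ≤ m → g * α 0 + e * α 2 = p * b →
      g * α 1 + f * α 2 = (m - p) * a →
      φ α = (P.map (Polynomial.evalRingHom (p : k))).eval (α 2 : k) := by
    intro α p hp h1 h2
    rw [hG]
    have h3 : (MvPolynomial.eval fun i => (α i : k)) =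
        ((Polynomial.evalRingHom (α 2 : k)).comp
          (Polynomial.mapRingHom (Polynomial.evalRingHom (p : k)))).comp
          (MvPolynomial.eval₂Hom (Polynomial.C.comp Polynomial.C) v) := by
      refine MvPolynomial.ringHom_ext (fun r => by simp) fun i => ?_
      have h1' : (g * α 0 + e * α 2 : k) = p * b := by
        exact_mod_cast congrArg (Nat.cast (R := k)) h1
      have h2' : (g * α 1 + f * α 2 : k) = (m - p) * a := by
        rw [← Nat.cast_sub hp]; exact_mod_cast congrArg (Nat.cast (R := k)) h2
      fin_cases i
      · simp [v]
        field_simp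
        linear_combination h1'
      · simp [v]
        field_simp
        linear_combination h2'
      · simp [v]
    rw [h3]
    rfl
  have hcolP : ∀ p t, p ≤ m → e * g * t ≤ p * b → f * g * t ≤ (m - p) * a →
      ∃ S : Finset k, S.card = t ∧ ∀ x ∈ S,
        (P.map (Polynomial.evalRingHom (p : k))).eval x = if p = p₀ then x ^ t₁ else 0 := by
    intro p t hp h1 h2
    obtain ⟨ρ, hρ⟩ := exists_points hg hr1 hr2 hrel hgm hd (Nat.add_sub_cancel' hp) h1 h2
    refine ⟨(Finset.range t).image fun s => ((ρ + g * s : ℕ) : k), ?_, ?_⟩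
    · rw [Finset.card_image_of_injective, Finset.card_range]
      intro s s' h
      have h3 : ρ + g * s = ρ + g * s' := Nat.cast_injective (R := k) h
      exact Nat.eq_of_mul_eq_mul_left hg (Nat.add_left_cancel h3)
    · intro x hx
      obtain ⟨s, hs, rfl⟩ := Finset.mem_image.1 hx
      obtain ⟨i, j, h3, h4, h5⟩ := hρ s (Finset.mem_range.1 hs)
      have h6 := hPe (expo i j (ρ + g * s)) p hp h3 h4
      rw [expo_two] at h6
      rw [← h6, ← hφ _ (by simpa using h5)]
      simp only [expo_zero, expo_one, expo_two, h3, h4, Polynomial.eval_pow, Polynomial.eval_X]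
      by_cases hpp : p = p₀
      · subst hpp; simp
      · rw [if_neg hpp, if_neg, zero_mul]
        rintro ⟨h7, -⟩
        exact hpp (Nat.eq_of_mul_eq_mul_right hb h7)
  -- Descending induction on i. Once the higher coefficients vanish, P(p,·) has degree at most i and
  -- is zero for each of at least m - i columns p ≠ p₀ with i + 1 points. The coefficient of index i
  -- has degree at most m - 1 - i in p, so it vanishes.
  have hPcoeff : ∀ s i, t₁ ≤ i → m ≤ i + s → P.coeff i = 0 := by
    intro s
    induction s with
    | zero =>
      intro i _ hi
      ext j
      rw [hP i j (by omega), Polynomial.coeff_zero]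
    | succ s ih =>
      intro i hi1 hi2
      rcases le_or_gt m i with hmi | hmi
      · ext j
        rw [hP i j (by omega), Polynomial.coeff_zero]
      obtain ⟨C, hC, hC'⟩ := exists_columns (e := e) (f := f) ha hb hrel hw (m := m) (t := i + 1)
        (by omega) hmi
      refine Polynomial.eq_zero_of_natDegree_lt_card_of_eval_eq_zero' _
        ((C.erase p₀).image (Nat.cast : ℕ → k)) ?_ ?_
      · intro x hx
        obtain ⟨p, hp, rfl⟩ := Finset.mem_image.1 hx
        obtain ⟨h1, h2, h3⟩ := hC' p (Finset.mem_of_mem_erase hp)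
        obtain ⟨S, hS, hS'⟩ := hcolP p (i + 1) h1 h2 h3
        have h4 : P.map (Polynomial.evalRingHom (p : k)) = 0 := by
          refine Polynomial.eq_zero_of_natDegree_lt_card_of_eval_eq_zero' _ S ?_ ?_
          · intro x hx
            rw [hS' x hx, if_neg (Finset.ne_of_mem_erase hp)]
          · rw [hS, Nat.lt_succ_iff, Polynomial.natDegree_le_iff_coeff_eq_zero]
            intro i' hi'
            rw [Polynomial.coeff_map, ih i' (by omega) (by omega), map_zero]
        have h5 := congrArg (fun Q => Polynomial.coeff Q i) h4
        simpa [Polynomial.coeff_map] using h5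
      · rw [Finset.card_image_of_injective _ Nat.cast_injective]
        have h1 : C.card - 1 ≤ (C.erase p₀).card := Finset.pred_card_le_card_erase
        have h2 : (P.coeff i).natDegree ≤ m - 1 - i := by
          rw [Polynomial.natDegree_le_iff_coeff_eq_zero]
          intro j hj
          exact hP i j (by omega)
        omega
  obtain ⟨S, hS, hS'⟩ := hcolP p₀ (t₁ + 1) hp₀m hp₀1 hp₀2
  set Q := P.map (Polynomial.evalRingHom (p₀ : k))
  have hQ : ∀ i, t₁ ≤ i → Q.coeff i = 0 := fun i hi => by
    rw [Polynomial.coeff_map, hPcoeff m i hi (by omega), map_zero]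
  -- Now Q has degree below t₁ but agrees with X^t₁ at t₁ + 1 points.
  have h1 : Polynomial.X ^ t₁ - Q = 0 := by
    refine Polynomial.eq_zero_of_natDegree_lt_card_of_eval_eq_zero' _ S ?_ ?_
    · intro x hx
      rw [Polynomial.eval_sub, hS' x hx, if_pos rfl, Polynomial.eval_pow, Polynomial.eval_X,
        sub_self]
    · rw [hS, Nat.lt_succ_iff, Polynomial.natDegree_le_iff_coeff_eq_zero]
      intro i hi
      rw [Polynomial.coeff_sub, hQ i hi.le, Polynomial.coeff_X_pow, if_neg (by omega), sub_zero]
  have h2 := congrArg (fun R => Polynomial.coeff R t₁) h1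
  simp [hQ t₁ le_rfl] at h2

end NotDivisible

/-! ### From the lattice-point counts of condition (2) to the two algebraic facts. -/

section Algebra

open MvPolynomial

variable {a b c e f g : ℕ}

/-- The integers δ are the negatives of the exponents of z in column p = 1. If an exponent has index
t, then all δ = r - g(1+s) with s ≤ t are counted, so t < n. -/
lemma exists_eq_of_left_count (he : 0 < e) {r n : ℕ} (hr : r < g)
    (hr1 : (g : ℤ) ∣ e * r + b) (hr2 : (g : ℤ) ∣ f * r - a)
    (hn : {δ : ℤ | δ ≤ 0 ∧ 0 ≤ (b : ℤ) + δ * e ∧ 0 ≤ (a : ℤ) - δ * f ∧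
      (g : ℤ) ∣ (b : ℤ) + δ * e ∧ (g : ℤ) ∣ (a : ℤ) - δ * f}.ncard = n)
    {l : ℕ} (hl : e * l ≤ b) (hlr : (g : ℤ) ∣ l + r) (hr0 : 0 < r) :
    ∃ t < n, l + r = g * (1 + t) := by
  have hg : 0 < g := by omega
  obtain ⟨u, hu⟩ : g ∣ l + r := by exact_mod_cast hlr
  obtain ⟨t, rfl⟩ : ∃ t, u = 1 + t := by
    refine ⟨u - 1, ?_⟩
    have : u ≠ 0 := by rintro rfl; omega
    omega
  refine ⟨t, ?_, hu⟩
  by_contra! hnt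
  set D := {δ : ℤ | δ ≤ 0 ∧ 0 ≤ (b : ℤ) + δ * e ∧ 0 ≤ (a : ℤ) - δ * f ∧
      (g : ℤ) ∣ (b : ℤ) + δ * e ∧ (g : ℤ) ∣ (a : ℤ) - δ * f}
  have hD : D.Finite := by
    refine (Set.finite_Icc (-(b : ℤ)) 0).subset fun δ hδ => ⟨?_, hδ.1⟩
    have h1 : 0 ≤ (b : ℤ) + δ * e := hδ.2.1
    have h2 : δ * e ≤ δ * 1 := mul_le_mul_of_nonpos_left (by exact_mod_cast he) hδ.1
    linarith
  have h1 : ((Finset.range (t + 1)).image fun s : ℕ => ((r : ℤ) - g * (1 + s))).card = t + 1 := by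
    rw [Finset.card_image_of_injective, Finset.card_range]
    intro s s' h
    have h2 : (g : ℤ) * s = g * s' := by simp only at h; linarith
    exact_mod_cast mul_left_cancel₀ (by exact_mod_cast hg.ne') h2
  have h2 : (((Finset.range (t + 1)).image fun s : ℕ => ((r : ℤ) - g * (1 + s)) : Finset ℤ) :
      Set ℤ) ⊆ D := by
    intro δ hδ
    rw [Finset.mem_coe, Finset.mem_image] at hδ
    obtain ⟨s, hs, rfl⟩ := hδ
    rw [Finset.mem_range] at hs
    obtain ⟨x, hx⟩ := hr1
    obtain ⟨y, hy⟩ := hr2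
    have h3 : (r : ℤ) - g * (1 + s) ≤ 0 := by
      have : (g : ℤ) * 1 ≤ g * (1 + s) := mul_le_mul_of_nonneg_left (by omega) (by positivity)
      have : (r : ℤ) < g := by exact_mod_cast hr
      linarith
    have h4 : (g : ℤ) * (1 + s) - r ≤ l := by
      have : (g : ℤ) * (1 + s) ≤ g * (1 + t) :=
        mul_le_mul_of_nonneg_left (by omega) (by positivity)
      have hu' : (l + r : ℤ) = g * (1 + t) := by exact_mod_cast hu
      linarith
    have hl' : (e * l : ℤ) ≤ b := by exact_mod_cast hl
    refine ⟨h3, ?_, ?_, ⟨x - (1 + s) * e, by linear_combination hx⟩,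
      ⟨-y + (1 + s) * f, by linear_combination -hy⟩⟩
    · have : (e : ℤ) * (g * (1 + s) - r) ≤ e * l := mul_le_mul_of_nonneg_left h4 (by positivity)
      linarith
    · have := mul_nonpos_of_nonpos_of_nonneg h3 (by positivity : (0 : ℤ) ≤ f)
      have : (0 : ℤ) ≤ a := by positivity
      linarith
  have h3 := Set.ncard_le_ncard h2 hD
  rw [Set.ncard_coe_finset, h1, hn] at h3
  omega

/-- Put N = n - 1. The exponents Nr + gs with 0 ≤ s ≤ N all fit into column N, so by the count they
are the only ones there. With w = N - q, adding wr or w(r+g) moves a point of column q into column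
N; the two images have indices s and s + w ≤ N, whence 0 ≤ s ≤ q. -/
lemma exists_eq_of_right_count (hg : 0 < g) (hf : 0 < f) {r n : ℕ} (hn0 : 0 < n)
    (hr1 : (g : ℤ) ∣ e * r + b) (hr2 : (g : ℤ) ∣ f * r - a)
    (hn : {γ : ℤ | 0 ≤ γ ∧ 0 ≤ ((n : ℤ) - 1) * b + γ * e ∧ 0 ≤ ((n : ℤ) - 1) * a - γ * f ∧
      (g : ℤ) ∣ ((n : ℤ) - 1) * b + γ * e ∧ (g : ℤ) ∣ ((n : ℤ) - 1) * a - γ * f}.ncard = n)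
    (hrg : f * (r + g) ≤ a) {q l : ℕ} (hq : q < n) (hl : f * l ≤ q * a)
    (hlr : (g : ℤ) ∣ l - q * r) : ∃ t ≤ q, l = q * r + g * t := by
  obtain ⟨N, rfl⟩ : ∃ N, n = N + 1 := ⟨n - 1, by omega⟩
  simp only [Nat.cast_add, Nat.cast_one, add_sub_cancel_right] at hn
  set D := {γ : ℤ | 0 ≤ γ ∧ 0 ≤ (N : ℤ) * b + γ * e ∧ 0 ≤ (N : ℤ) * a - γ * f ∧
      (g : ℤ) ∣ (N : ℤ) * b + γ * e ∧ (g : ℤ) ∣ (N : ℤ) * a - γ * f}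
  have hD : D.Finite := by
    refine (Set.finite_Icc 0 ((N : ℤ) * a)).subset fun γ hγ => ⟨hγ.1, ?_⟩
    have h1 : 0 ≤ (N : ℤ) * a - γ * f := hγ.2.2.1
    have h2 : γ * 1 ≤ γ * f := mul_le_mul_of_nonneg_left (by exact_mod_cast hf) hγ.1
    linarith
  have hmem : ∀ l' : ℕ, f * l' ≤ N * a → (g : ℤ) ∣ l' - N * r → (l' : ℤ) ∈ D := by
    intro l' h1 h2
    obtain ⟨x, hx⟩ := hr1
    obtain ⟨y, hy⟩ := hr2
    obtain ⟨z, hz⟩ := h2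
    refine ⟨by positivity, by positivity, ?_, ⟨N * x + z * e, ?_⟩, ⟨-N * y - z * f, ?_⟩⟩
    · have : (f * l' : ℤ) ≤ N * a := by exact_mod_cast h1
      linarith
    · linear_combination N * hx + e * hz
    · linear_combination -N * hy - f * hz
  have h1 : ((Finset.range (N + 1)).image fun s : ℕ => ((N * r + g * s : ℕ) : ℤ)).card = N + 1 := by
    rw [Finset.card_image_of_injective, Finset.card_range]
    intro s s' h
    have h2 : N * r + g * s = N * r + g * s' := Nat.cast_injective (R := ℤ) h
    exact Nat.eq_of_mul_eq_mul_left hg (Nat.add_left_cancel h2)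
  have hfr : ∀ s ≤ N, f * (N * r + g * s) ≤ N * a := by
    intro s hs
    calc f * (N * r + g * s) ≤ f * (N * r + g * N) := by gcongr
      _ = N * (f * (r + g)) := by ring
      _ ≤ N * a := Nat.mul_le_mul_left _ hrg
  have h2 : (((Finset.range (N + 1)).image fun s : ℕ => ((N * r + g * s : ℕ) : ℤ) : Finset ℤ) :
      Set ℤ) = D := by
    refine Set.eq_of_subset_of_ncard_le ?_ ?_ hD
    · intro γ hγ
      rw [Finset.mem_coe, Finset.mem_image] at hγ
      obtain ⟨s, hs, rfl⟩ := hγ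
      rw [Finset.mem_range] at hs
      exact hmem _ (hfr s (by omega)) ⟨s, by push_cast; ring⟩
    · rw [Set.ncard_coe_finset, h1, hn]
  have h3 : ∀ l' : ℕ, f * l' ≤ N * a → (g : ℤ) ∣ l' - N * r → ∃ s ≤ N, l' = N * r + g * s := by
    intro l' h4 h5
    have h6 := hmem l' h4 h5
    rw [← h2, Finset.mem_coe, Finset.mem_image] at h6
    obtain ⟨s, hs, h7⟩ := h6
    rw [Finset.mem_range] at hs
    exact ⟨s, by omega, (Nat.cast_injective (R := ℤ) h7).symm⟩
  obtain ⟨w, rfl⟩ := Nat.exists_eq_add_of_le (Nat.lt_succ_iff.1 hq)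
  obtain ⟨z, hz⟩ := hlr
  obtain ⟨s, hs, h4⟩ := h3 (l + w * r) (by
    have : f * r ≤ a := le_trans (Nat.mul_le_mul_left _ (Nat.le_add_right _ _)) hrg
    calc f * (l + w * r) = f * l + w * (f * r) := by ring
      _ ≤ q * a + w * a := by gcongr
      _ = (q + w) * a := by ring) ⟨z, by push_cast; linear_combination hz⟩
  obtain ⟨s', hs', h5⟩ := h3 (l + w * (r + g)) (by
    calc f * (l + w * (r + g)) = f * l + w * (f * (r + g)) := by ring
      _ ≤ q * a + w * a := by gcongr
      _ = (q + w) * a := by ring) ⟨z + w, by push_cast; linear_combination hz⟩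
  have h6 : s' = s + w := by
    refine Nat.eq_of_mul_eq_mul_left hg ?_
    have : (l + w * (r + g)) = (l + w * r) + g * w := by ring
    rw [h5, h4] at this
    rw [mul_add]; omega
  refine ⟨s, by omega, ?_⟩
  rw [add_mul] at h4
  omega

variable {k : Type*} [Field k] [CharZero k]

/-- The algebraic core. Taking m = gKj makes m divisible by g and d = Kjab divisible by b, as both
halves require. -/
theorem exists_multiple_curve_dvd (ha : 0 < a) (hb : 0 < b) (hc : 0 < c)
    (habc : Nat.gcd (Nat.gcd a b) c = 1) (he : 0 < e) (hf : 0 < f) (hg : 0 < g)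
    (hefg : Nat.gcd (Nat.gcd e f) g = 1) (hrel : a * e + b * f = c * g)
    (hw : ((g : ℚ) ^ 2 * c) / (a * b) < 1) (n : ℕ)
    (hn : {δ : ℤ | δ ≤ 0 ∧ 0 ≤ (b : ℤ) + δ * e ∧ 0 ≤ (a : ℤ) - δ * f ∧
      (g : ℤ) ∣ (b : ℤ) + δ * e ∧ (g : ℤ) ∣ (a : ℤ) - δ * f}.ncard = n)
    (hn' : {γ : ℤ | 0 ≤ γ ∧ 0 ≤ ((n : ℤ) - 1) * b + γ * e ∧ 0 ≤ ((n : ℤ) - 1) * a - γ * f ∧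
      (g : ℤ) ∣ ((n : ℤ) - 1) * b + γ * e ∧ (g : ℤ) ∣ ((n : ℤ) - 1) * a - γ * f}.ncard = n)
    (hmod : ¬ (g ∣ n * b ∧ g ∣ n * a)) :
    ∃ K T : ℕ, 0 < K ∧ ∀ j : ℕ, 0 < j →
      (∀ F : MvPolynomial (Fin 3) k, F.IsWeightedHomogeneous ![a, b, c] (K * j * (a * b)) →
        VanishesToOrder (g * (K * j)) F → curve k e f g ∣ F) ∧
      ∃ F : MvPolynomial (Fin 3) k, F.IsWeightedHomogeneous ![a, b, c] (K * j * (a * b)) ∧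
        VanishesToOrder (g * (K * j)) F ∧ ¬ curve k e f g ^ T ∣ F := by
  obtain ⟨r, hr, hr1, hr2⟩ := exists_residue hg hefg hrel
  have hn0 : 0 < n := by
    rcases Nat.eq_zero_or_pos n with rfl | h
    · exact absurd ⟨⟨0, by simp⟩, ⟨0, by simp⟩⟩ hmod
    · exact h
  have hnr : ¬ g ∣ n * r := by
    intro h
    have h' : (g : ℤ) ∣ n * r := by exact_mod_cast h
    refine hmod ⟨?_, ?_⟩
    · have h1 : (g : ℤ) ∣ n * b := by
        have : (n * b : ℤ) = n * (e * r + b) - e * (n * r) := by ring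
        rw [this]
        exact dvd_sub (hr1.mul_left _) (h'.mul_left _)
      exact_mod_cast h1
    · have h1 : (g : ℤ) ∣ n * a := by
        have : (n * a : ℤ) = f * (n * r) - n * (f * r - a) := by ring
        rw [this]
        exact dvd_sub (h'.mul_left _) (hr2.mul_left _)
      exact_mod_cast h1
  have hr0 : 0 < r := by
    rcases Nat.eq_zero_or_pos r with rfl | h
    · exact absurd ⟨0, by simp⟩ hnr
    · exact h
  have hw' : g ^ 2 * c < a * b := by
    rw [div_lt_one (by positivity)] at hw
    exact_mod_cast hw
  -- This K puts m above both thresholds, n + 2 for divisibility and 2ab + 1 for its failure.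
  refine ⟨n + 2 + 2 * (a * b), 2 * (a * b) + 1, by omega, fun j hj => ?_⟩
  have hle : n + 2 + 2 * (a * b) ≤ g * ((n + 2 + 2 * (a * b)) * j) :=
    (Nat.le_mul_of_pos_right _ hj).trans (Nat.le_mul_of_pos_left _ hg)
  constructor
  · intro F hF hF'
    exact curve_dvd_of_vanishesToOrder ha hb hg he hf habc hefg hrel hr hr1 hr2
      (fun l h1 h2 => exists_eq_of_left_count he hr hr1 hr2 hn h1 h2 hr0)
      (fun h q hq l h1 h2 => exists_eq_of_right_count hg hf hn0 hr1 hr2 hn' h hq h1 h2)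
      hnr ⟨_, rfl⟩ (by omega) (by ring) ⟨(n + 2 + 2 * (a * b)) * j * a, by ring⟩ hF hF'
  · exact exists_not_curve_pow_dvd ha hb hg hrel hc hw' hr1 hr2 ⟨_, rfl⟩ (by omega) (by ring)

end Algebra

set_option linter.unusedSectionVars false

/-! ### Integer-valued valuations of the function field and orders along prime divisors. -/

section FieldValuation

/-- A group homomorphism from the units of a field to the integers, extended arbitrarily to `0`. -/
structure MultiplicativeFun {K : Type*} [Field K] (v : K → ℤ) : Prop where
  map_mul : ∀ {f g : K}, f ≠ 0 → g ≠ 0 → v (f * g) = v f + v g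

namespace MultiplicativeFun

variable {K : Type*} [Field K] {v : K → ℤ}

lemma map_one (hv : MultiplicativeFun v) : v 1 = 0 := by
  have := hv.map_mul one_ne_zero one_ne_zero
  rw [mul_one] at this
  omega

lemma map_inv (hv : MultiplicativeFun v) {f : K} (hf : f ≠ 0) : v f⁻¹ = -v f := by
  have := hv.map_mul hf (inv_ne_zero hf)
  rw [mul_inv_cancel₀ hf, hv.map_one] at this
  omega

lemma map_div (hv : MultiplicativeFun v) {f g : K} (hf : f ≠ 0) (hg : g ≠ 0) :
    v (f / g) = v f - v g := by
  rw [div_eq_mul_inv, hv.map_mul hf (inv_ne_zero hg), hv.map_inv hg, sub_eq_add_neg]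

lemma map_pow (hv : MultiplicativeFun v) {f : K} (hf : f ≠ 0) (n : ℕ) : v (f ^ n) = n * v f := by
  induction n with
  | zero => simp [hv.map_one]
  | succ n ih => rw [pow_succ, hv.map_mul (pow_ne_zero _ hf) hf, ih]; push_cast; ring

lemma map_zpow (hv : MultiplicativeFun v) {f : K} (hf : f ≠ 0) (n : ℤ) : v (f ^ n) = n * v f := by
  obtain ⟨m, rfl | rfl⟩ := n.eq_nat_or_neg
  · rw [zpow_natCast, hv.map_pow hf]
  · rw [zpow_neg, zpow_natCast, hv.map_inv (pow_ne_zero _ hf), hv.map_pow hf]; ring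

variable {R : Type*} [CommRing R] [IsDomain R] [Algebra R K] [IsFractionRing R K]

lemma dvd_total (hv : MultiplicativeFun v) (hR : ∀ f : K, f ≠ 0 →
    (0 ≤ v f ↔ f ∈ Set.range (algebraMap R K))) (r s : R) :
    r ∣ s ∨ s ∣ r := by
  have key : ∀ {r s : R}, r ≠ 0 → s ≠ 0 → v (algebraMap R K r) ≤ v (algebraMap R K s) →
      r ∣ s := by
    intro r s hr hs h
    have hr' : algebraMap R K r ≠ 0 := by simpa using hr
    have hs' : algebraMap R K s ≠ 0 := by simpa using hs
    obtain ⟨t, ht⟩ := (hR (algebraMap R K s / algebraMap R K r) (div_ne_zero hs' hr')).1 (by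
      rw [hv.map_div hs' hr']; omega)
    refine ⟨t, IsFractionRing.injective R K ?_⟩
    rw [RingHom.map_mul, ht, mul_div_cancel₀ _ hr']
  by_cases hr : r = 0
  · exact Or.inr (hr ▸ dvd_zero s)
  by_cases hs : s = 0
  · exact Or.inl (hs ▸ dvd_zero r)
  exact (le_total _ _).imp (key hr hs) (key hs hr)

lemma map_algebraMap_unit (hv : MultiplicativeFun v) (hR : ∀ f : K, f ≠ 0 →
    (0 ≤ v f ↔ f ∈ Set.range (algebraMap R K)))
    (u : Rˣ) : v (algebraMap R K u) = 0 := by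
  have h0 : algebraMap R K u ≠ 0 := by simp
  have h1 := (hR _ h0).2 ⟨_, rfl⟩
  have h2 := (hR (algebraMap R K u)⁻¹ (inv_ne_zero h0)).2 ⟨(u⁻¹ : Rˣ), by
    refine eq_inv_of_mul_eq_one_left ?_
    rw [← RingHom.map_mul, Units.inv_mul, RingHom.map_one]⟩
  rw [hv.map_inv h0] at h2
  omega

end MultiplicativeFun

/-- A homomorphism that is nonnegative exactly on the local ring vanishes on its units, so it is
determined by its value at a uniformizer. Leaving this value e free avoids any proof that v is
normalised. -/
lemma exists_eq_mul_ord {X : Scheme.{u}} [IsIntegral X] [IsLocallyNoetherian X] {z : X}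
    (hz : Order.coheight z = 1) [IsDiscreteValuationRing (X.presheaf.stalk z)]
    {v : X.functionField → ℤ} (hv : MultiplicativeFun v) (hR : ∀ f : X.functionField, f ≠ 0 →
      (0 ≤ v f ↔ f ∈ Set.range (algebraMap (X.presheaf.stalk z) X.functionField))) :
    ∃ e : ℕ, 0 < e ∧ ∀ f : X.functionField, f ≠ 0 → v f = e * Scheme.ord f z := by
  obtain ⟨ϖ, hϖ⟩ := IsDiscreteValuationRing.exists_irreducible (X.presheaf.stalk z)
  have hK : Ring.KrullDimLE 1 (X.presheaf.stalk z) := krullDimLE_of_coheight_le hz.le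
  set w := algebraMap (X.presheaf.stalk z) X.functionField ϖ with hw
  have hw0 : w ≠ 0 := by simpa [hw] using hϖ.ne_zero
  have h0 : 0 ≤ v w := (hR w hw0).2 ⟨ϖ, rfl⟩
  have hpos : 0 < v w := by
    refine lt_of_le_of_ne h0 fun h => hϖ.not_isUnit ?_
    obtain ⟨t, ht⟩ := (hR w⁻¹ (inv_ne_zero hw0)).1 (by rw [hv.map_inv hw0]; omega)
    refine IsUnit.of_mul_eq_one t (IsFractionRing.injective _ X.functionField ?_)
    rw [RingHom.map_mul, ht, RingHom.map_one, ← hw, mul_inv_cancel₀ hw0]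
  obtain ⟨e, he⟩ := Int.eq_ofNat_of_zero_le h0
  refine ⟨e, by omega, fun f hf => ?_⟩
  have h1 : Ring.ordFrac (X.presheaf.stalk z) f =
      Ring.ordFrac (X.presheaf.stalk z) (w ^ (Scheme.ord f z)) := by
    have h2 := (Scheme.ord_eq_iff hz hf).1 rfl
    rw [map_zpow₀, hw, Ring.ordFrac_irreducible hϖ]
    refine Eq.trans h2 ?_
    rw [← WithZero.exp_zsmul, smul_eq_mul, mul_one]
    rfl
  obtain ⟨u, hu⟩ := Ring.associated_of_ordFrac_eq _ _ h1
  have h3 : v (algebraMap _ X.functionField (u : X.presheaf.stalk z) * f) =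
      v (w ^ (Scheme.ord f z)) := by
    rw [← hu, Units.smul_def, Algebra.smul_def]
  rw [hv.map_mul (by simp) hf, hv.map_algebraMap_unit hR, hv.map_zpow hw0, he, zero_add] at h3
  rw [h3, mul_comm]

end FieldValuation

/-! ### Extension of valuations to the field of fractions. -/

section FracVal

variable {A : Type*} [CommRing A] [IsDomain A] (w : A → ℕ)

/-- The extension to the field of fractions of a valuation on a domain. -/
def fracVal (x : FractionRing A) : ℤ :=
  w (IsLocalization.sec (nonZeroDivisors A) x).1 - w (IsLocalization.sec (nonZeroDivisors A) x).2

variable {w}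

lemma fracVal_div (hw : ∀ {x y : A}, x ≠ 0 → y ≠ 0 → w (x * y) = w x + w y) {F G : A} (hF : F ≠ 0)
    (hG : G ≠ 0) :
    fracVal w (algebraMap A (FractionRing A) F / algebraMap A (FractionRing A) G) =
      w F - w G := by
  set x := algebraMap A (FractionRing A) F / algebraMap A (FractionRing A) G with hx
  have hG' : algebraMap A (FractionRing A) G ≠ 0 := by simpa using hG
  have hF' : algebraMap A (FractionRing A) F ≠ 0 := by simpa using hF
  have h0 := nonZeroDivisors.coe_ne_zero (IsLocalization.sec (nonZeroDivisors A) x).2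
  have h1 := IsLocalization.sec_spec (nonZeroDivisors A) x
  rw [hx, div_mul_eq_mul_div, div_eq_iff hG', ← RingHom.map_mul, ← RingHom.map_mul, ← hx] at h1
  have h2 := IsFractionRing.injective A (FractionRing A) h1
  have h3 : (IsLocalization.sec (nonZeroDivisors A) x).1 ≠ 0 := by
    intro h
    rw [h, zero_mul] at h2
    exact (mul_ne_zero hF h0) h2
  have h4 := congrArg w h2
  rw [hw hF h0, hw h3 hG] at h4
  rw [fracVal]
  omega

lemma multiplicativeFun_fracVal (hw : ∀ {x y : A}, x ≠ 0 → y ≠ 0 → w (x * y) = w x + w y) :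
    MultiplicativeFun (fracVal w) := by
  refine ⟨fun {f g} hf hg => ?_⟩
  obtain ⟨F, G, hG, rfl⟩ := IsFractionRing.div_surjective (A := A) f
  obtain ⟨F', G', hG', rfl⟩ := IsFractionRing.div_surjective (A := A) g
  have h1 : F ≠ 0 := by rintro rfl; simp at hf
  have h2 : F' ≠ 0 := by rintro rfl; simp at hg
  have h3 := nonZeroDivisors.ne_zero hG
  have h4 := nonZeroDivisors.ne_zero hG'
  rw [div_mul_div_comm, ← RingHom.map_mul, ← RingHom.map_mul,
    fracVal_div hw (mul_ne_zero h1 h2) (mul_ne_zero h3 h4), fracVal_div hw h1 h3,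
    fracVal_div hw h2 h4, hw h1 h2, hw h3 h4]
  push_cast
  ring

end FracVal

/-! ### The order of vanishing at (1, …, 1) as a valuation. -/

section OrdOne

open MvPolynomial

variable {σ : Type*} [Fintype σ] {k : Type*} [Field k]

/-- The order of vanishing at `(1, …, 1)`. -/
def ordOne (F : MvPolynomial σ k) : ℕ∞ := (taylorOne F : MvPowerSeries σ k).order

lemma le_ordOne_iff {m : ℕ} {F : MvPolynomial σ k} : (m : ℕ∞) ≤ ordOne F ↔ VanishesToOrder m F := by
  constructor
  · intro h β hβ
    rw [← MvPolynomial.coeff_coe]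
    exact MvPowerSeries.coeff_of_lt_order (lt_of_lt_of_le (by exact_mod_cast hβ) h)
  · intro h
    refine MvPowerSeries.nat_le_order fun β hβ => ?_
    rw [MvPolynomial.coeff_coe]
    exact h β hβ

/-- The substitution `Xᵢ ↦ Xᵢ - 1`. -/
def taylorOneInv : MvPolynomial σ k →ₐ[k] MvPolynomial σ k := aeval fun i => X i - 1

lemma taylorOneInv_taylorOne (F : MvPolynomial σ k) : taylorOneInv (taylorOne F) = F := by
  have : (taylorOneInv.comp taylorOne : MvPolynomial σ k →ₐ[k] _) = AlgHom.id k _ := by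
    ext i; simp [taylorOne, taylorOneInv]
  exact DFunLike.congr_fun this F

lemma ordOne_mul (F G : MvPolynomial σ k) : ordOne (F * G) = ordOne F + ordOne G := by
  rw [ordOne, ordOne, ordOne, map_mul, MvPolynomial.coe_mul, MvPowerSeries.order_mul]

lemma ordOne_eq_top_iff {F : MvPolynomial σ k} : ordOne F = ⊤ ↔ F = 0 := by
  rw [ordOne, MvPowerSeries.order_eq_top_iff, MvPolynomial.coe_eq_zero_iff]
  constructor
  · intro h
    rw [← taylorOneInv_taylorOne F, h, map_zero]
  · rintro rfl
    exact map_zero _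

lemma natCast_toNat_ordOne {F : MvPolynomial σ k} (hF : F ≠ 0) :
    ((ordOne F).toNat : ℕ∞) = ordOne F := ENat.natCast_toNat (by rwa [Ne, ordOne_eq_top_iff])

lemma toNat_ordOne_mul {F G : MvPolynomial σ k} (hF : F ≠ 0) (hG : G ≠ 0) :
    (ordOne (F * G)).toNat = (ordOne F).toNat + (ordOne G).toNat := by
  rw [ordOne_mul, ENat.toNat_add] <;> rwa [Ne, ordOne_eq_top_iff]

lemma one_le_ordOne_iff {F : MvPolynomial σ k} :
    1 ≤ ordOne F ↔ eval (fun _ : σ => (1 : k)) F = 0 := by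
  have h := le_ordOne_iff (m := 1) (F := F)
  rw [Nat.cast_one] at h
  rw [h]
  have h1 : coeff 0 (taylorOne F) = eval (fun _ : σ => (1 : k)) F := by
    rw [← MvPolynomial.constantCoeff_eq]
    have : ((constantCoeff : MvPolynomial σ k →+* k).comp (taylorOne : _ →ₐ[k] _).toRingHom) =
        eval (fun _ : σ => (1 : k)) := by
      refine MvPolynomial.ringHom_ext (fun r => ?_) fun i => ?_
      · simp [taylorOne]
      · simp [taylorOne]
    exact DFunLike.congr_fun this F
  rw [← h1]
  constructor
  · exact fun h => h 0 (by simp)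
  · intro h β hβ
    have : β = 0 := (Finsupp.degree_eq_zero_iff β).1 (by omega)
    rw [this, h]

/-- F is a combination of products of at least m factors Xᵢ - 1, and each such factor is sent into
J. -/
lemma map_mem_pow_of_vanishesToOrder {B : Type*} [CommRing B] {J : Ideal B}
    (ρ : MvPolynomial σ k →+* B) (hρ : ∀ i, ρ (X i) - 1 ∈ J) {m : ℕ} {F : MvPolynomial σ k}
    (hF : VanishesToOrder m F) : ρ F ∈ J ^ m := by
  have h1 : taylorOne F ∈ idealOfVars σ k ^ m := (mem_pow_idealOfVars_iff' ..).2 hF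
  have h2 : Ideal.map (ρ.comp (taylorOneInv : _ →ₐ[k] _).toRingHom) (idealOfVars σ k) ≤ J := by
    rw [idealOfVars, Ideal.map_span, Ideal.span_le]
    rintro _ ⟨_, ⟨i, rfl⟩, rfl⟩
    simpa [taylorOneInv] using hρ i
  have h3 := Ideal.mem_map_of_mem (ρ.comp (taylorOneInv : _ →ₐ[k] _).toRingHom) h1
  rw [Ideal.map_pow] at h3
  have h4 := Ideal.pow_right_mono h2 m h3
  have h5 : (ρ.comp (taylorOneInv : _ →ₐ[k] _).toRingHom) (taylorOne F) = ρ F :=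
    congrArg ρ (taylorOneInv_taylorOne F)
  rwa [h5] at h4

end OrdOne

/-! ### Stalks of the Proj of a graded domain inside the field of fractions. -/

section ProjStalk

open TopologicalSpace HomogeneousLocalization

variable {A : Type u} {σ : Type*} [CommRing A] [IsDomain A] [SetLike σ A] [AddSubgroupClass σ A]
  (𝒜 : ℕ → σ) [GradedRing 𝒜]

/-- The embedding of a homogeneous localization at a prime of a graded domain into the field of
fractions. -/
def atPrimeToFrac (p : Ideal A) [p.IsPrime] :
    HomogeneousLocalization.AtPrime 𝒜 p →+* FractionRing A :=
  (IsLocalization.lift (M := p.primeCompl) (S := Localization p.primeCompl)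
    (g := algebraMap A (FractionRing A)) fun y =>
      IsLocalization.map_units (FractionRing A) (⟨y.1, p.primeCompl_le_nonZeroDivisors y.2⟩ :
        nonZeroDivisors A)).comp
    (algebraMap (HomogeneousLocalization.AtPrime 𝒜 p) (Localization p.primeCompl))

lemma atPrimeToFrac_mk (p : Ideal A) [p.IsPrime] (c : NumDenSameDeg 𝒜 p.primeCompl) :
    atPrimeToFrac 𝒜 p (.mk c) =
      algebraMap A (FractionRing A) c.num / algebraMap A (FractionRing A) c.den := by
  have h0 : algebraMap A (FractionRing A) c.den ≠ 0 := by
    have := p.primeCompl_le_nonZeroDivisors c.den_mem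
    simpa using nonZeroDivisors.ne_zero this
  simp only [atPrimeToFrac, RingHom.comp_apply, HomogeneousLocalization.algebraMap_apply,
    HomogeneousLocalization.val_mk, Localization.mk_eq_mk']
  rw [IsLocalization.lift_mk'_spec, mul_div_cancel₀ _ h0]

lemma atPrimeToFrac_injective (p : Ideal A) [p.IsPrime] :
    Function.Injective (atPrimeToFrac 𝒜 p) := by
  rw [injective_iff_map_eq_zero]
  intro z hz
  obtain ⟨c, rfl⟩ := HomogeneousLocalization.mk_surjective z
  have h0 : algebraMap A (FractionRing A) c.den ≠ 0 := by
    have := p.primeCompl_le_nonZeroDivisors c.den_mem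
    simpa using nonZeroDivisors.ne_zero this
  rw [atPrimeToFrac_mk, div_eq_zero_iff, or_iff_left h0] at hz
  exact HomogeneousLocalization.mk_eq_zero_of_num _ (by simpa using hz)

instance isPrime_of_proj (x : Proj 𝒜) : x.asHomogeneousIdeal.toIdeal.IsPrime :=
  ProjectiveSpectrum.isPrime x

/-- The embedding of a stalk of the projective spectrum of a graded domain into the field of
fractions. -/
def stalkToFrac (x : Proj 𝒜) : (Proj 𝒜).presheaf.stalk x →+* FractionRing A :=
  (atPrimeToFrac 𝒜 x.asHomogeneousIdeal.toIdeal).comp (Proj.stalkIso 𝒜 x).hom.hom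

lemma stalkToFrac_injective (x : Proj 𝒜) : Function.Injective (stalkToFrac 𝒜 x) := by
  refine (atPrimeToFrac_injective 𝒜 _).comp ?_
  exact (Proj.stalkIso 𝒜 x).commRingCatIsoToRingEquiv.injective

/-- Near y a section is a single fraction, and the neighbourhood contains the generization x. -/
lemma stalkToFrac_germ (x y : Proj 𝒜) (h : x ⤳ y) (s : (Proj 𝒜).presheaf.stalk y) :
    stalkToFrac 𝒜 x ((Proj 𝒜).presheaf.stalkSpecializes h s) = stalkToFrac 𝒜 y s := by
  obtain ⟨U, hyU, s, rfl⟩ := (Proj 𝒜).presheaf.exists_germ_eq s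
  have hxU : x ∈ U := h.mem_open U.2 hyU
  have key : ∀ (z : Proj 𝒜) (hz : z ∈ U), stalkToFrac 𝒜 z ((Proj 𝒜).presheaf.germ U z hz s) =
      atPrimeToFrac 𝒜 z.asHomogeneousIdeal.toIdeal (s.1 ⟨z, hz⟩) := by
    intro z hz
    simp only [stalkToFrac, RingHom.comp_apply]
    congr 1
    exact Proj.stalkIso'_germ 𝒜 U z hz s
  have hs : (Proj 𝒜).presheaf.stalkSpecializes h ((Proj 𝒜).presheaf.germ U y hyU s) =
      (Proj 𝒜).presheaf.germ U x hxU s := by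
    rw [← CategoryTheory.ConcreteCategory.comp_apply, (Proj 𝒜).presheaf.germ_stalkSpecializes]
  rw [hs, key, key]
  obtain ⟨V, hyV, i, n, a, b, hb, e⟩ := s.2 ⟨y, hyU⟩
  have hxV : x ∈ V := h.mem_open V.2 hyV
  have e1 := e ⟨y, hyV⟩
  have e2 := e ⟨x, hxV⟩
  have e1' : s.1 ⟨y, hyU⟩ = _ := e1
  have e2' : s.1 ⟨x, hxU⟩ = _ := e2
  rw [e1', e2', atPrimeToFrac_mk, atPrimeToFrac_mk]


lemma exists_stalkToFrac_eq (x : Proj 𝒜) (s : (Proj 𝒜).presheaf.stalk x) :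
    ∃ (n : ℕ) (F G : A), F ∈ 𝒜 n ∧ G ∈ 𝒜 n ∧ G ∉ x.asHomogeneousIdeal ∧
      stalkToFrac 𝒜 x s = algebraMap A (FractionRing A) F / algebraMap A (FractionRing A) G := by
  obtain ⟨c, hc⟩ := HomogeneousLocalization.mk_surjective ((Proj.stalkIso 𝒜 x).hom.hom s)
  refine ⟨c.deg, c.num, c.den, c.num.2, c.den.2, c.den_mem, ?_⟩
  rw [← atPrimeToFrac_mk, hc]
  rfl

/-- The germ at `x` of the fraction `F / G`. -/
def stalkMk (x : Proj 𝒜) {n : ℕ} {F G : A} (hF : F ∈ 𝒜 n) (hG : G ∈ 𝒜 n)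
    (hx : G ∉ x.asHomogeneousIdeal) : (Proj 𝒜).presheaf.stalk x :=
  (Proj.stalkIso 𝒜 x).inv.hom (.mk ⟨n, ⟨F, hF⟩, ⟨G, hG⟩, hx⟩)

lemma stalkToFrac_stalkMk (x : Proj 𝒜) {n : ℕ} {F G : A} (hF : F ∈ 𝒜 n) (hG : G ∈ 𝒜 n)
    (hx : G ∉ x.asHomogeneousIdeal) : stalkToFrac 𝒜 x (stalkMk 𝒜 x hF hG hx) =
      algebraMap A (FractionRing A) F / algebraMap A (FractionRing A) G := by
  have h := (Proj.stalkIso 𝒜 x).inv_hom_id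
  have h2 := congr($(h).hom (.mk ⟨n, ⟨F, hF⟩, ⟨G, hG⟩, hx⟩))
  simp only [stalkToFrac, stalkMk, RingHom.comp_apply]
  refine (congrArg (atPrimeToFrac 𝒜 x.asHomogeneousIdeal.toIdeal) h2).trans ?_
  exact atPrimeToFrac_mk _ _ _

lemma exists_stalkMk_eq (x : Proj 𝒜) (s : (Proj 𝒜).presheaf.stalk x) :
    ∃ (n : ℕ) (F G : A) (hF : F ∈ 𝒜 n) (hG : G ∈ 𝒜 n) (hx : G ∉ x.asHomogeneousIdeal),
      s = stalkMk 𝒜 x hF hG hx := by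
  obtain ⟨n, F, G, hF, hG, hx, h⟩ := exists_stalkToFrac_eq 𝒜 x s
  exact ⟨n, F, G, hF, hG, hx, stalkToFrac_injective 𝒜 x (by rw [h, stalkToFrac_stalkMk])⟩

lemma specializes_iff_le (x y : Proj 𝒜) :
    x ⤳ y ↔ x.asHomogeneousIdeal ≤ y.asHomogeneousIdeal := by
  rw [specializes_iff_mem_closure]
  exact (ProjectiveSpectrum.le_iff_mem_closure (𝒜 := 𝒜) x y).symm

/-- The generic point of the projective spectrum of a graded domain. -/
def projBot {n : ℕ} (hn : 0 < n) {f : A} (hf : f ∈ 𝒜 n) (hf0 : f ≠ 0) : Proj 𝒜 where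
  asHomogeneousIdeal := ⊥
  isPrime := by
    rw [HomogeneousIdeal.toIdeal_bot]
    exact Ideal.isPrime_bot
  not_irrelevant_le h := by
    have h1 := h (HomogeneousIdeal.mem_irrelevant_of_mem 𝒜 hn hf)
    exact hf0 (by simpa [← HomogeneousIdeal.mem_iff] using h1)

lemma isIntegral_proj {n : ℕ} (hn : 0 < n) {f : A} (hf : f ∈ 𝒜 n) (hf0 : f ≠ 0) :
    IsIntegral (Proj 𝒜) := by
  have h1 : IrreducibleSpace (Proj 𝒜) := by
    have h : closure {projBot 𝒜 hn hf hf0} = Set.univ := by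
      rw [Set.eq_univ_iff_forall]
      intro x
      rw [← specializes_iff_mem_closure, specializes_iff_le]
      exact bot_le
    have h2 := (isIrreducible_singleton (x := projBot 𝒜 hn hf hf0)).closure
    rw [h] at h2
    exact { isPreirreducible_univ := h2.2, toNonempty := ⟨projBot 𝒜 hn hf hf0⟩ }
  have h2 : ∀ x : Proj 𝒜, _root_.IsReduced ((Proj 𝒜).presheaf.stalk x) := fun x =>
    isReduced_of_injective _ (stalkToFrac_injective 𝒜 x)
  have h3 : IsReduced (Proj 𝒜) := isReduced_of_isReduced_stalk _
  exact isIntegral_of_irreducibleSpace_of_isReduced _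

/-- Otherwise 0 ⊂ y ⊂ z would be a strict chain of homogeneous primes, and z would have codimension
at least two. -/
lemma eq_of_coheight_eq_one {z y : Proj 𝒜} (hz : Order.coheight z = 1)
    (h : y.asHomogeneousIdeal ≤ z.asHomogeneousIdeal) {f : A} (hf : f ∈ y.asHomogeneousIdeal)
    (hf0 : f ≠ 0) : y = z := by
  by_contra hne
  have h1 : y ⤳ z := (specializes_iff_le 𝒜 y z).2 h
  have hirr := y.not_irrelevant_le
  -- The generic point needs a nonzero homogeneous element of positive degree; without one the
  -- irrelevant ideal would be zero and contained in y.
  obtain ⟨n, hn, w, hw, hw0⟩ : ∃ n, 0 < n ∧ ∃ w ∈ 𝒜 n, w ≠ 0 := by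
    by_contra hcon
    push Not at hcon
    refine hirr fun a ha => ?_
    have : a = 0 := by
      classical
      rw [← DirectSum.sum_support_decompose 𝒜 a]
      refine Finset.sum_eq_zero fun i _ => ?_
      rcases Nat.eq_zero_or_pos i with rfl | hi
      · simpa [HomogeneousIdeal.mem_irrelevant_iff] using ha
      · exact hcon i hi _ (SetLike.coe_mem _)
    rw [this]
    exact zero_mem y.asHomogeneousIdeal.toIdeal
  have h2 : projBot 𝒜 hn hw hw0 ⤳ y := (specializes_iff_le 𝒜 _ y).2 bot_le
  have hne2 : projBot 𝒜 hn hw hw0 ≠ y := by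
    rintro rfl
    have : f ∈ (⊥ : HomogeneousIdeal 𝒜).toIdeal := hf
    rw [HomogeneousIdeal.toIdeal_bot] at this
    exact hf0 (by simpa using this)
  have lt1 : z < y := lt_of_le_not_ge h1 fun h' => hne (h1.antisymm h').eq
  have lt2 : y < projBot 𝒜 hn hw hw0 := lt_of_le_not_ge h2 fun h' => hne2 (h2.antisymm h').eq
  have c1 := Order.coheight_add_one_le lt1
  have c2 := Order.coheight_add_one_le lt2
  rw [hz] at c1
  have c3 : (1 : ℕ∞) + 1 ≤ 1 := by
    refine le_trans ?_ c1
    gcongr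
    exact le_trans (by simp) c2
  exact absurd c3 (by decide)

lemma isDiscreteValuationRing_of_dvd_total {R : Type*} [CommRing R] [IsDomain R] [IsLocalRing R]
    [IsNoetherianRing R] (h : ∀ a b : R, a ∣ b ∨ b ∣ a) {r : R} (hr : r ≠ 0) (hr' : ¬ IsUnit r) :
    IsDiscreteValuationRing R := by
  have hf : ¬ IsField R := fun hf => hr' (by
    obtain ⟨b, hb⟩ := hf.mul_inv_cancel hr
    exact IsUnit.of_mul_eq_one b hb)
  have hV : ValuationRing R := ValuationRing.iff_dvd_total.2 ⟨h⟩
  exact ((IsDiscreteValuationRing.TFAE R hf).out 0 1).2 hV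

end ProjStalk

/-! ### The structure morphism of Proj on global sections. -/

section ProjToSpec

variable {R A : Type u} [CommRing R] [CommRing A] [IsDomain A] [Algebra R A]
  (𝒜 : ℕ → Submodule R A) [GradedAlgebra 𝒜]

/-- Bookkeeping for `Proj.toSpecZero`, which passes through the chart of 1, an open set equal but
not identical to the whole space. -/
lemma topIso_inv_isoOfEq_inv_app (X : Scheme.{u}) (U : X.Opens) (e : U = ⊤) :
    U.topIso.inv ≫ (X.isoOfEq e).inv.appTop ≫ X.topIso.inv.appTop =
      X.presheaf.map (eqToHom e.symm).op := by
  have h : X.topIso.inv ≫ (X.isoOfEq e).inv ≫ U.ι = 𝟙 X := by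
    rw [Scheme.isoOfEq_inv_ι, Scheme.toIso_inv_ι]
  have h1 : U.topIso.inv = U.ι.appLE U ⊤ (by simp) := by
    rw [Scheme.Opens.ι_appLE]; rfl
  have h3 : ∀ j : X ⟶ U.toScheme, j.appTop = j.appLE ⊤ ⊤
      (show (⊤ : X.Opens) ≤ j ⁻¹ᵁ ⊤ from le_rfl) :=
    fun j => Scheme.Hom.app_eq_appLE _
  rw [h1, ← Scheme.Hom.comp_appTop, h3, Scheme.Hom.appLE_comp_appLE]
  have h2 : ∀ (j : X ⟶ X) (h : j = 𝟙 X) (hle : ⊤ ≤ j ⁻¹ᵁ U), j.appLE U ⊤ hle =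
      X.presheaf.map (eqToHom e.symm).op := by
    rintro _ rfl hle
    simp [Scheme.Hom.appLE]
    rfl
  exact h2 _ (by rw [Category.assoc, h]) _

lemma toSpecZero_appTop : (Proj.toSpecZero 𝒜).appTop =
    (Scheme.ΓSpecIso _).hom ≫
      CommRingCat.ofHom (HomogeneousLocalization.fromZeroRingHom 𝒜 (.powers 1)) ≫
      Proj.awayToSection 𝒜 1 ≫ (Proj 𝒜).presheaf.map (eqToHom (Proj.basicOpen_one 𝒜).symm).op := by
  rw [← topIso_inv_isoOfEq_inv_app _ _ (Proj.basicOpen_one 𝒜)]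
  have h0 : (Proj.basicOpenToSpec 𝒜 1).appTop = _ := Proj.basicOpenToSpec_app_top 𝒜 1
  simp only [Proj.toSpecZero, Scheme.Hom.comp_appTop, h0, Category.assoc]
  have h := Scheme.ΓSpecIso_naturality (CommRingCat.ofHom
    (HomogeneousLocalization.fromZeroRingHom 𝒜 (.powers 1)))
  rw [reassoc_of% h]

lemma stalkToFrac_projToSpec (x : Proj 𝒜) (r : R) :
    stalkToFrac 𝒜 x ((Proj 𝒜).presheaf.germ ⊤ x trivial
      ((projToSpec 𝒜).appTop ((Scheme.ΓSpecIso (.of R)).inv r))) =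
      algebraMap A (FractionRing A) (algebraMap R A r) := by
  have h1 : (projToSpec 𝒜).appTop ((Scheme.ΓSpecIso (.of R)).inv r) =
      (Proj 𝒜).presheaf.map (eqToHom (Proj.basicOpen_one 𝒜).symm).op
        (Proj.awayToSection 𝒜 1 (HomogeneousLocalization.fromZeroRingHom 𝒜 (.powers 1)
          (algebraMap R (𝒜 0) r))) := by
    have h := Scheme.ΓSpecIso_inv_naturality (CommRingCat.ofHom (algebraMap R (𝒜 0)))
    have h' := congr($(h).hom r)
    simp only [projToSpec, Scheme.Hom.comp_appTop, toSpecZero_appTop]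
    simp only [CommRingCat.hom_comp, RingHom.comp_apply] at h' ⊢
    erw [← h']
    simp
  rw [h1]
  have hx1 : x ∈ Proj.basicOpen 𝒜 1 := by rw [Proj.basicOpen_one]; trivial
  have h2 := Proj.stalkIso'_germ 𝒜 (Proj.basicOpen 𝒜 1) x hx1 (Proj.awayToSection 𝒜 1
    (HomogeneousLocalization.fromZeroRingHom 𝒜 (.powers 1) (algebraMap R (𝒜 0) r)))
  erw [(Proj 𝒜).presheaf.germ_res_apply]
  refine (congrArg (atPrimeToFrac 𝒜 x.asHomogeneousIdeal.toIdeal) h2).trans ?_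
  refine (atPrimeToFrac_mk 𝒜 x.asHomogeneousIdeal.toIdeal ⟨0, algebraMap R (𝒜 0) r, 1,
    Submonoid.one_mem _⟩).trans ?_
  simp

end ProjToSpec

/-! ### The exceptional point of Proj of the Rees algebra. -/

section ReesValuation

open Polynomial

variable {A : Type u} [CommRing A] (I : Ideal A)

/-- A valuation on a domain whose value filtration is the filtration by the powers of `I`, and which
takes the value `1`. -/
structure AdicValuation where
  /-- the underlying function -/
  val : A → ℕ∞
  mem_pow_iff : ∀ (n : ℕ) (a : A), a ∈ I ^ n ↔ (n : ℕ∞) ≤ val a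
  val_mul : ∀ a b, val (a * b) = val a + val b
  val_ne_top : ∀ a, a ≠ 0 → val a ≠ ⊤
  /-- an element of value `1` -/
  unif : A
  val_unif : val unif = 1

variable {I}

/-- The element `w tⁿ` of the Rees algebra. -/
def reesMonomial (n : ℕ) (w : A) (hw : w ∈ I ^ n) : reesAlgebra I :=
  ⟨monomial n w, reesAlgebra.monomial_mem.2 hw⟩

lemma reesMonomial_mem (n : ℕ) (w : A) (hw : w ∈ I ^ n) :
    reesMonomial n w hw ∈ reesGrading I n := ⟨w, rfl⟩

lemma exists_reesMonomial {n : ℕ} {p : reesAlgebra I} (hp : p ∈ reesGrading I n) :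
    ∃ (w : A) (hw : w ∈ I ^ n), p = reesMonomial n w hw :=
  ⟨(p : A[X]).coeff n, p.2 n, Subtype.ext (mem_reesGrading.1 hp).symm⟩

lemma reesMonomial_mul {n m : ℕ} {w w' : A} (hw : w ∈ I ^ n) (hw' : w' ∈ I ^ m)
    (h : w * w' ∈ I ^ (n + m)) :
    reesMonomial n w hw * reesMonomial m w' hw' = reesMonomial (n + m) (w * w') h :=
  Subtype.ext (monomial_mul_monomial ..)

lemma reesMonomial_congr {n m : ℕ} {w w' : A} (hw : w ∈ I ^ n) (hw' : w' ∈ I ^ m)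
    (hn : n = m) (h : w = w') : reesMonomial n w hw = reesMonomial m w' hw' := by
  subst hn h; rfl

lemma algebraMap_eq_reesMonomial (a : A) :
    algebraMap A (reesAlgebra I) a = reesMonomial 0 a (by simp) :=
  Subtype.ext (show C a = monomial 0 a from
    (@monomial_zero_left A _ a).symm)

lemma reesMonomial_eq_zero_iff {n : ℕ} {w : A} (hw : w ∈ I ^ n) :
    reesMonomial n w hw = 0 ↔ w = 0 := by
  rw [← Subtype.coe_inj]
  exact monomial_eq_zero_iff w n

variable (I) in
/-- The ideal `⨁ₙ Iⁿ⁺¹ tⁿ` of the Rees algebra. -/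
def exceptionalIdeal : HomogeneousIdeal (reesGrading I) where
  carrier := {p | ∀ n, (p : A[X]).coeff n ∈ I ^ (n + 1)}
  add_mem' hp hq n := by
    simpa using add_mem (hp n) (hq n)
  zero_mem' n := by simp
  smul_mem' p q hq n := by
    simp only [smul_eq_mul, MulMemClass.coe_mul, coeff_mul]
    refine sum_mem fun x hx => ?_
    have hx := Finset.HasAntidiagonal.mem_antidiagonal.1 hx
    rw [← hx, add_assoc, pow_add]
    exact Ideal.mul_mem_mul (p.2 _) (hq _)
  is_homogeneous' i p hp n := by
    rw [← GradedRing.proj_apply]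
    have : (GradedRing.proj (reesGrading I) i p : reesAlgebra I) =
        reesMonomial i ((p : A[X]).coeff i) (p.2 i) := by
      rw [GradedRing.proj_apply]
      have h := coeff_coe_directSum (DirectSum.decompose (reesGrading I) p) i
      have h' : DirectSum.coeAddMonoidHom (reesGrading I)
          (DirectSum.decompose (reesGrading I) p) = p :=
        (DirectSum.Decomposition.left_inv (ℳ := reesGrading I) p)
      rw [h'] at h
      obtain ⟨w, hw, e⟩ := exists_reesMonomial (DirectSum.decompose (reesGrading I) p i).2
      rw [e] at h ⊢
      refine reesMonomial_congr _ _ rfl ?_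
      rw [h]
      simp [reesMonomial]
    rw [this]
    simp only [reesMonomial, coeff_monomial]
    split_ifs with h
    · subst h; exact hp _
    · simp

lemma reesMonomial_mem_exceptionalIdeal {n : ℕ} {w : A} (hw : w ∈ I ^ n) :
    reesMonomial n w hw ∈ exceptionalIdeal I ↔ w ∈ I ^ (n + 1) := by
  constructor
  · intro h
    simpa [reesMonomial] using h n
  · intro h m
    simp only [reesMonomial, coeff_monomial]
    split_ifs with h'
    · subst h'; exact h
    · simp

lemma algebraMap_mul_reesMonomial {n : ℕ} (a : A) {w : A} (hw : w ∈ I ^ n)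
    (h : a * w ∈ I ^ n) : algebraMap A (reesAlgebra I) a * reesMonomial n w hw =
      reesMonomial n (a * w) h :=
  Subtype.ext (C_mul_monomial ..)

lemma reesMonomial_add {n : ℕ} {w w' : A} (hw : w ∈ I ^ n) (hw' : w' ∈ I ^ n)
    (h : w + w' ∈ I ^ n) : reesMonomial n (w + w') h =
      reesMonomial n w hw + reesMonomial n w' hw' :=
  Subtype.ext (map_add (monomial n) w w')

/-- Since Iⁿ⁺¹tⁿ = I · Iⁿtⁿ, this ideal is generated by the copy of I in degree zero. -/
lemma exceptionalIdeal_le {J : HomogeneousIdeal (reesGrading I)}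
    (h : ∀ a ∈ I, algebraMap A (reesAlgebra I) a ∈ J) :
    exceptionalIdeal I ≤ J := by
  have key : ∀ (n : ℕ) (w : A) (hw : w ∈ I ^ (n + 1)),
      reesMonomial n w (Ideal.pow_le_pow_right (Nat.le_succ n) hw) ∈ J := by
    intro n w hw
    have h2 : w ∈ I * I ^ n := by rwa [← pow_succ']
    have h3 : ∀ x ∈ I * I ^ n, ∃ hx : x ∈ I ^ n, reesMonomial n x hx ∈ J.toIdeal := by
      intro x hx
      refine Submodule.mul_induction_on hx ?_ ?_
      · intro a ha b hb
        refine ⟨Ideal.mul_mem_left _ _ hb, ?_⟩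
        have h4 := J.toIdeal.mul_mem_right (reesMonomial n b hb) (h a ha)
        rwa [algebraMap_mul_reesMonomial a hb (Ideal.mul_mem_left _ _ hb)] at h4
      · rintro a b ⟨ha, h1⟩ ⟨hb, h2⟩
        refine ⟨add_mem ha hb, ?_⟩
        rw [reesMonomial_add ha hb]
        exact add_mem h1 h2
    exact (h3 w h2).2
  intro p hp
  rw [← HomogeneousIdeal.mem_iff]
  have : p = ∑ n ∈ (p : A[X]).support, reesMonomial n ((p : A[X]).coeff n) (p.2 n) := by
    apply Subtype.ext
    rw [AddSubmonoidClass.coe_finsetSum]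
    exact (p : A[X]).as_sum_support
  rw [this]
  exact sum_mem fun n _ => key n _ (hp n)

variable (V : AdicValuation I)

namespace AdicValuation

lemma reesMonomial_notMem_iff {n : ℕ} {w : A} (hw : w ∈ I ^ n) :
    reesMonomial n w hw ∉ exceptionalIdeal I ↔ V.val w = n := by
  rw [reesMonomial_mem_exceptionalIdeal, V.mem_pow_iff]
  have h := (V.mem_pow_iff n w).1 hw
  constructor
  · intro h'
    push_cast at h'
    exact le_antisymm (ENat.lt_add_one_iff (ENat.natCast_ne_top n) |>.1 (not_le.1 h')) h
  · intro h'
    rw [h', Nat.cast_le]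
    omega

lemma unif_mem : V.unif ∈ I ^ 1 := (V.mem_pow_iff 1 _).2 (by rw [V.val_unif]; rfl)

lemma unif_ne_zero : V.unif ≠ 0 := by
  intro h
  have h1 := (V.mem_pow_iff 2 V.unif).1 (by rw [h]; exact zero_mem _)
  rw [V.val_unif] at h1
  exact absurd h1 (by decide)

variable [IsDomain A]

/-- The generic point of the exceptional divisor. -/
def exceptionalPoint : affineBlowup I where
  asHomogeneousIdeal := exceptionalIdeal I
  isPrime := by
    -- Primality is the multiplicativity of the valuation: wtⁿ lies outside the ideal exactly when w
    -- has value n.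
    refine (exceptionalIdeal I).isHomogeneous.isPrime_of_homogeneous_mem_or_mem ?_ ?_
    · intro h
      have h1 : (reesMonomial 1 V.unif V.unif_mem) ∈ exceptionalIdeal I := by
        rw [← HomogeneousIdeal.mem_iff, h]; trivial
      exact (V.reesMonomial_notMem_iff V.unif_mem).2 V.val_unif h1
    · rintro x y ⟨n, hn⟩ ⟨m, hm⟩ hxy
      obtain ⟨w, hw, rfl⟩ := exists_reesMonomial hn
      obtain ⟨w', hw', rfl⟩ := exists_reesMonomial hm
      by_contra! hcon
      obtain ⟨h1, h2⟩ := hcon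
      have h1' := (V.reesMonomial_notMem_iff hw).1 h1
      have h2' := (V.reesMonomial_notMem_iff hw').1 h2
      rw [reesMonomial_mul hw hw' (pow_add I n m ▸ Ideal.mul_mem_mul hw hw')] at hxy
      refine (V.reesMonomial_notMem_iff _).2 ?_ hxy
      rw [V.val_mul, h1', h2', Nat.cast_add]
  not_irrelevant_le h := by
    have h1 := h (HomogeneousIdeal.mem_irrelevant_of_mem (reesGrading I) one_pos
      (reesMonomial_mem 1 V.unif V.unif_mem))
    exact (V.reesMonomial_notMem_iff V.unif_mem).2 V.val_unif h1

lemma eq_exceptionalPoint {z : affineBlowup I} (hz : Order.coheight z = 1)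
    (h : ∀ a ∈ I, algebraMap A (reesAlgebra I) a ∈ z.asHomogeneousIdeal) :
    z = V.exceptionalPoint := by
  refine (eq_of_coheight_eq_one (reesGrading I) hz (y := V.exceptionalPoint)
    (exceptionalIdeal_le h) (f := algebraMap A (reesAlgebra I) V.unif) ?_ ?_).symm
  · rw [algebraMap_eq_reesMonomial]
    exact (reesMonomial_mem_exceptionalIdeal _).2 V.unif_mem
  · rw [algebraMap_eq_reesMonomial, Ne, reesMonomial_eq_zero_iff]
    exact V.unif_ne_zero

end AdicValuation

end ReesValuation

/-! ### The local ring at the exceptional point is a valuation ring. -/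

section ExceptionalStalk

open Polynomial IsLocalRing

variable {A : Type u} [CommRing A] {I : Ideal A} (V : AdicValuation I)

namespace AdicValuation

lemma mem_pow_of_val_eq {n : ℕ} {w : A} (h : V.val w = n) : w ∈ I ^ n :=
  (V.mem_pow_iff n w).2 h.ge

lemma ne_zero_of_val_eq {n : ℕ} {w : A} (h : V.val w = n) : w ≠ 0 := by
  rintro rfl
  have h1 := (V.mem_pow_iff (n + 1) 0).1 (zero_mem _)
  rw [h, Nat.cast_le] at h1
  omega

variable [IsDomain A]

lemma reesMonomial_notMem_exceptionalPoint {n : ℕ} {w : A} (hw : w ∈ I ^ n) (h : V.val w = n) :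
    reesMonomial n w hw ∉ V.exceptionalPoint.asHomogeneousIdeal :=
  (V.reesMonomial_notMem_iff hw).2 h

/-- The germ of `w / w'` at the generic point of the exceptional divisor. -/
def germMk {n : ℕ} {w w' : A} (hw : w ∈ I ^ n) (hw' : V.val w' = n) :
    (affineBlowup I).presheaf.stalk V.exceptionalPoint :=
  stalkMk (reesGrading I) V.exceptionalPoint (reesMonomial_mem n w hw)
    (reesMonomial_mem n w' (V.mem_pow_of_val_eq hw'))
    (V.reesMonomial_notMem_exceptionalPoint (V.mem_pow_of_val_eq hw') hw')

lemma exists_germMk_eq (s : (affineBlowup I).presheaf.stalk V.exceptionalPoint) :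
    ∃ (n : ℕ) (w w' : A) (hw : w ∈ I ^ n) (hw' : V.val w' = n), s = V.germMk hw hw' := by
  obtain ⟨n, F, G, hF, hG, hx, rfl⟩ := exists_stalkMk_eq (reesGrading I) _ s
  obtain ⟨w, hw, rfl⟩ := exists_reesMonomial hF
  obtain ⟨w', hw', rfl⟩ := exists_reesMonomial hG
  exact ⟨n, w, w', hw, (V.reesMonomial_notMem_iff hw').1 hx, rfl⟩

lemma stalkToFrac_germMk {n : ℕ} {w w' : A} (hw : w ∈ I ^ n) (hw' : V.val w' = n) :
    stalkToFrac (reesGrading I) _ (V.germMk hw hw') =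
      algebraMap _ (FractionRing (reesAlgebra I)) (algebraMap A (reesAlgebra I) w) /
      algebraMap _ (FractionRing (reesAlgebra I)) (algebraMap A (reesAlgebra I) w') := by
  have h0 : ∀ {m : ℕ} (h : w' ∈ I ^ m), algebraMap _ (FractionRing (reesAlgebra I))
      (reesMonomial m w' h) ≠ 0 := by
    intro m h
    rw [Ne, FaithfulSMul.algebraMap_eq_zero_iff, reesMonomial_eq_zero_iff]
    exact V.ne_zero_of_val_eq hw'
  rw [germMk, stalkToFrac_stalkMk, algebraMap_eq_reesMonomial, algebraMap_eq_reesMonomial,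
    div_eq_div_iff (h0 _) (h0 _), ← map_mul, ← map_mul]
  congr 1
  exact Subtype.ext (by simp [reesMonomial])

lemma germMk_mul_eq {n m l : ℕ} {w w' u u' t t' : A} (hw : w ∈ I ^ n) (hw' : V.val w' = n)
    (hu : u ∈ I ^ m) (hu' : V.val u' = m) (ht : t ∈ I ^ l) (ht' : V.val t' = l)
    (h : w * u * t' = t * (w' * u')) : V.germMk hw hw' * V.germMk hu hu' = V.germMk ht ht' := by
  apply stalkToFrac_injective
  have h0 : ∀ {m : ℕ} {w' : A} (hw' : V.val w' = m), algebraMap _ (FractionRing (reesAlgebra I))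
      (algebraMap A (reesAlgebra I) w') ≠ 0 := by
    intro m w' hw'
    rw [Ne, FaithfulSMul.algebraMap_eq_zero_iff, algebraMap_eq_reesMonomial,
      reesMonomial_eq_zero_iff]
    exact V.ne_zero_of_val_eq hw'
  rw [map_mul, stalkToFrac_germMk, stalkToFrac_germMk, stalkToFrac_germMk, div_mul_div_comm,
    div_eq_div_iff (mul_ne_zero (h0 hw') (h0 hu')) (h0 ht')]
  simp only [← map_mul]
  rw [h]

/-- The germ of w/w' has value val(w) - n, and the values of two nonzero germs decide which divides
the other: the quotient (u w')/(w u') is again a germ, because its denominator has value N + m and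
its numerator at least that. -/
lemma dvd_total (s t : (affineBlowup I).presheaf.stalk V.exceptionalPoint) : s ∣ t ∨ t ∣ s := by
  obtain ⟨n, w, w', hw, hw', rfl⟩ := V.exists_germMk_eq s
  obtain ⟨m, u, u', hu, hu', rfl⟩ := V.exists_germMk_eq t
  have key : ∀ {n m : ℕ} {w w' u u' : A} (hw : w ∈ I ^ n) (hw' : V.val w' = n)
      (hu : u ∈ I ^ m) (hu' : V.val u' = m), w ≠ 0 → V.val w + m ≤ V.val u + n →
      V.germMk hw hw' ∣ V.germMk hu hu' := by
    intro n m w w' u u' hw hw' hu hu' hw0 hle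
    obtain ⟨N, hN⟩ := ENat.ne_top_iff_exists.1 (V.val_ne_top w hw0)
    refine ⟨V.germMk (n := N + m) (w := u * w') (w' := w * u') ?_ ?_, ?_⟩
    · rw [V.mem_pow_iff, V.val_mul, hw', Nat.cast_add, hN]
      exact hle
    · rw [V.val_mul, hu', Nat.cast_add, hN]
    · exact (V.germMk_mul_eq _ _ _ _ _ _ (by ring)).symm
  by_cases hw0 : w = 0
  · right
    subst hw0
    refine ⟨V.germMk hw hw', (V.germMk_mul_eq _ _ _ _ _ _ ?_).symm⟩
    ring
  by_cases hu0 : u = 0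
  · left
    subst hu0
    refine ⟨V.germMk hu hu', (V.germMk_mul_eq _ _ _ _ _ _ ?_).symm⟩
    ring
  rcases le_total (V.val w + m) (V.val u + n) with h | h
  · exact Or.inl (key _ _ _ _ hw0 h)
  · exact Or.inr (key _ _ _ _ hu0 h)

lemma val_one : V.val 1 = (0 : ℕ) := by
  have h := V.val_mul V.unif 1
  rw [mul_one, V.val_unif] at h
  have : (1 : ℕ∞) + V.val 1 = 1 + 0 := by rw [← h, add_zero]
  simpa using ENat.add_right_injective_of_ne_top (n := 1) (by decide) this

/-- The germ of `a` at the generic point of the exceptional divisor. -/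
def germOf (a : A) : (affineBlowup I).presheaf.stalk V.exceptionalPoint :=
  V.germMk (n := 0) (w := a) (w' := 1) (by simp) V.val_one

lemma not_isUnit_germOf_unif : ¬ IsUnit (V.germOf V.unif) := by
  intro h
  obtain ⟨t, ht⟩ := h.exists_right_inv
  obtain ⟨n, w, w', hw, hw', rfl⟩ := V.exists_germMk_eq t
  have h1 := congr(stalkToFrac (reesGrading I) _ $ht)
  have h0 : algebraMap _ (FractionRing (reesAlgebra I)) (algebraMap A (reesAlgebra I) w') ≠ 0 := by
    rw [Ne, FaithfulSMul.algebraMap_eq_zero_iff, algebraMap_eq_reesMonomial,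
      reesMonomial_eq_zero_iff]
    exact V.ne_zero_of_val_eq hw'
  rw [map_mul, germOf, stalkToFrac_germMk, stalkToFrac_germMk, map_one, map_one, map_one, div_one,
    ← mul_div_assoc, div_eq_one_iff_eq h0, ← map_mul, ← map_mul] at h1
  have h2 : V.unif * w = w' := by
    have h3 := IsFractionRing.injective (reesAlgebra I) (FractionRing (reesAlgebra I)) h1
    exact C_injective (congrArg Subtype.val h3)
  have h4 := V.val_mul V.unif w
  rw [h2, hw', V.val_unif] at h4
  have h5 := (V.mem_pow_iff n w).1 hw
  have h6 : (1 : ℕ∞) + n ≤ n := by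
    calc (1 : ℕ∞) + n ≤ 1 + V.val w := by gcongr
      _ = n := h4.symm
  have h7 : 1 + n ≤ n := by exact_mod_cast h6
  omega

end AdicValuation

end ExceptionalStalk

/-! ### Blowing up the unit ideal changes nothing. -/

section ReesTop

open Polynomial HomogeneousLocalization

variable {A : Type u} [CommRing A] (I : Ideal A)

lemma mem_pow_of_eq_top (hI : I = ⊤) (n : ℕ) (a : A) : a ∈ I ^ n := by
  rw [hI, Ideal.top_pow]; trivial

/-- The Rees algebra is A[t], and the degree-zero part of A[t, t⁻¹] is A. -/
lemma bijective_algebraMap_away_of_eq_top (hI : I = ⊤) : Function.Bijective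
    ((fromZeroRingHom (reesGrading I)
      (.powers (reesMonomial 1 1 (mem_pow_of_eq_top I hI 1 1)))).comp
        (algebraMap A (reesGrading I 0))) := by
  set t := reesMonomial 1 1 (mem_pow_of_eq_top I hI 1 1) with ht
  have htn : ∀ n, t ^ n = reesMonomial n 1 (mem_pow_of_eq_top I hI n 1) := fun n =>
    Subtype.ext (by simp [ht, reesMonomial, monomial_pow])
  have hval : ∀ a, ((fromZeroRingHom (reesGrading I) (.powers t)).comp
      (algebraMap A (reesGrading I 0)) a).val = algebraMap _ (Localization (.powers t))
        (algebraMap A (reesAlgebra I) a) := fun a => by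
    rw [← Localization.mk_one_eq_algebraMap]
    rfl
  constructor
  · rw [injective_iff_map_eq_zero]
    intro a ha
    have h1 := hval a
    rw [ha, val_zero, eq_comm, IsLocalization.map_eq_zero_iff (.powers t)] at h1
    obtain ⟨⟨_, n, rfl⟩, h2⟩ := h1
    simp only [htn] at h2
    rw [mul_comm, algebraMap_mul_reesMonomial a _ (mem_pow_of_eq_top I hI _ _),
      reesMonomial_eq_zero_iff, mul_one] at h2
    exact h2
  · intro y
    obtain ⟨n, x, hx, rfl⟩ := Away.mk_surjective (reesGrading I)
      (reesMonomial_mem 1 1 (mem_pow_of_eq_top I hI 1 1)) y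
    obtain ⟨w, hw, rfl⟩ := exists_reesMonomial hx
    refine ⟨w, val_injective _ ?_⟩
    rw [hval, Away.val_mk, ← Localization.mk_one_eq_algebraMap, Localization.mk_eq_mk_iff]
    rw [Localization.r_iff_exists]
    refine ⟨1, ?_⟩
    simp only [OneMemClass.coe_one, one_mul]
    apply Subtype.ext
    change ((t ^ n * algebraMap A (reesAlgebra I) w : reesAlgebra I) : A[X]) =
      ((reesMonomial _ w hw : reesAlgebra I) : A[X])
    rw [htn]
    rw [mul_comm, algebraMap_mul_reesMonomial w _ (mem_pow_of_eq_top I hI _ _)]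
    exact congrArg Subtype.val (reesMonomial_congr _ _ (by simp) (mul_one w))

/-- Every element of positive degree is a multiple of t, so the chart of t is all of Proj. -/
lemma isIso_projToSpec_of_eq_top (hI : I = ⊤) : IsIso (projToSpec (reesGrading I)) := by
  set t := reesMonomial 1 1 (mem_pow_of_eq_top I hI 1 1) with ht
  have htd : t ∈ reesGrading I 1 := reesMonomial_mem 1 1 _
  have h1 : (Proj.awayι (reesGrading I) t htd one_pos).opensRange = ⊤ := by
    rw [Proj.opensRange_awayι, eq_top_iff]
    intro x _
    rw [Proj.mem_basicOpen]
    intro hx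
    refine x.not_irrelevant_le ?_
    intro p hp
    rw [← HomogeneousIdeal.mem_iff]
    have : p = ∑ n ∈ (p : A[X]).support, reesMonomial n ((p : A[X]).coeff n) (p.2 n) := by
      apply Subtype.ext
      rw [AddSubmonoidClass.coe_finsetSum]
      exact (p : A[X]).as_sum_support
    rw [this]
    refine sum_mem fun n _ => ?_
    rcases Nat.eq_zero_or_pos n with rfl | hn
    · have h0 : (p : A[X]).coeff 0 = 0 := by
        rw [HomogeneousIdeal.mem_irrelevant_iff, GradedRing.proj_apply] at hp
        have h := coeff_coe_directSum (DirectSum.decompose (reesGrading I) p) 0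
        rw [hp, show DirectSum.coeAddMonoidHom (reesGrading I)
          (DirectSum.decompose (reesGrading I) p) = p from
          DirectSum.Decomposition.left_inv (ℳ := reesGrading I) p] at h
        simpa using h
      have : reesMonomial 0 ((p : A[X]).coeff 0) (p.2 0) = 0 :=
        (reesMonomial_eq_zero_iff _).2 h0
      rw [this]
      exact zero_mem _
    · obtain ⟨m, rfl⟩ := Nat.exists_eq_add_of_lt hn
      have : reesMonomial (0 + m + 1) ((p : A[X]).coeff (0 + m + 1)) (p.2 _) =
          reesMonomial (0 + m) ((p : A[X]).coeff (0 + m + 1)) (mem_pow_of_eq_top I hI _ _) * t :=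
        Subtype.ext (by simp [ht, reesMonomial, monomial_mul_monomial])
      rw [this]
      exact Ideal.mul_mem_left _ _ hx
  have h2 : IsIso (Proj.awayι (reesGrading I) t htd one_pos) :=
    isIso_of_isOpenImmersion_of_opensRange_eq_top _ h1
  have h3 : Proj.awayι (reesGrading I) t htd one_pos ≫ projToSpec (reesGrading I) =
      Spec.map (CommRingCat.ofHom ((fromZeroRingHom (reesGrading I) (.powers t)).comp
        (algebraMap A (reesGrading I 0)))) := by
    rw [projToSpec, Proj.awayι_toSpecZero_assoc, ← Spec.map_comp]
    rfl
  have h4 : IsIso (CommRingCat.ofHom ((fromZeroRingHom (reesGrading I) (.powers t)).comp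
        (algebraMap A (reesGrading I 0)))) := by
    exact (RingEquiv.ofBijective _
      (bijective_algebraMap_away_of_eq_top I hI)).toCommRingCatIso.isIso_hom
  have h5 : IsIso (Proj.awayι (reesGrading I) t htd one_pos ≫ projToSpec (reesGrading I)) := by
    rw [h3]; infer_instance
  exact IsIso.of_isIso_comp_left (Proj.awayι (reesGrading I) t htd one_pos) _

end ReesTop

/-! ### Finiteness of the structure morphism of Proj. -/

section FiniteType

variable {R A : Type u} [CommRing R] [CommRing A] [Algebra R A] [Algebra.FiniteType R A]
  (𝒜 : ℕ → Submodule R A) [GradedAlgebra 𝒜]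

lemma finiteType_projToSpec_of_surjective (h : Function.Surjective (algebraMap R (𝒜 0))) :
    LocallyOfFiniteType (projToSpec 𝒜) ∧ QuasiCompact (projToSpec 𝒜) := by
  have h0 : IsScalarTower R (𝒜 0) A := ⟨fun r x y => Algebra.smul_mul_assoc r (x : A) y⟩
  have h1 : Algebra.FiniteType (𝒜 0) A := Algebra.FiniteType.of_restrictScalars_finiteType R _ _
  have h2 : LocallyOfFiniteType (Spec.map (CommRingCat.ofHom (algebraMap R (𝒜 0)))) := by
    rw [HasRingHomProperty.Spec_iff (P := @LocallyOfFiniteType)]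
    exact RingHom.FiniteType.of_surjective _ h
  unfold projToSpec
  exact ⟨inferInstance, inferInstance⟩

end FiniteType

/-! ### Charts of a blowup; it is Noetherian and integral. -/

section Charts

variable {X Y : Scheme.{u}} {π : X ⟶ Y} {I : Y.IdealSheafData}

lemma IsBlowup.exists_chart (h : IsBlowup π I) (U : Y.affineOpens) :
    ∃ (ψ : affineBlowup (I.ideal U) ⟶ X) (_ : IsOpenImmersion ψ), ψ.opensRange = π ⁻¹ᵁ U.1 ∧
      ψ ≫ π = projToSpec (reesGrading (I.ideal U)) ≫ U.2.fromSpec := by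
  obtain ⟨φ, hφ⟩ := h U
  refine ⟨φ.inv ≫ (π ⁻¹ᵁ U.1).ι, inferInstance, ?_, ?_⟩
  · rw [Scheme.Hom.opensRange_comp_of_isIso, Scheme.Opens.opensRange_ι]
  · rw [Category.assoc, Iso.inv_comp_eq, reassoc_of% hφ, ← morphismRestrict_ι]
    exact congrArg (π ∣_ U.1 ≫ ·) (IsAffineOpen.isoSpec_hom_fromSpec U.2).symm

lemma IsBlowup.exists_chart_of_eq_top (h : IsBlowup π I) (U : Y.affineOpens)
    (hU : I.ideal U = ⊤) : IsIso (π ∣_ U.1) := by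
  obtain ⟨φ, hφ⟩ := h U
  have := isIso_projToSpec_of_eq_top _ hU
  have h1 : π ∣_ U.1 = φ.hom ≫ projToSpec (reesGrading (I.ideal U)) ≫ U.2.isoSpec.inv := by
    rw [reassoc_of% hφ, Iso.hom_inv_id, Category.comp_id]
  rw [h1]
  infer_instance

lemma IsBlowup.isIso_stalkMap (h : IsBlowup π I) (U : Y.affineOpens)
    (hU : I.ideal U = ⊤) (z : X) (hz : π z ∈ U.1) : IsIso (π.stalkMap z) := by
  have := h.exists_chart_of_eq_top U hU
  have h2 : ∀ w, IsIso ((π ∣_ U.1).stalkMap w) := fun w => inferInstance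
  have e := morphismRestrictStalkMap π U.1 ⟨z, hz⟩
  exact ((MorphismProperty.isomorphisms CommRingCat).arrow_mk_iso_iff e).1 (h2 _)

lemma IsBlowup.exists_preimage (h : IsBlowup π I) (U : Y.affineOpens)
    (hU : I.ideal U = ⊤) (y : Y) (hy : y ∈ U.1) : ∃ z, π z = y := by
  have := h.exists_chart_of_eq_top U hU
  obtain ⟨z, hz⟩ := (π ∣_ U.1).surjective ⟨y, hy⟩
  refine ⟨z.1, ?_⟩
  have := congrArg Subtype.val hz
  rwa [morphismRestrict_base_coe] at this

lemma finiteType_projToSpec {A : Type u} [CommRing A] [IsNoetherianRing A] (I : Ideal A) :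
    LocallyOfFiniteType (projToSpec (reesGrading I)) ∧
      QuasiCompact (projToSpec (reesGrading I)) := by
  refine finiteType_projToSpec_of_surjective _ fun y => ?_
  obtain ⟨w, hw, e⟩ := exists_reesMonomial y.2
  refine ⟨w, Subtype.ext ?_⟩
  rw [e]
  exact algebraMap_eq_reesMonomial w

/-- Over affine opens the Rees algebra of a Noetherian ring is of finite type; finite type and
quasi-compactness of π are then checked locally on Y. -/
lemma IsBlowup.isNoetherian [IsNoetherian Y] (h : IsBlowup π I) : IsNoetherian X := by
  have key : ∀ U : Y.affineOpens, LocallyOfFiniteType (π ∣_ U.1) ∧ QuasiCompact (π ∣_ U.1) := by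
    intro U
    obtain ⟨φ, hφ⟩ := h U
    have h1 : π ∣_ U.1 = φ.hom ≫ projToSpec (reesGrading (I.ideal U)) ≫ U.2.isoSpec.inv := by
      rw [reassoc_of% hφ, Iso.hom_inv_id, Category.comp_id]
    have : IsNoetherianRing Γ(Y, U.1) := IsLocallyNoetherian.component_noetherian U
    obtain ⟨h2, h3⟩ := finiteType_projToSpec (I.ideal U)
    rw [h1]
    exact ⟨inferInstance, inferInstance⟩
  have h1 : LocallyOfFiniteType π :=
    @IsZariskiLocalAtTarget.of_iSup_eq_top (@LocallyOfFiniteType : MorphismProperty Scheme.{u})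
      (HasRingHomProperty.instIsZariskiLocalAtTarget
        (P := (@LocallyOfFiniteType : MorphismProperty Scheme.{u}))) _ _ _ _ _
      (iSup_affineOpens_eq_top Y) fun U => (key U).1
  have h2 : QuasiCompact π := by
    refine (quasiCompact_iff_forall_isAffineOpen).2 fun U hU => ?_
    obtain ⟨ψ, h3, h4, -⟩ := h.exists_chart ⟨U, hU⟩
    have := (key ⟨U, hU⟩).2
    have : IsAffine U := hU
    rw [isCompact_iff_compactSpace]
    exact QuasiCompact.compactSpace_of_compactSpace (π ∣_ U)
  have h3 : IsLocallyNoetherian X := LocallyOfFiniteType.isLocallyNoetherian π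
  have h4 : CompactSpace X := QuasiCompact.compactSpace_of_compactSpace π
  exact {}

/-- The charts are Proj of domains, hence integral, and all those over nonempty opens contain the
given point over the generic point of Y. An open cover by irreducible sets that pairwise meet has
irreducible union. -/
lemma IsBlowup.isIntegral [IsIntegral Y] (h : IsBlowup π I)
    (hI : ∀ y : Y, ∃ U : Y.affineOpens, y ∈ U.1 ∧ I.ideal U ≠ ⊥)
    (hgen : ∃ z, π z = genericPoint Y) : IsIntegral X := by
  have hc : ∀ U : Y.affineOpens, (U.1 : Set Y).Nonempty → I.ideal U ≠ ⊥ →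
      IsIntegral (affineBlowup (I.ideal U)) := by
    rintro U ⟨y, hy⟩ hU
    have : Nonempty U.1 := ⟨y, hy⟩
    obtain ⟨a, ha, ha0⟩ := Submodule.exists_mem_ne_zero_of_ne_bot hU
    exact isIntegral_proj (reesGrading (I.ideal U)) one_pos
      (reesMonomial_mem 1 a (by rwa [pow_one])) (by rwa [Ne, reesMonomial_eq_zero_iff])
  obtain ⟨z, hz⟩ := hgen
  have hg : ∀ U : Y.Opens, (U : Set Y).Nonempty → z ∈ π ⁻¹ᵁ U := by
    intro U hU
    change π z ∈ U
    rw [hz]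
    exact ((genericPoint_spec Y).mem_open_set_iff U.isOpen).2 (by simpa using hU)
  have hred : IsReduced X := by
    refine @isReduced_of_isReduced_stalk X fun x => ?_
    obtain ⟨U, hxU, hIU⟩ := hI (π x)
    obtain ⟨ψ, h1, h2, -⟩ := h.exists_chart U
    have hx : x ∈ ψ.opensRange := by rw [h2]; exact hxU
    obtain ⟨y, rfl⟩ := hx
    have := hc U ⟨_, hxU⟩ hIU
    exact isReduced_of_injective (ψ.stalkMap y).hom
      (asIso (ψ.stalkMap y)).commRingCatIsoToRingEquiv.injective
  have hirr : PreirreducibleSpace X := by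
    refine PreirreducibleSpace.of_isOpenCover
      (ι := {U : Y.affineOpens // (U.1 : Set Y).Nonempty ∧ I.ideal U ≠ ⊥})
      (U := fun U => π ⁻¹ᵁ U.1.1) ?_ ?_ ?_
    · intro U V _ hd
      have := hd.le_bot (show z ∈ π ⁻¹ᵁ U.1.1 ⊓ π ⁻¹ᵁ V.1.1 from ⟨hg _ U.2.1, hg _ V.2.1⟩)
      exact this
    · rw [TopologicalSpace.IsOpenCover, eq_top_iff]
      intro x _
      obtain ⟨U, hxU, hIU⟩ := hI (π x)
      exact TopologicalSpace.Opens.mem_iSup.2 ⟨⟨U, ⟨_, hxU⟩, hIU⟩, hxU⟩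
    · intro U
      obtain ⟨ψ, h1, h2, -⟩ := h.exists_chart U.1
      have := hc U.1 U.2.1 U.2.2
      have h3 : IsPreirreducible (Set.range ψ) := by
        rw [← Set.image_univ]
        exact (PreirreducibleSpace.isPreirreducible_univ).image _ ψ.continuous.continuousOn
      have h4 : (Set.range ψ) = (π ⁻¹ᵁ U.1.1 : X.Opens) := by
        rw [← h2]; rfl
      rw [h4] at h3
      exact Subtype.preirreducibleSpace h3
  have : IrreducibleSpace X := { toNonempty := ⟨z⟩ }
  exact isIntegral_of_irreducibleSpace_of_isReduced _

end Charts

/-! ### Sections over basic open sets as fractions. -/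

section BasicOpen

variable {A : Type u} {σ : Type*} [CommRing A] [SetLike σ A] [AddSubgroupClass σ A]
  (𝒜 : ℕ → σ) [GradedRing 𝒜]

lemma mapId_awayMk {f : A} {m : ℕ} (hf : f ∈ 𝒜 m) {Q : Submonoid A} (h : Submonoid.powers f ≤ Q)
    {n : ℕ} {F : A} (hF : F ∈ 𝒜 (n • m)) :
    HomogeneousLocalization.mapId 𝒜 h (HomogeneousLocalization.Away.mk 𝒜 hf n F hF) =
      .mk ⟨n • m, ⟨F, hF⟩, ⟨f ^ n, SetLike.pow_mem_graded n hf⟩, h ⟨n, rfl⟩⟩ :=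
  rfl

end BasicOpen

section BasicOpen

variable {A : Type u} {σ : Type*} [CommRing A] [IsDomain A] [SetLike σ A] [AddSubgroupClass σ A]
  (𝒜 : ℕ → σ) [GradedRing 𝒜]

lemma stalkToFrac_germ_awayToSection {f : A} {m : ℕ} (hf : f ∈ 𝒜 m) (x : Proj 𝒜)
    (hx : x ∈ Proj.basicOpen 𝒜 f) {n : ℕ} {F : A} (hF : F ∈ 𝒜 (n • m)) :
    stalkToFrac 𝒜 x ((Proj 𝒜).presheaf.germ _ x hx
      (Proj.awayToSection 𝒜 f (HomogeneousLocalization.Away.mk 𝒜 hf n F hF))) =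
      algebraMap A (FractionRing A) F / algebraMap A (FractionRing A) f ^ n := by
  have h1 := congr($(ProjectiveSpectrum.Proj.awayToSection_germ 𝒜 f x hx).hom
    (HomogeneousLocalization.Away.mk 𝒜 hf n F hF))
  have h2 : (Proj.stalkIso 𝒜 x).hom.hom ((Proj 𝒜).presheaf.germ _ x hx
      (Proj.awayToSection 𝒜 f (HomogeneousLocalization.Away.mk 𝒜 hf n F hF))) =
      HomogeneousLocalization.mapId 𝒜 (Submonoid.powers_le.mpr hx)
        (HomogeneousLocalization.Away.mk 𝒜 hf n F hF) := by
    refine Eq.trans (congrArg (Proj.stalkIso 𝒜 x).hom.hom h1) ?_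
    exact congr($((Proj.stalkIso 𝒜 x).inv_hom_id).hom _)
  rw [stalkToFrac, RingHom.comp_apply, h2]
  rw [mapId_awayMk, atPrimeToFrac_mk]
  simp

lemma exists_section_basicOpen {f : A} {m : ℕ} (hf : f ∈ 𝒜 m) {n : ℕ} {F : A}
    (hF : F ∈ 𝒜 (n • m)) : ∃ s : Γ(Proj 𝒜, Proj.basicOpen 𝒜 f),
      ∀ (x : Proj 𝒜) (hx : x ∈ Proj.basicOpen 𝒜 f),
        stalkToFrac 𝒜 x ((Proj 𝒜).presheaf.germ _ x hx s) =
          algebraMap A (FractionRing A) F / algebraMap A (FractionRing A) f ^ n :=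
  ⟨_, fun x hx => stalkToFrac_germ_awayToSection 𝒜 hf x hx hF⟩

lemma exists_stalkToFrac_germ_eq {f : A} {m : ℕ} (hf : f ∈ 𝒜 m) (hm : 0 < m)
    (s : Γ(Proj 𝒜, Proj.basicOpen 𝒜 f)) : ∃ (n : ℕ) (F : A), F ∈ 𝒜 (n • m) ∧
      ∀ (x : Proj 𝒜) (hx : x ∈ Proj.basicOpen 𝒜 f),
        stalkToFrac 𝒜 x ((Proj 𝒜).presheaf.germ _ x hx s) =
          algebraMap A (FractionRing A) F / algebraMap A (FractionRing A) f ^ n := by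
  obtain ⟨n, F, hF, h⟩ := HomogeneousLocalization.Away.mk_surjective 𝒜 hf
    ((Proj.basicOpenIsoAway 𝒜 f hf hm).inv s)
  refine ⟨n, F, hF, fun x hx => ?_⟩
  rw [← stalkToFrac_germ_awayToSection 𝒜 hf x hx hF, h]
  congr 2
  have h1 := congr($((Proj.basicOpenIsoAway 𝒜 f hf hm).inv_hom_id).hom s)
  rw [← Proj.basicOpenIsoAway_hom 𝒜 f hf hm]
  exact h1.symm

end BasicOpen

/-! ### The ideal of t₀ on the torus and its powers. -/

section TorusChart

open MvPolynomial

variable {k : Type u} [Field k] {a b c : ℕ}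

lemma ordOne_eq_zero {σ : Type*} [Fintype σ] {F : MvPolynomial σ k}
    (h : eval (fun _ : σ => (1 : k)) F ≠ 0) : ordOne F = 0 := by
  by_contra h0
  exact h (one_le_ordOne_iff.1 (Order.one_le_iff_ne_zero.2 h0))

lemma monomial_mem_wGrading (i j l : ℕ) :
    (X 0 ^ i * X 1 ^ j * X 2 ^ l : MvPolynomial (Fin 3) k) ∈
      wGrading k a b c (a * i + b * j + c * l) := by
  rw [← monomial_expo, mem_weightedHomogeneousSubmodule]
  refine isWeightedHomogeneous_monomial _ _ _ ?_
  rw [Finsupp.weight_apply, Finsupp.sum_fintype _ _ (by simp), Fin.sum_univ_three]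
  simp [mul_comm]

lemma torusEq_mem : (X 0 * X 1 * X 2 : MvPolynomial (Fin 3) k) ∈ wGrading k a b c (a + b + c) := by
  simpa using monomial_mem_wGrading (k := k) (a := a) (b := b) (c := c) 1 1 1

lemma ordOne_binomial [CharZero k] (hb : 0 < b) :
    ordOne (X 0 ^ b - X 1 ^ a : MvPolynomial (Fin 3) k) = 1 := by
  have h1 : (X 0 ^ b - X 1 ^ a : MvPolynomial (Fin 3) k) =
      monomial (expo b 0 0) 1 - monomial (expo 0 a 0) 1 := by
    rw [monomial_expo, monomial_expo]; simp
  refine le_antisymm ?_ (one_le_ordOne_iff.2 (by simp))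
  by_contra! h
  have h2 : ((2 : ℕ) : ℕ∞) ≤ ordOne (X 0 ^ b - X 1 ^ a : MvPolynomial (Fin 3) k) := by
    have := Order.add_one_le_of_lt h
    rwa [one_add_one_eq_two] at this
  have h3 := le_ordOne_iff.1 h2 (expo 1 0 0) (by
    rw [Finsupp.degree_eq_sum, Fin.sum_univ_three]; simp)
  rw [coeff_taylorOne, h1, map_sub, moment_monomial, moment_monomial, Fin.prod_univ_three,
    Fin.prod_univ_three] at h3
  simp at h3
  omega

/-- An embedding `j` of a ring into the field of fractions of `k[x, y, z]` whose image is the ring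
of regular functions on the torus of the weighted projective plane. -/
structure TorusChart (a b c : ℕ) {A : Type u} [CommRing A]
    (j : A →+* FractionRing (MvPolynomial (Fin 3) k)) (I : Ideal A) : Prop where
  injective : Function.Injective j
  exists_preimage : ∀ {n : ℕ} {F : MvPolynomial (Fin 3) k}, F ∈ wGrading k a b c (n • (a + b + c)) →
    ∃ s, j s = algebraMap _ _ F / algebraMap (MvPolynomial (Fin 3) k) _ (X 0 * X 1 * X 2) ^ n
  exists_eq : ∀ s, ∃ (n : ℕ) (F : MvPolynomial (Fin 3) k), F ∈ wGrading k a b c (n • (a + b + c)) ∧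
    j s = algebraMap _ _ F / algebraMap (MvPolynomial (Fin 3) k) _ (X 0 * X 1 * X 2) ^ n
  mem_ideal_iff : ∀ {s : A} {n : ℕ} {F : MvPolynomial (Fin 3) k},
    F ∈ wGrading k a b c (n • (a + b + c)) →
    j s = algebraMap _ _ F / algebraMap (MvPolynomial (Fin 3) k) _ (X 0 * X 1 * X 2) ^ n →
    (s ∈ I ↔ eval (fun _ => (1 : k)) F = 0)

namespace TorusChart

variable {A : Type u} [CommRing A] {j : A →+* FractionRing (MvPolynomial (Fin 3) k)} {I : Ideal A}

/-- The order of vanishing at the identity of the torus. -/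
def val (h : TorusChart a b c j I) (s : A) : ℕ∞ := ordOne (h.exists_eq s).choose_spec.choose

lemma torusEq_ne_zero (k : Type u) [Field k] : algebraMap (MvPolynomial (Fin 3) k)
    (FractionRing (MvPolynomial (Fin 3) k)) (X 0 * X 1 * X 2) ≠ 0 := by
  simp

lemma ordOne_eq_of_div_eq {n n' : ℕ} {F F' : MvPolynomial (Fin 3) k}
    (h1 : algebraMap (MvPolynomial (Fin 3) k) (FractionRing (MvPolynomial (Fin 3) k)) F /
        algebraMap (MvPolynomial (Fin 3) k) _ (X 0 * X 1 * X 2) ^ n =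
      algebraMap (MvPolynomial (Fin 3) k) _ F' /
        algebraMap (MvPolynomial (Fin 3) k) _ (X 0 * X 1 * X 2) ^ n') : ordOne F = ordOne F' := by
  rw [div_eq_div_iff (pow_ne_zero _ (torusEq_ne_zero k)) (pow_ne_zero _ (torusEq_ne_zero k)),
    ← RingHom.map_pow, ← RingHom.map_pow, ← RingHom.map_mul, ← RingHom.map_mul] at h1
  have h2 := congrArg ordOne (IsFractionRing.injective _ _ h1)
  have h3 : ∀ m, ordOne ((X 0 * X 1 * X 2 : MvPolynomial (Fin 3) k) ^ m) = 0 := fun m =>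
    ordOne_eq_zero (by simp)
  rw [ordOne_mul, ordOne_mul, h3, h3, add_zero, add_zero] at h2
  exact h2

lemma val_eq (h : TorusChart a b c j I) {s : A} {n : ℕ} {F : MvPolynomial (Fin 3) k}
    (hs : j s = algebraMap _ _ F / algebraMap (MvPolynomial (Fin 3) k) _ (X 0 * X 1 * X 2) ^ n) :
    h.val s = ordOne F :=
  (ordOne_eq_of_div_eq (hs.symm.trans (h.exists_eq s).choose_spec.choose_spec.2)).symm

lemma exists_laurent (h : TorusChart a b c j I) {p q r : ℤ} (hpqr : a * p + b * q + c * r = 0) :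
    ∃ s, j s = algebraMap (MvPolynomial (Fin 3) k) _ (X 0) ^ p *
      algebraMap (MvPolynomial (Fin 3) k) _ (X 1) ^ q * algebraMap (MvPolynomial (Fin 3) k) _ (X 2) ^ r ∧
      s - 1 ∈ I := by
  have hX : ∀ i : Fin 3, algebraMap (MvPolynomial (Fin 3) k)
    (FractionRing (MvPolynomial (Fin 3) k)) (X i) ≠ 0 := fun i => by simp
  -- Multiplying by (xyz)^N makes all three exponents nonnegative.
  set N := p.natAbs + q.natAbs + r.natAbs
  obtain ⟨p', hp'⟩ := Int.eq_ofNat_of_zero_le (show 0 ≤ p + N by omega)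
  obtain ⟨q', hq'⟩ := Int.eq_ofNat_of_zero_le (show 0 ≤ q + N by omega)
  obtain ⟨r', hr'⟩ := Int.eq_ofNat_of_zero_le (show 0 ≤ r + N by omega)
  have hdeg : a * p' + b * q' + c * r' = N • (a + b + c) := by
    rw [smul_eq_mul]
    zify
    rw [← hp', ← hq', ← hr']
    linear_combination hpqr
  have hF := monomial_mem_wGrading (k := k) (a := a) (b := b) (c := c) p' q' r'
  rw [hdeg] at hF
  obtain ⟨s, hs⟩ := h.exists_preimage hF
  refine ⟨s, ?_, ?_⟩
  · rw [hs, div_eq_iff (pow_ne_zero _ (torusEq_ne_zero k))]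
    simp only [RingHom.map_mul, RingHom.map_pow, mul_pow]
    rw [← zpow_natCast _ p', ← zpow_natCast _ q', ← zpow_natCast _ r', ← hp', ← hq', ← hr',
      zpow_add₀ (hX 0), zpow_add₀ (hX 1), zpow_add₀ (hX 2)]
    simp only [zpow_natCast]
    ring
  · have hG : (X 0 * X 1 * X 2 : MvPolynomial (Fin 3) k) ^ N ∈
        wGrading k a b c (N • (a + b + c)) := SetLike.pow_mem_graded N torusEq_mem
    rw [h.mem_ideal_iff (n := N) (sub_mem hF hG)]
    · simp
    · rw [RingHom.map_sub, RingHom.map_sub, hs, sub_div, RingHom.map_one, RingHom.map_pow,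
        div_self (pow_ne_zero _ (torusEq_ne_zero k))]

/-- Since gcd(a,b,c) = 1 there is a Laurent monomial θ of degree one. Dividing a form of degree d by
θ^d dehomogenises k[x,y,z] into the ring of the torus, and the variables go to Laurent monomials of
degree zero, which take the value 1 at t₀. -/
lemma exists_retraction (h : TorusChart a b c j I) (habc : Nat.gcd (Nat.gcd a b) c = 1) :
    ∃ (θ : FractionRing (MvPolynomial (Fin 3) k)) (ρ : MvPolynomial (Fin 3) k →+* A), θ ≠ 0 ∧
      (∀ (d : ℕ) (F : MvPolynomial (Fin 3) k), F ∈ wGrading k a b c d →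
        j (ρ F) * θ ^ d = algebraMap _ _ F) ∧ (∀ i, ρ (X i) - 1 ∈ I) ∧
      IsUnit (ρ (X 0 * X 1 * X 2)) := by
  have hX : ∀ i : Fin 3, algebraMap (MvPolynomial (Fin 3) k)
    (FractionRing (MvPolynomial (Fin 3) k)) (X i) ≠ 0 := fun i => by simp
  obtain ⟨α, β, γ, hαβγ⟩ : ∃ α β γ : ℤ, a * α + b * β + c * γ = 1 := by
    have h1 := Nat.gcd_eq_gcd_ab a b
    have h2 := Nat.gcd_eq_gcd_ab (Nat.gcd a b) c
    rw [habc, h1] at h2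
    exact ⟨Nat.gcdA a b * Nat.gcdA (Nat.gcd a b) c, Nat.gcdB a b * Nat.gcdA (Nat.gcd a b) c,
      Nat.gcdB (Nat.gcd a b) c, by push_cast at h2; linear_combination -h2⟩
  set θ : FractionRing (MvPolynomial (Fin 3) k) :=
    algebraMap (MvPolynomial (Fin 3) k) _ (X 0) ^ α * algebraMap (MvPolynomial (Fin 3) k) _ (X 1) ^ β *
      algebraMap (MvPolynomial (Fin 3) k) _ (X 2) ^ γ with hθ
  have hθ0 : θ ≠ 0 := mul_ne_zero (mul_ne_zero (zpow_ne_zero _ (hX 0)) (zpow_ne_zero _ (hX 1)))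
    (zpow_ne_zero _ (hX 2))
  have hθpow : ∀ n : ℕ, θ ^ n = algebraMap (MvPolynomial (Fin 3) k) _ (X 0) ^ (n * α) *
      algebraMap (MvPolynomial (Fin 3) k) _ (X 1) ^ (n * β) *
      algebraMap (MvPolynomial (Fin 3) k) _ (X 2) ^ (n * γ) := fun n => by
    rw [hθ, mul_pow, mul_pow, ← zpow_natCast, ← zpow_natCast, ← zpow_natCast, ← zpow_mul,
      ← zpow_mul, ← zpow_mul, mul_comm α, mul_comm β, mul_comm γ]
  have hvar : ∀ i : Fin 3, ∃ s, j s * θ ^ (![a, b, c] i) =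
      algebraMap (MvPolynomial (Fin 3) k) _ (X i) ∧ s - 1 ∈ I := by
    have key : ∀ (n : ℕ) (p q r : ℤ), a * p + b * q + c * r = n → ∃ s, j s * θ ^ n =
        algebraMap (MvPolynomial (Fin 3) k) _ (X 0) ^ p *
          algebraMap (MvPolynomial (Fin 3) k) _ (X 1) ^ q * algebraMap (MvPolynomial (Fin 3) k) _ (X 2) ^ r ∧
        s - 1 ∈ I := by
      intro n p q r hn
      obtain ⟨s, hs, hs'⟩ := h.exists_laurent (p := p - n * α) (q := q - n * β) (r := r - n * γ)
        (by linear_combination hn - n * hαβγ)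
      refine ⟨s, ?_, hs'⟩
      rw [hs, hθpow, zpow_sub₀ (hX 0), zpow_sub₀ (hX 1), zpow_sub₀ (hX 2)]
      have := zpow_ne_zero (n * α) (hX 0)
      have := zpow_ne_zero (n * β) (hX 1)
      have := zpow_ne_zero (n * γ) (hX 2)
      field_simp
    intro i
    fin_cases i
    · simpa using key a 1 0 0 (by ring)
    · simpa using key b 0 1 0 (by ring)
    · simpa using key c 0 0 1 (by ring)
  choose v hv hvI using hvar
  have hconst : ∀ r : k, ∃ s, j s = algebraMap (MvPolynomial (Fin 3) k) _ (C r) := fun r => by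
    obtain ⟨s, hs⟩ := h.exists_preimage (n := 0) (F := C r) (by
      rw [zero_smul, mem_weightedHomogeneousSubmodule]
      exact isWeightedHomogeneous_C _ r)
    exact ⟨s, by rw [hs, pow_zero, div_one]⟩
  let ρL : MvPolynomial (Fin 3) k →+* FractionRing (MvPolynomial (Fin 3) k) :=
    eval₂Hom ((algebraMap (MvPolynomial (Fin 3) k) _).comp C) fun i => j (v i)
  have hmem : ∀ F, ρL F ∈ j.range := by
    intro F
    induction F using MvPolynomial.induction_on with
    | C r =>
      obtain ⟨s, hs⟩ := hconst r
      exact ⟨s, by rw [hs]; simp [ρL]⟩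
    | add p q hp hq => rw [RingHom.map_add]; exact add_mem hp hq
    | mul_X p i hp =>
      rw [RingHom.map_mul]
      exact mul_mem hp ⟨v i, by simp [ρL]⟩
  let ρ : MvPolynomial (Fin 3) k →+* A :=
    (RingEquiv.ofBijective j.rangeRestrict ⟨fun x y hxy => h.injective (congrArg Subtype.val hxy),
      j.rangeRestrict_surjective⟩).symm.toRingHom.comp (ρL.codRestrict j.range hmem)
  have hρ : ∀ F, j (ρ F) = ρL F := fun F => by
    have := (RingEquiv.ofBijective j.rangeRestrict ⟨fun x y hxy => h.injective
      (congrArg Subtype.val hxy), j.rangeRestrict_surjective⟩).apply_symm_apply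
        (ρL.codRestrict j.range hmem F)
    exact congrArg Subtype.val this
  have hρX : ∀ i, ρ (X i) = v i := fun i => h.injective (by rw [hρ]; simp [ρL])
  have hgraded : ∀ (d : ℕ) (F : MvPolynomial (Fin 3) k), F ∈ wGrading k a b c d →
        j (ρ F) * θ ^ d = algebraMap _ _ F := by
    intro d F hF
    rw [hρ, F.as_sum, map_sum, map_sum, Finset.sum_mul]
    refine Finset.sum_congr rfl fun δ hδ => ?_
    have hd := weight_eq_of_mem_support ((mem_weightedHomogeneousSubmodule _ _ _ _).1 hF) hδ
    have h0 := hv 0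
    have h1 := hv 1
    have h2 := hv 2
    simp only [Matrix.cons_val_zero, Matrix.cons_val_one, Matrix.cons_val] at h0 h1 h2
    rw [← hd, monomial_eq, Finsupp.prod_fintype _ _ (by simp), Fin.prod_univ_three]
    simp only [RingHom.map_mul, RingHom.map_pow, ← h0, ← h1, ← h2]
    simp only [ρL, coe_eval₂Hom, eval₂_C, eval₂_X, RingHom.comp_apply, pow_add, pow_mul, mul_pow]
    ring
  refine ⟨θ, ρ, hθ0, hgraded, fun i => by rw [hρX]; exact hvI i, ?_⟩
  obtain ⟨s, hs, -⟩ := h.exists_laurent (p := (a + b + c : ℕ) * α - 1)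
    (q := (a + b + c : ℕ) * β - 1) (r := (a + b + c : ℕ) * γ - 1)
    (by push_cast; linear_combination (a + b + c : ℤ) * hαβγ)
  refine IsUnit.of_mul_eq_one s (h.injective ?_)
  have h1 := hgraded _ _ (torusEq_mem (k := k) (a := a) (b := b) (c := c))
  rw [hθpow] at h1
  refine mul_right_cancel₀ (torusEq_ne_zero k) ?_
  rw [RingHom.map_mul, RingHom.map_one, one_mul]
  conv_rhs => rw [← h1]
  rw [hs, zpow_sub₀ (hX 0), zpow_sub₀ (hX 1), zpow_sub₀ (hX 2)]
  simp only [RingHom.map_mul, zpow_one]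
  have := hX 0
  have := hX 1
  have := hX 2
  field_simp

lemma le_val_add (h : TorusChart a b c j I) {m : ℕ} {s t : A} (hs : (m : ℕ∞) ≤ h.val s)
    (ht : (m : ℕ∞) ≤ h.val t) : (m : ℕ∞) ≤ h.val (s + t) := by
  obtain ⟨n, F, -, hF⟩ := h.exists_eq s
  obtain ⟨n', F', -, hF'⟩ := h.exists_eq t
  have h1 : j (s + t) = algebraMap (MvPolynomial (Fin 3) k) _
      (F * (X 0 * X 1 * X 2) ^ n' + F' * (X 0 * X 1 * X 2) ^ n) /
      algebraMap (MvPolynomial (Fin 3) k) _ (X 0 * X 1 * X 2) ^ (n + n') := by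
    rw [RingHom.map_add, hF, hF', RingHom.map_add, RingHom.map_mul _ F, RingHom.map_mul _ F',
      RingHom.map_pow, RingHom.map_pow, pow_add]
    have := torusEq_ne_zero k
    field_simp
  rw [h.val_eq hF, le_ordOne_iff] at hs
  rw [h.val_eq hF', le_ordOne_iff] at ht
  have h2 : ∀ {G H : MvPolynomial (Fin 3) k}, VanishesToOrder m G → VanishesToOrder m (G * H) :=
    fun {G H} hG => by
      rw [← le_ordOne_iff] at hG ⊢
      rw [ordOne_mul]
      exact hG.trans le_self_add
  rw [h.val_eq h1, le_ordOne_iff]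
  intro β hβ
  rw [map_add, coeff_add, h2 hs β hβ, h2 ht β hβ, add_zero]

lemma val_mul (h : TorusChart a b c j I) (s t : A) : h.val (s * t) = h.val s + h.val t := by
  obtain ⟨n, F, -, hF⟩ := h.exists_eq s
  obtain ⟨n', F', -, hF'⟩ := h.exists_eq t
  rw [h.val_eq hF, h.val_eq hF', ← ordOne_mul]
  refine h.val_eq (n := n + n') ?_
  rw [RingHom.map_mul, hF, hF', RingHom.map_mul _ F, div_mul_div_comm, pow_add]

lemma le_val_of_mem_pow (h : TorusChart a b c j I) (m : ℕ) (s : A) (hs : s ∈ I ^ m) :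
    (m : ℕ∞) ≤ h.val s := by
  induction m generalizing s with
  | zero => simp
  | succ m ih =>
    rw [pow_succ] at hs
    refine Submodule.mul_induction_on hs (fun x hx y hy => ?_) fun x y hx hy => h.le_val_add hx hy
    rw [h.val_mul, Nat.cast_succ]
    refine add_le_add (ih x hx) ?_
    obtain ⟨n, F, hF1, hF⟩ := h.exists_eq y
    rw [h.val_eq hF, one_le_ordOne_iff]
    exact (h.mem_ideal_iff hF1 hF).1 hy

/-- After dehomogenising, s is ρ(F) times a unit, and the Taylor expansion of F at (1,1,1) puts ρ(F)
in I^m. Together with the preceding lemma, the powers of I are the filtration by order of vanishing.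
-/
lemma mem_pow_of_le_val (h : TorusChart a b c j I) (habc : Nat.gcd (Nat.gcd a b) c = 1) (m : ℕ)
    (s : A) (hs : (m : ℕ∞) ≤ h.val s) : s ∈ I ^ m := by
  obtain ⟨θ, ρ, hθ0, hρ, hρI, hu⟩ := h.exists_retraction habc
  obtain ⟨n, F, hF1, hF⟩ := h.exists_eq s
  rw [h.val_eq hF, le_ordOne_iff] at hs
  have h1 := map_mem_pow_of_vanishesToOrder ρ hρI hs
  have h2 : s * ρ (X 0 * X 1 * X 2) ^ n = ρ F := by
    refine h.injective (mul_right_cancel₀ (pow_ne_zero (n • (a + b + c)) hθ0) ?_)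
    rw [hρ _ _ hF1, RingHom.map_mul, hF, RingHom.map_pow, mul_assoc, smul_eq_mul, mul_comm n,
      pow_mul, ← mul_pow, hρ _ _ torusEq_mem, div_mul_cancel₀ _ (pow_ne_zero _ (torusEq_ne_zero k))]
  obtain ⟨w, hw⟩ := (hu.pow n).exists_right_inv
  have h3 : s = ρ F * w := by rw [← h2, mul_assoc, hw, mul_one]
  rw [h3]
  exact Ideal.mul_mem_right _ _ h1

/-- The order of vanishing at the identity of the torus as an adic valuation. -/
def adicValuation [CharZero k] (h : TorusChart a b c j I) (habc : Nat.gcd (Nat.gcd a b) c = 1)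
    (hb : 0 < b) (hc : 0 < c) : AdicValuation I :=
  have hex : ∃ s, h.val s = 1 := by
    -- The form x^b - y^a has order one; the power of x brings the degree to ab(a+b+c) without
    -- changing the order.
    have hF : (X 0 ^ b - X 1 ^ a) * X 0 ^ (b * (a + b + c - 1)) ∈
        wGrading k a b c ((a * b) • (a + b + c)) := by
      have h1 : (X 0 ^ b - X 1 ^ a : MvPolynomial (Fin 3) k) ∈ wGrading k a b c (a * b) := by
        refine sub_mem ?_ ?_
        · simpa using monomial_mem_wGrading (k := k) (a := a) (b := b) (c := c) b 0 0
        · simpa [mul_comm] using monomial_mem_wGrading (k := k) (a := a) (b := b) (c := c) 0 a 0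
      have h2 := SetLike.mul_mem_graded h1 (monomial_mem_wGrading (k := k) (a := a) (b := b)
        (c := c) (b * (a + b + c - 1)) 0 0)
      simp only [pow_zero, mul_one, mul_zero, add_zero] at h2
      convert h2 using 2
      rw [smul_eq_mul]
      obtain ⟨N, hN⟩ : ∃ N, a + b + c = N + 1 := ⟨a + b + c - 1, by omega⟩
      rw [hN, Nat.add_sub_cancel]; ring
    obtain ⟨s, hs⟩ := h.exists_preimage hF
    refine ⟨s, ?_⟩
    rw [h.val_eq hs, ordOne_mul, ordOne_binomial hb, ordOne_eq_zero (F := X 0 ^ _) (by simp),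
      add_zero]
  { val := h.val
    mem_pow_iff := fun n s => ⟨h.le_val_of_mem_pow n s, h.mem_pow_of_le_val habc n s⟩
    val_mul := h.val_mul
    val_ne_top := fun s hs => by
      obtain ⟨n, F, -, hF⟩ := h.exists_eq s
      rw [h.val_eq hF, Ne, ordOne_eq_top_iff]
      rintro rfl
      rw [RingHom.map_zero, zero_div] at hF
      exact hs (h.injective (by rw [hF, RingHom.map_zero]))
    unif := hex.choose
    val_unif := hex.choose_spec }

end TorusChart

end TorusChart

/-! ### The ideal sheaf of a closed point. -/

section PointIdeal

variable {Y : Scheme.{u}} {y : Y}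

lemma mem_vanishingIdeal_point_iff (hy : IsClosed ({y} : Set Y)) (U : Y.affineOpens)
    (s : Γ(Y, U)) :
    s ∈ (Scheme.IdealSheafData.vanishingIdeal (TopologicalSpace.Closeds.closure {y})).ideal U ↔
      (y ∈ U.1 → y ∉ Y.basicOpen s) := by
  rw [Scheme.IdealSheafData.vanishingIdeal_ideal, PrimeSpectrum.mem_vanishingIdeal]
  have h1 : ∀ p : Spec Γ(Y, U), U.2.fromSpec p ∈ Y.basicOpen s ↔ s ∉ p.asIdeal := fun p => by
    have h0 : p ∈ U.2.fromSpec ⁻¹ᵁ Y.basicOpen s ↔ p ∈ PrimeSpectrum.basicOpen s :=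
      Eq.to_iff (congrArg (p ∈ ·) (IsAffineOpen.fromSpec_preimage_basicOpen U.2 s))
    exact h0
  have h2 : ∀ p : Spec Γ(Y, U), p ∈ (U.2.fromSpec ⁻¹' (TopologicalSpace.Closeds.closure {y}) :
      Set (Spec Γ(Y, U))) ↔ U.2.fromSpec p = y := fun p => by
    change U.2.fromSpec p ∈ closure {y} ↔ _
    rw [hy.closure_eq, Set.mem_singleton_iff]
  constructor
  · intro h hyU
    rw [← SetLike.mem_coe, ← U.2.range_fromSpec] at hyU
    obtain ⟨p, hp⟩ := hyU
    rw [← hp, h1, not_not]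
    exact h p ((h2 p).2 hp)
  · intro h p hp
    have hp' := (h2 p).1 hp
    by_contra h3
    refine h ?_ ((hp' ▸ (h1 p).2 h3))
    rw [← hp', ← SetLike.mem_coe, ← U.2.range_fromSpec]
    exact ⟨p, rfl⟩

lemma vanishingIdeal_point_eq_top (hy : IsClosed ({y} : Set Y)) (U : Y.affineOpens)
    (hU : y ∉ U.1) :
    (Scheme.IdealSheafData.vanishingIdeal (TopologicalSpace.Closeds.closure {y})).ideal U = ⊤ := by
  rw [Ideal.eq_top_iff_one, mem_vanishingIdeal_point_iff hy]
  exact fun h => absurd h hU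

end PointIdeal

/-! ### The weighted projective plane is integral and Noetherian, and t₀ is closed. -/

section Plane

open MvPolynomial

variable {k : Type u} [Field k] {a b c : ℕ}

lemma X0_mem_wGrading : (X 0 : MvPolynomial (Fin 3) k) ∈ wGrading k a b c a := by
  simpa using monomial_mem_wGrading (k := k) (a := a) (b := b) (c := c) 1 0 0

lemma X1_mem_wGrading : (X 1 : MvPolynomial (Fin 3) k) ∈ wGrading k a b c b := by
  simpa using monomial_mem_wGrading (k := k) (a := a) (b := b) (c := c) 0 1 0

lemma X2_mem_wGrading : (X 2 : MvPolynomial (Fin 3) k) ∈ wGrading k a b c c := by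
  simpa using monomial_mem_wGrading (k := k) (a := a) (b := b) (c := c) 0 0 1

lemma isIntegral_weightedPlane (ha : 0 < a) : IsIntegral (weightedPlane k a b c) :=
  isIntegral_proj (wGrading k a b c) ha X0_mem_wGrading (X_ne_zero 0)

lemma eq_C_of_mem_wGrading_zero (ha : 0 < a) (hb : 0 < b) (hc : 0 < c)
    {F : MvPolynomial (Fin 3) k} (hF : F ∈ wGrading k a b c 0) : F = C (coeff 0 F) := by
  refine MvPolynomial.ext _ _ fun δ => ?_
  rw [coeff_C]
  split_ifs with h
  · rw [h]
  · by_contra h0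
    have h1 := weight_eq_of_mem_support ((mem_weightedHomogeneousSubmodule _ _ _ _).1 hF)
      (mem_support_iff.2 h0)
    refine h (Finsupp.ext fun i => ?_)
    have h2 : δ 0 = 0 ∧ δ 1 = 0 ∧ δ 2 = 0 := by
      refine ⟨?_, ?_, ?_⟩ <;> by_contra h3 <;> have h4 := Nat.pos_of_ne_zero h3
      · have := Nat.mul_pos ha h4; omega
      · have := Nat.mul_pos hb h4; omega
      · have := Nat.mul_pos hc h4; omega
    fin_cases i
    · exact h2.1.symm
    · exact h2.2.1.symm
    · exact h2.2.2.symm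

lemma isNoetherian_weightedPlane (ha : 0 < a) (hb : 0 < b) (hc : 0 < c) :
    IsNoetherian (weightedPlane k a b c) := by
  obtain ⟨h1, h2⟩ := finiteType_projToSpec_of_surjective (wGrading k a b c) (fun F =>
    ⟨coeff 0 F.1, Subtype.ext (eq_C_of_mem_wGrading_zero ha hb hc F.2).symm⟩)
  have h3 : IsLocallyNoetherian (weightedPlane k a b c) :=
    LocallyOfFiniteType.isLocallyNoetherian (projToSpec (wGrading k a b c))
  have h4 : CompactSpace (weightedPlane k a b c) :=
    QuasiCompact.compactSpace_of_compactSpace (projToSpec (wGrading k a b c))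
  exact {}

lemma not_forall_X_mem (y : weightedPlane k a b c) :
    ¬ ∀ i, (X i : MvPolynomial (Fin 3) k) ∈ y.asHomogeneousIdeal := by
  intro h
  refine y.not_irrelevant_le ?_
  refine (HomogeneousIdeal.toIdeal_irrelevant_le (wGrading k a b c)).2 fun n hn p hp => ?_
  change p ∈ y.asHomogeneousIdeal.toIdeal
  rw [p.as_sum]
  refine sum_mem fun δ hδ => ?_
  have hδ0 : δ ≠ 0 := by
    rintro rfl
    have := weight_eq_of_mem_support ((mem_weightedHomogeneousSubmodule _ _ _ _).1 hp) hδ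
    simp at this
    omega
  obtain ⟨i, hi⟩ := Finsupp.ne_iff.1 hδ0
  have h3 : (monomial δ (coeff δ p) : MvPolynomial (Fin 3) k) =
      monomial (δ - Finsupp.single i 1) (coeff δ p) * X i := by
    rw [X, monomial_mul, mul_one, tsub_add_cancel_of_le]
    exact Finsupp.single_le_iff.2 (Nat.one_le_iff_ne_zero.2 hi)
  rw [h3]
  exact Ideal.mul_mem_left _ _ (h i)

lemma mem_of_pow_mem {y : weightedPlane k a b c} {F : MvPolynomial (Fin 3) k} {n : ℕ}
    (h : F ^ n ∈ y.asHomogeneousIdeal) : F ∈ y.asHomogeneousIdeal :=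
  y.isPrime.mem_of_pow_mem n h

lemma mem_t₀_iff (ha : 0 < a) {d : ℕ} {F : MvPolynomial (Fin 3) k} (hF : F ∈ wGrading k a b c d) :
    F ∈ (t₀ k b c ha).asHomogeneousIdeal ↔ eval (fun _ => (1 : k)) F = 0 := by
  refine ⟨fun h => ?_, fun h => ?_⟩
  · exact Ideal.toIdeal_homogeneousCore_le (wGrading k a b c) (idealOne k) h
  · exact Ideal.mem_homogeneousCore_of_homogeneous_of_mem (I := idealOne k) ⟨d, hF⟩ h

/-- For a form F of degree n, F^a - F(1,1,1)^a x^n vanishes at t₀. If x vanished at y, all variables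
would. If some F vanishing at y had F(1,1,1) ≠ 0, then x would vanish at y. -/
lemma eq_t₀_of_le (ha : 0 < a) (hb : 0 < b) (hc : 0 < c) {y : weightedPlane k a b c}
    (h : (t₀ k b c ha).asHomogeneousIdeal ≤ y.asHomogeneousIdeal) : y = t₀ k b c ha := by
  have hpow : ∀ {n : ℕ} {F : MvPolynomial (Fin 3) k}, F ∈ wGrading k a b c n →
      F ^ a - C (eval (fun _ => (1 : k)) F ^ a) * X 0 ^ n ∈ y.asHomogeneousIdeal := by
    intro n F hF
    refine h ((mem_t₀_iff ha (d := n * a) (sub_mem ?_ ?_)).2 ?_)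
    · simpa [mul_comm] using SetLike.pow_mem_graded a hF
    · rw [← smul_eq_C_mul]
      exact Submodule.smul_mem _ _ (by
        simpa using SetLike.pow_mem_graded n (X0_mem_wGrading (k := k) (a := a) (b := b) (c := c)))
    · simp
  have hX0 : (X 0 : MvPolynomial (Fin 3) k) ∉ y.asHomogeneousIdeal := by
    intro h0
    have key : ∀ {n : ℕ} {F : MvPolynomial (Fin 3) k}, 0 < n → F ∈ wGrading k a b c n →
        F ∈ y.asHomogeneousIdeal := by
      intro n F hn hF
      refine mem_of_pow_mem (n := a) ?_
      have h1 := hpow hF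
      have h2 : C (eval (fun _ => (1 : k)) F ^ a) * X 0 ^ n ∈ y.asHomogeneousIdeal :=
        Ideal.mul_mem_left _ _ (Ideal.pow_mem_of_mem _ h0 n hn)
      simpa using add_mem h1 h2
    refine not_forall_X_mem y fun i => ?_
    fin_cases i
    · exact h0
    · exact key hb X1_mem_wGrading
    · exact key hc X2_mem_wGrading
  refine ProjectiveSpectrum.ext (le_antisymm ?_ h)
  intro p hp
  classical
  rw [← DirectSum.sum_support_decompose (wGrading k a b c) p]
  refine sum_mem fun n _ => ?_
  have hF : (DirectSum.decompose (wGrading k a b c) p n : MvPolynomial (Fin 3) k) ∈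
    y.asHomogeneousIdeal := y.asHomogeneousIdeal.isHomogeneous n hp
  refine (mem_t₀_iff ha (SetLike.coe_mem _)).2 ?_
  by_contra h0
  refine hX0 (mem_of_pow_mem (n := n) ?_)
  have h1 := hpow (SetLike.coe_mem (DirectSum.decompose (wGrading k a b c) p n))
  have h2 := sub_mem (Ideal.pow_mem_of_mem _ hF a ha) h1
  rw [sub_sub_cancel] at h2
  have h3 : C (eval (fun _ => (1 : k)) (DirectSum.decompose (wGrading k a b c) p n :
      MvPolynomial (Fin 3) k) ^ a)⁻¹ * _ ∈ y.asHomogeneousIdeal := Ideal.mul_mem_left _ _ h2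
  rwa [← mul_assoc, ← C_mul, inv_mul_cancel₀ (pow_ne_zero _ h0), C_1, one_mul] at h3

lemma isClosed_t₀ (ha : 0 < a) (hb : 0 < b) (hc : 0 < c) :
    IsClosed ({t₀ k b c ha} : Set (weightedPlane k a b c)) := by
  rw [← closure_subset_iff_isClosed]
  intro y hy
  exact eq_t₀_of_le ha hb hc ((specializes_iff_le _ _ _).1 (specializes_iff_mem_closure.2 hy))

end Plane

/-! ### Factors of weighted homogeneous polynomials. -/

section GradingMap

open MvPolynomial

variable {σ R : Type*} [CommRing R] (w : σ → ℕ)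

/-- The homomorphism `F ↦ ∑ₙ Fₙ Tⁿ`, where `Fₙ` is the component of `F` of weighted degree `n`. -/
def gradingMap : MvPolynomial σ R →ₐ[R] Polynomial (MvPolynomial σ R) :=
  aeval fun i => Polynomial.C (X i) * Polynomial.X ^ w i

lemma gradingMap_monomial (δ : σ →₀ ℕ) (r : R) :
    gradingMap w (monomial δ r) = Polynomial.monomial (Finsupp.weight w δ) (monomial δ r) := by
  rw [gradingMap, aeval_monomial, ← Polynomial.C_mul_X_pow_eq_monomial, monomial_eq,
    Polynomial.C_mul, Finsupp.weight_apply, Finsupp.prod, Finsupp.prod, Finsupp.sum, map_prod,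
    ← Finset.prod_pow_eq_pow_sum, mul_assoc, ← Finset.prod_mul_distrib]
  congr 1
  refine Finset.prod_congr rfl fun i _ => ?_
  rw [mul_pow, Polynomial.C_pow, smul_eq_mul, mul_comm (δ i), pow_mul]

lemma coeff_coeff_gradingMap (F : MvPolynomial σ R) (δ : σ →₀ ℕ) (n : ℕ) :
    coeff δ ((gradingMap w F).coeff n) = if Finsupp.weight w δ = n then coeff δ F else 0 := by
  classical
  induction F using MvPolynomial.induction_on' with
  | monomial δ' r =>
    rw [gradingMap_monomial, Polynomial.coeff_monomial]
    by_cases h : δ' = δ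
    · subst h; split_ifs <;> simp
    · simp [coeff_monomial, h, apply_ite (coeff δ)]
  | add p q hp hq =>
    rw [map_add, Polynomial.coeff_add, coeff_add, hp, hq, coeff_add]
    split_ifs <;> simp

lemma isWeightedHomogeneous_iff_gradingMap {F : MvPolynomial σ R} {n : ℕ} :
    F.IsWeightedHomogeneous w n ↔ gradingMap w F = Polynomial.monomial n F := by
  constructor
  · intro h
    refine Polynomial.ext fun m => MvPolynomial.ext _ _ fun δ => ?_
    rw [coeff_coeff_gradingMap, Polynomial.coeff_monomial]
    by_cases h0 : coeff δ F = 0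
    · split_ifs <;> simp [h0]
    · rw [h h0]
      split_ifs <;> simp
  · intro h δ hδ
    by_contra hne
    have h1 := coeff_coeff_gradingMap w F δ (Finsupp.weight w δ)
    rw [h, Polynomial.coeff_monomial, if_neg (Ne.symm hne), if_pos rfl, coeff_zero] at h1
    exact hδ h1.symm

/-- Highest and lowest degree in T are additive on products; they agree for the product, hence for
each factor. -/
lemma exists_isWeightedHomogeneous_of_dvd [IsDomain R] {F G : MvPolynomial σ R} {n : ℕ}
    (hF : F.IsWeightedHomogeneous w n) (hF0 : F ≠ 0) (hGF : G ∣ F) :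
    ∃ m, G.IsWeightedHomogeneous w m := by
  obtain ⟨H, rfl⟩ := hGF
  have hinj : ∀ Q : MvPolynomial σ R, Q ≠ 0 → gradingMap w Q ≠ 0 := by
    intro Q hQ h
    obtain ⟨δ, hδ⟩ := MvPolynomial.ne_zero_iff.1 hQ
    have h1 := coeff_coeff_gradingMap w Q δ (Finsupp.weight w δ)
    rw [h, if_pos rfl, Polynomial.coeff_zero, coeff_zero] at h1
    exact hδ h1.symm
  have hG := hinj _ (left_ne_zero_of_mul hF0)
  have hH := hinj _ (right_ne_zero_of_mul hF0)
  rw [isWeightedHomogeneous_iff_gradingMap, map_mul] at hF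
  have h1 := Polynomial.natDegree_mul hG hH
  have h2 := Polynomial.natTrailingDegree_mul hG hH
  rw [hF, Polynomial.natDegree_monomial_eq _ hF0] at h1
  rw [hF, Polynomial.natTrailingDegree_monomial hF0] at h2
  have h3 := Polynomial.natTrailingDegree_le_natDegree (gradingMap w G)
  have h4 := Polynomial.natTrailingDegree_le_natDegree (gradingMap w H)
  refine ⟨(gradingMap w G).natDegree, fun δ hδ => ?_⟩
  by_contra hne
  have h5 := coeff_coeff_gradingMap w G δ (Finsupp.weight w δ)
  rw [if_pos rfl] at h5
  have h6 : (gradingMap w G).coeff (Finsupp.weight w δ) ≠ 0 := by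
    intro h
    rw [h, coeff_zero] at h5
    exact hδ h5.symm
  have h7 := Polynomial.le_natDegree_of_ne_zero h6
  have h8 := Polynomial.natTrailingDegree_le_of_ne_zero h6
  omega

end GradingMap

/-! ### Codimension-one points of the plane are the homogeneous primes of k[x, y, z]. -/

section PrimePoint

open MvPolynomial

variable {k : Type u} [Field k] {a b c : ℕ}

lemma exists_mem_wGrading_of_dvd {F G : MvPolynomial (Fin 3) k} {n : ℕ}
    (hF : F ∈ wGrading k a b c n) (hF0 : F ≠ 0) (hGF : G ∣ F) : ∃ m, G ∈ wGrading k a b c m :=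
  exists_isWeightedHomogeneous_of_dvd _ hF hF0 hGF

lemma eq_of_mem_wGrading {F : MvPolynomial (Fin 3) k} {n m : ℕ} (hF : F ∈ wGrading k a b c n)
    (hF' : F ∈ wGrading k a b c m) (hF0 : F ≠ 0) : n = m :=
  IsWeightedHomogeneous.inj_right hF0 hF hF'

lemma finiteMultiplicity {p F : MvPolynomial (Fin 3) k} (hp : Prime p) (hF : F ≠ 0) :
    FiniteMultiplicity p F :=
  FiniteMultiplicity.of_prime_left hp hF

lemma multiplicity_mul_of_ne_zero {p F G : MvPolynomial (Fin 3) k} (hp : Prime p) (hF : F ≠ 0)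
    (hG : G ≠ 0) : multiplicity p (F * G) = multiplicity p F + multiplicity p G :=
  multiplicity_mul hp (finiteMultiplicity hp (mul_ne_zero hF hG))

lemma mem_iff_dvd {y : weightedPlane k a b c} {p : MvPolynomial (Fin 3) k}
    (hy : y.asHomogeneousIdeal.toIdeal = Ideal.span {p}) (F : MvPolynomial (Fin 3) k) :
    F ∈ y.asHomogeneousIdeal ↔ p ∣ F := by
  rw [← Ideal.mem_span_singleton, ← hy]; rfl

lemma exists_point_of_prime {p : MvPolynomial (Fin 3) k} {n : ℕ} (hp : Prime p)
    (hpn : p ∈ wGrading k a b c n) (ha : 0 < a) (hb : 0 < b) :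
    ∃ y : weightedPlane k a b c, y.asHomogeneousIdeal.toIdeal = Ideal.span {p} := by
  have hhom : (Ideal.span {p}).IsHomogeneous (wGrading k a b c) :=
    Ideal.homogeneous_span _ _ (by rintro x rfl; exact ⟨n, hpn⟩)
  refine ⟨⟨⟨Ideal.span {p}, hhom⟩, (Ideal.span_singleton_prime hp.ne_zero).2 hp, ?_⟩, rfl⟩
  intro h
  have h0 : p ∣ X 0 := Ideal.mem_span_singleton.1
    (h (HomogeneousIdeal.mem_irrelevant_of_mem (wGrading k a b c) ha X0_mem_wGrading))
  have h1 : p ∣ X 1 := Ideal.mem_span_singleton.1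
    (h (HomogeneousIdeal.mem_irrelevant_of_mem (wGrading k a b c) hb X1_mem_wGrading))
  have h2 : (X 0 : MvPolynomial (Fin 3) k) ∣ X 1 :=
    ((hp.irreducible.associated_of_dvd X_prime.irreducible h0).symm.dvd).trans h1
  rw [X_dvd_X] at h2
  simp at h2

/-- The point contains a nonzero form and hence one of its prime factors p, which is again
homogeneous; codimension one leaves no room between (p) and y. -/
lemma exists_prime_of_coheight_eq_one {y : weightedPlane k a b c} (hy : Order.coheight y = 1)
    (ha : 0 < a) (hb : 0 < b) : ∃ (p : MvPolynomial (Fin 3) k) (n : ℕ), Prime p ∧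
      p ∈ wGrading k a b c n ∧ y.asHomogeneousIdeal.toIdeal = Ideal.span {p} := by
  have hF : ∃ (F : MvPolynomial (Fin 3) k) (n : ℕ), F ∈ wGrading k a b c n ∧ F ≠ 0 ∧
      F ∈ y.asHomogeneousIdeal := by
    by_contra! hcon
    have hbot : y.asHomogeneousIdeal ≤ ⊥ := by
      intro F hF
      classical
      rw [← DirectSum.sum_support_decompose (wGrading k a b c) F]
      refine sum_mem fun n _ => ?_
      by_cases h0 : (DirectSum.decompose (wGrading k a b c) F n : MvPolynomial (Fin 3) k) = 0
      · rw [h0]; exact zero_mem _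
      · exact absurd (y.asHomogeneousIdeal.isHomogeneous n hF) (hcon _ n (SetLike.coe_mem _) h0)
    have h1 : Order.coheight y = 0 := by
      rw [Order.coheight_eq_zero]
      intro z hz
      exact (specializes_iff_le (wGrading k a b c) y z).2 (hbot.trans bot_le)
    rw [h1] at hy
    exact zero_ne_one hy
  obtain ⟨F, n, hFn, hF0, hFy⟩ := hF
  have key : ∃ p ∈ UniqueFactorizationMonoid.factors F, p ∈ y.asHomogeneousIdeal := by
    have h1 : (UniqueFactorizationMonoid.factors F).prod ∈ y.asHomogeneousIdeal := by
      obtain ⟨u, hu⟩ := UniqueFactorizationMonoid.factors_prod hF0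
      rw [← hu] at hFy
      refine (y.isPrime.mem_or_mem hFy).resolve_right fun h => ?_
      exact y.isPrime.ne_top (Ideal.eq_top_of_isUnit_mem _ h u.isUnit)
    exact (y.isPrime.multiset_prod_mem_iff_exists_mem _).1 h1
  obtain ⟨p, hpF, hpy⟩ := key
  have hp := UniqueFactorizationMonoid.prime_of_factor p hpF
  obtain ⟨m, hm⟩ := exists_mem_wGrading_of_dvd hFn hF0
      (UniqueFactorizationMonoid.dvd_of_mem_factors hpF)
  obtain ⟨y', hy'⟩ := exists_point_of_prime hp hm ha hb
  refine ⟨p, m, hp, hm, ?_⟩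
  rw [← eq_of_coheight_eq_one (wGrading k a b c) hy (y := y') ?_
    ((mem_iff_dvd hy' p).2 dvd_rfl) hp.ne_zero, hy']
  intro G hG
  obtain ⟨H, rfl⟩ := (mem_iff_dvd hy' G).1 hG
  exact Ideal.mul_mem_right _ _ hpy

/-- The power of p in G can be cancelled from both terms; the remaining factors are forms of equal
degree with denominator prime to p. -/
lemma mem_range_stalkToFrac_iff {y : weightedPlane k a b c} {p : MvPolynomial (Fin 3) k} {m : ℕ}
    (hp : Prime p) (hpm : p ∈ wGrading k a b c m)
    (hy : y.asHomogeneousIdeal.toIdeal = Ideal.span {p}) {F G : MvPolynomial (Fin 3) k} {n : ℕ}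
    (hF : F ∈ wGrading k a b c n) (hG : G ∈ wGrading k a b c n) (hF0 : F ≠ 0) (hG0 : G ≠ 0) :
    algebraMap _ (FractionRing (MvPolynomial (Fin 3) k)) F / algebraMap _ _ G ∈
      Set.range (stalkToFrac (wGrading k a b c) y) ↔ multiplicity p G ≤ multiplicity p F := by
  have hne : ∀ {H : MvPolynomial (Fin 3) k}, H ≠ 0 →
      algebraMap _ (FractionRing (MvPolynomial (Fin 3) k)) H ≠ 0 := fun h => by
    rwa [Ne, FaithfulSMul.algebraMap_eq_zero_iff]
  constructor
  · rintro ⟨s, hs⟩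
    obtain ⟨i, F', G', hF', hG', hGy, h1⟩ := exists_stalkToFrac_eq (wGrading k a b c) y s
    have hG'0 : G' ≠ 0 := by
      rintro rfl
      exact hGy (zero_mem _)
    rw [hs, div_eq_div_iff (hne hG0) (hne hG'0), ← RingHom.map_mul, ← RingHom.map_mul] at h1
    have h2 := IsFractionRing.injective _ _ h1
    have hF'0 : F' ≠ 0 := by
      rintro rfl
      rw [zero_mul] at h2
      exact mul_ne_zero hF0 hG'0 h2
    have h3 := congrArg (multiplicity p) h2
    rw [multiplicity_mul_of_ne_zero hp hF0 hG'0, multiplicity_mul_of_ne_zero hp hF'0 hG0,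
      multiplicity_eq_zero.2 fun h => hGy ((mem_iff_dvd hy _).2 h)] at h3
    omega
  · intro h
    obtain ⟨G', hG', hpG'⟩ := (finiteMultiplicity hp hG0).exists_eq_pow_mul_and_not_dvd
    obtain ⟨F', hF'⟩ := (pow_dvd_pow p h).trans (pow_multiplicity_dvd p F)
    have hF'0 : F' ≠ 0 := by rintro rfl; exact hF0 (by rw [hF', mul_zero])
    have hG'0 : G' ≠ 0 := by rintro rfl; exact hpG' (dvd_zero p)
    obtain ⟨i, hi⟩ := exists_mem_wGrading_of_dvd hF hF0 ⟨p ^ multiplicity p G, by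
      rw [mul_comm]; exact hF'⟩
    obtain ⟨j, hj⟩ := exists_mem_wGrading_of_dvd hG hG0 ⟨p ^ multiplicity p G, by
      rw [mul_comm]; exact hG'⟩
    have hpow := SetLike.pow_mem_graded (multiplicity p G) hpm
    have h1 := SetLike.mul_mem_graded hpow hi
    have h2 := SetLike.mul_mem_graded hpow hj
    rw [← hF'] at h1
    rw [← hG'] at h2
    have h3 := eq_of_mem_wGrading hF h1 hF0
    have h4 := eq_of_mem_wGrading hG h2 hG0
    obtain rfl : i = j := by omega
    refine ⟨stalkMk (wGrading k a b c) y hi hj fun h => hpG' ((mem_iff_dvd hy _).1 h), ?_⟩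
    rw [stalkToFrac_stalkMk]
    rw [div_eq_div_iff (hne hG'0) (hne hG0), ← RingHom.map_mul, ← RingHom.map_mul]
    refine congrArg _ ?_
    linear_combination F' * hG' - G' * hF'

lemma dvd_total_stalk {y : weightedPlane k a b c} {p : MvPolynomial (Fin 3) k} {m : ℕ}
    (hp : Prime p) (hpm : p ∈ wGrading k a b c m)
    (hy : y.asHomogeneousIdeal.toIdeal = Ideal.span {p})
    (s t : (weightedPlane k a b c).presheaf.stalk y) : s ∣ t ∨ t ∣ s := by
  have hne : ∀ {H : MvPolynomial (Fin 3) k}, H ≠ 0 →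
      algebraMap _ (FractionRing (MvPolynomial (Fin 3) k)) H ≠ 0 := fun h => by
    rwa [Ne, FaithfulSMul.algebraMap_eq_zero_iff]
  obtain ⟨n, F, G, hF, hG, hGy, hs⟩ := exists_stalkToFrac_eq (wGrading k a b c) y s
  obtain ⟨n', F', G', hF', hG', hGy', ht⟩ := exists_stalkToFrac_eq (wGrading k a b c) y t
  have hG0 : G ≠ 0 := by rintro rfl; exact hGy (zero_mem _)
  have hG'0 : G' ≠ 0 := by rintro rfl; exact hGy' (zero_mem _)
  rcases eq_or_ne F 0 with rfl | hF0
  · right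
    have : s = 0 := stalkToFrac_injective (wGrading k a b c) y (by simpa using hs)
    rw [this]; exact dvd_zero t
  rcases eq_or_ne F' 0 with rfl | hF'0
  · left
    have : t = 0 := stalkToFrac_injective (wGrading k a b c) y (by simpa using ht)
    rw [this]; exact dvd_zero s
  have h1 := SetLike.mul_mem_graded hF hG'
  have h2 := SetLike.mul_mem_graded hG hF'
  rcases le_total (multiplicity p (F * G')) (multiplicity p (G * F')) with h | h
  · left
    obtain ⟨r, hr⟩ := (mem_range_stalkToFrac_iff hp hpm hy h2 h1 (mul_ne_zero hG0 hF'0)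
      (mul_ne_zero hF0 hG'0)).2 h
    refine ⟨r, stalkToFrac_injective (wGrading k a b c) y ?_⟩
    rw [RingHom.map_mul, hs, ht, hr, RingHom.map_mul, RingHom.map_mul]
    have := hne hG0; have := hne hG'0; have := hne hF0
    field_simp
  · right
    obtain ⟨r, hr⟩ := (mem_range_stalkToFrac_iff hp hpm hy h1 h2 (mul_ne_zero hF0 hG'0)
      (mul_ne_zero hG0 hF'0)).2 h
    refine ⟨r, stalkToFrac_injective (wGrading k a b c) y ?_⟩
    rw [RingHom.map_mul, hs, ht, hr, RingHom.map_mul, RingHom.map_mul]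
    have := hne hG0; have := hne hG'0; have := hne hF'0
    field_simp

/-- The codimension is the Krull dimension of the stalk, which is a discrete valuation ring:
divisibility is total, and p^n/F^m, with F a form of degree n prime to p, is a nonzero nonunit. -/
lemma coheight_eq_one_of_span {y : weightedPlane k a b c} {p : MvPolynomial (Fin 3) k} {m : ℕ}
    (ha : 0 < a) (hb : 0 < b) (hc : 0 < c) (hp : Prime p) (hpm : p ∈ wGrading k a b c m)
    (hy : y.asHomogeneousIdeal.toIdeal = Ideal.span {p}) : Order.coheight y = 1 := by
  have := isIntegral_weightedPlane (k := k) (b := b) (c := c) ha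
  have := isNoetherian_weightedPlane (k := k) ha hb hc
  have hne : ∀ {H : MvPolynomial (Fin 3) k}, H ≠ 0 →
      algebraMap _ (FractionRing (MvPolynomial (Fin 3) k)) H ≠ 0 := fun h => by
    rwa [Ne, FaithfulSMul.algebraMap_eq_zero_iff]
  obtain ⟨F, n, hn, hF, hFy⟩ : ∃ (F : MvPolynomial (Fin 3) k) (n : ℕ), 0 < n ∧
      F ∈ wGrading k a b c n ∧ ¬ p ∣ F := by
    by_contra! h
    refine not_forall_X_mem y fun i => (mem_iff_dvd hy _).2 ?_
    fin_cases i
    · exact h _ a ha X0_mem_wGrading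
    · exact h _ b hb X1_mem_wGrading
    · exact h _ c hc X2_mem_wGrading
  have hF0 : F ≠ 0 := by rintro rfl; exact hFy (dvd_zero p)
  have h1 : p ^ n ∈ wGrading k a b c (n * m) := by simpa using SetLike.pow_mem_graded n hpm
  have h2 : F ^ m ∈ wGrading k a b c (n * m) := by
    simpa [mul_comm] using SetLike.pow_mem_graded m hF
  have h3 : F ^ m ∉ y.asHomogeneousIdeal := fun h =>
    hFy (hp.dvd_of_dvd_pow ((mem_iff_dvd hy _).1 h))
  have h4 := isDiscreteValuationRing_of_dvd_total (dvd_total_stalk hp hpm hy)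
    (r := stalkMk (wGrading k a b c) y h1 h2 h3) (fun h => ?_) (fun h => ?_)
  · have h5 := IsPrincipalIdealRing.ringKrullDim_eq_one ((weightedPlane k a b c).presheaf.stalk y)
      (IsDiscreteValuationRing.not_isField _)
    rw [ringKrullDim_stalk_eq_coheight] at h5
    exact_mod_cast h5
  · have h5 := congrArg (stalkToFrac (wGrading k a b c) y) h
    rw [stalkToFrac_stalkMk, RingHom.map_zero] at h5
    exact div_ne_zero (hne (pow_ne_zero _ hp.ne_zero)) (hne (pow_ne_zero _ hF0)) h5
  · obtain ⟨s, hs⟩ := h.exists_right_inv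
    have h5 := congrArg (stalkToFrac (wGrading k a b c) y) hs
    rw [RingHom.map_mul, stalkToFrac_stalkMk, RingHom.map_one, mul_comm, ← eq_div_iff ?_,
      one_div_div] at h5
    · have h6 := (mem_range_stalkToFrac_iff hp hpm hy h2 h1 (pow_ne_zero _ hF0)
        (pow_ne_zero _ hp.ne_zero)).1 ⟨s, h5⟩
      rw [multiplicity_pow_self hp.ne_zero hp.not_isUnit, multiplicity_eq_zero.2 fun h =>
        hFy (hp.dvd_of_dvd_pow h)] at h6
      omega
    · exact div_ne_zero (hne (pow_ne_zero _ hp.ne_zero)) (hne (pow_ne_zero _ hF0))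

/-- Otherwise p would divide x^b - y^a, x^c - z^a and y^c - z^b. Each lacks one variable, so p would
be constant. -/
lemma span_ne_t₀ {p : MvPolynomial (Fin 3) k} (ha : 0 < a) (hb : 0 < b) (hc : 0 < c) (hp : Prime p)
    (h : (t₀ k b c ha).asHomogeneousIdeal.toIdeal = Ideal.span {p}) : False := by
  have hdeg : ∀ {i j l : Fin 3} {n n' : ℕ}, i ≠ l → j ≠ l → i ≠ j → 0 < n →
      p ∣ (X i ^ n - X j ^ n' : MvPolynomial (Fin 3) k) → p.degreeOf l = 0 := by
    rintro i j l n n' hil hjl hij hn ⟨q, hq⟩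
    have h0 : (X i ^ n - X j ^ n' : MvPolynomial (Fin 3) k) ≠ 0 := by
      intro h0
      have h1 := congrArg (eval (Function.update (fun _ => (1 : k)) i 0)) h0
      rw [map_sub, map_pow, map_pow, eval_X, eval_X, Function.update_self,
        Function.update_of_ne (Ne.symm hij), zero_pow hn.ne'] at h1
      simp at h1
    have h1 : degreeOf l (X i ^ n - X j ^ n' : MvPolynomial (Fin 3) k) = 0 := by
      refine Nat.le_zero.1 ((degreeOf_sub_le _ _ _).trans (max_le ?_ ?_))
      · refine (degreeOf_pow_le _ _ _).trans ?_
        rw [degreeOf_X_of_ne hil.symm, mul_zero]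
      · refine (degreeOf_pow_le _ _ _).trans ?_
        rw [degreeOf_X_of_ne hjl.symm, mul_zero]
    rw [hq] at h0 h1
    rw [degreeOf_mul_eq (left_ne_zero_of_mul h0) (right_ne_zero_of_mul h0)] at h1
    omega
  have hmem : ∀ {F : MvPolynomial (Fin 3) k} {d : ℕ}, F ∈ wGrading k a b c d →
      eval (fun _ => (1 : k)) F = 0 → p ∣ F := fun hF h0 =>
    (mem_iff_dvd h _).1 ((mem_t₀_iff ha hF).2 h0)
  have hX0 : ∀ n, (X 0 : MvPolynomial (Fin 3) k) ^ n ∈ wGrading k a b c (n * a) := fun n => by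
    simpa using SetLike.pow_mem_graded n X0_mem_wGrading
  have hX1 : ∀ n, (X 1 : MvPolynomial (Fin 3) k) ^ n ∈ wGrading k a b c (n * b) := fun n => by
    simpa using SetLike.pow_mem_graded n X1_mem_wGrading
  have hX2 : ∀ n, (X 2 : MvPolynomial (Fin 3) k) ^ n ∈ wGrading k a b c (n * c) := fun n => by
    simpa using SetLike.pow_mem_graded n X2_mem_wGrading
  have h2 := hdeg (i := 0) (j := 1) (l := 2) (by decide) (by decide) (by decide) hb
    (hmem (sub_mem (hX0 b) (by rw [mul_comm]; exact hX1 a)) (by simp))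
  have h1 := hdeg (i := 0) (j := 2) (l := 1) (by decide) (by decide) (by decide) hc
    (hmem (sub_mem (hX0 c) (by rw [mul_comm]; exact hX2 a)) (by simp))
  have h0 := hdeg (i := 1) (j := 2) (l := 0) (by decide) (by decide) (by decide) hc
    (hmem (sub_mem (hX1 c) (by rw [mul_comm]; exact hX2 b)) (by simp))
  refine hp.not_isUnit ?_
  have h3 : p = C (coeff 0 p) := by
    rw [← totalDegree_eq_zero_iff_eq_C, totalDegree_eq_zero_iff]
    intro δ hδ i
    have h4 := monomial_le_degreeOf i hδ
    fin_cases i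
    · exact Nat.le_zero.1 (h4.trans h0.le)
    · exact Nat.le_zero.1 (h4.trans h1.le)
    · exact Nat.le_zero.1 (h4.trans h2.le)
  rw [h3]
  refine (IsUnit.mk0 _ fun h0 => hp.ne_zero ?_).map C
  rw [h3, h0, C_0]

end PrimePoint

/-! ### The function field of a birational model inside Frac A. -/

section FracMap

variable {A : Type u} [CommRing A] [IsDomain A] {R : Type u} [CommRing R] [Algebra R A]
  (𝒜 : ℕ → Submodule R A) [GradedAlgebra 𝒜] {X : Scheme.{u}} [IsIntegral X] (π : X ⟶ Proj 𝒜)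
  [IsIso (π.stalkMap (genericPoint X))]

/-- The embedding of the function field of a scheme that is birational to the projective spectrum of
a graded domain into the field of fractions of this domain. -/
def fracMap : X.functionField →+* FractionRing A :=
  (stalkToFrac 𝒜 (π (genericPoint X))).comp (inv (π.stalkMap (genericPoint X))).hom

lemma fracMap_injective : Function.Injective (fracMap 𝒜 π) := RingHom.injective _

lemma fracMap_stalkMap (s : (Proj 𝒜).presheaf.stalk (π (genericPoint X))) :
    fracMap 𝒜 π (π.stalkMap (genericPoint X) s) = stalkToFrac 𝒜 _ s := by
  refine congrArg (stalkToFrac 𝒜 _) ?_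
  exact congr($(IsIso.hom_inv_id (π.stalkMap (genericPoint X))).hom s)

lemma fracMap_algebraMap_stalkMap (z : X) (s : (Proj 𝒜).presheaf.stalk (π z)) :
    fracMap 𝒜 π (algebraMap (X.presheaf.stalk z) X.functionField (π.stalkMap z s)) =
      stalkToFrac 𝒜 (π z) s := by
  have hz : genericPoint X ⤳ z := (genericPoint_spec X).specializes trivial
  have h1 : algebraMap (X.presheaf.stalk z) X.functionField (π.stalkMap z s) =
      π.stalkMap (genericPoint X) ((Proj 𝒜).presheaf.stalkSpecializes
        (π.base.hom.map_specializes hz) s) :=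
    (Scheme.Hom.stalkSpecializes_stalkMap_apply π _ _ hz s).symm
  rw [h1, fracMap_stalkMap, stalkToFrac_germ]

lemma exists_fracMap_eq (u : X.functionField) : ∃ (n : ℕ) (F G : A), F ∈ 𝒜 n ∧ G ∈ 𝒜 n ∧ G ≠ 0 ∧
    fracMap 𝒜 π u = algebraMap A (FractionRing A) F / algebraMap A (FractionRing A) G := by
  obtain ⟨n, F, G, hF, hG, hG0, h⟩ := exists_stalkToFrac_eq 𝒜 _
    ((inv (π.stalkMap (genericPoint X))).hom u)
  exact ⟨n, F, G, hF, hG, fun h0 => hG0 (by rw [h0]; exact zero_mem _), h⟩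

lemma asHomogeneousIdeal_genericPoint {n : ℕ} (hn : 0 < n) {f : A} (hf : f ∈ 𝒜 n) (hf0 : f ≠ 0)
    {y : Proj 𝒜} (hgen : ∀ y', y ⤳ y') : y.asHomogeneousIdeal = ⊥ :=
  le_bot_iff.1 ((specializes_iff_le 𝒜 _ _).1 (hgen (projBot 𝒜 hn hf hf0)))

lemma exists_fracMap_preimage (hgen : (π (genericPoint X)).asHomogeneousIdeal = ⊥) {n : ℕ} {F G : A}
    (hF : F ∈ 𝒜 n) (hG : G ∈ 𝒜 n) (hG0 : G ≠ 0) :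
    ∃ u, fracMap 𝒜 π u = algebraMap A (FractionRing A) F / algebraMap A (FractionRing A) G := by
  have hG' : G ∉ (π (genericPoint X)).asHomogeneousIdeal := by
    intro h
    rw [hgen, ← HomogeneousIdeal.mem_iff, HomogeneousIdeal.toIdeal_bot] at h
    exact hG0 (by simpa using h)
  exact ⟨π.stalkMap (genericPoint X) (stalkMk 𝒜 _ hF hG hG'), by
    rw [fracMap_stalkMap, stalkToFrac_stalkMk]⟩

lemma mem_range_algebraMap_iff (z : X) [IsIso (π.stalkMap z)] (f : X.functionField) :
    f ∈ Set.range (algebraMap (X.presheaf.stalk z) X.functionField) ↔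
      fracMap 𝒜 π f ∈ Set.range (stalkToFrac 𝒜 (π z)) := by
  constructor
  · rintro ⟨s, rfl⟩
    refine ⟨(inv (π.stalkMap z)).hom s, ?_⟩
    rw [← fracMap_algebraMap_stalkMap]
    congr 2
    exact congr($(IsIso.inv_hom_id (π.stalkMap z)).hom s)
  · rintro ⟨s, hs⟩
    exact ⟨π.stalkMap z s, fracMap_injective 𝒜 π (by rw [fracMap_algebraMap_stalkMap, hs])⟩

lemma coheight_eq_of_isIso_stalkMap {X Y : Scheme.{u}} (π : X ⟶ Y) (z : X) [IsIso (π.stalkMap z)] :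
    Order.coheight z = Order.coheight (π z) := by
  have h := ringKrullDim_eq_of_ringEquiv (asIso (π.stalkMap z)).commRingCatIsoToRingEquiv
  rw [ringKrullDim_stalk_eq_coheight, ringKrullDim_stalk_eq_coheight] at h
  exact_mod_cast h.symm

end FracMap

/-! ### Functions on the base read in a chart of the blowup. -/

section ChartStalk

variable {X Y : Scheme.{u}} {π : X ⟶ Y}

lemma stalkMap_chart {U : Y.Opens} (hU : IsAffineOpen U) {Z : Scheme.{u}} (ψ : Z ⟶ X)
    (p : Z ⟶ Spec Γ(Y, U)) (h : ψ ≫ π = p ≫ hU.fromSpec) (y : Z) (hz : π (ψ y) ∈ U)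
    (s : Γ(Y, U)) :
    ψ.stalkMap y (π.stalkMap (ψ y) (Y.presheaf.germ U _ hz s)) =
      Z.presheaf.germ ⊤ y trivial (p.appTop ((Scheme.ΓSpecIso Γ(Y, U)).inv s)) := by
  have hz2 : hU.fromSpec (p y) ∈ U := by
    have : (p ≫ hU.fromSpec) y = (ψ ≫ π) y := by rw [h]
    exact this ▸ hz
  have h0 : ψ.stalkMap y (π.stalkMap (ψ y) (Y.presheaf.germ U _ hz s)) =
      Z.presheaf.germ ((ψ ≫ π) ⁻¹ᵁ U) y hz ((ψ ≫ π).app U s) := by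
    refine (congrArg _ (Scheme.Hom.germ_stalkMap_apply π U (ψ y) hz s)).trans ?_
    refine (Scheme.Hom.germ_stalkMap_apply ψ (π ⁻¹ᵁ U) y hz _).trans ?_
    rw [Scheme.Hom.comp_app]; rfl
  have h1 : ∀ (q : Z ⟶ Y) (hq : ψ ≫ π = q) (hyq : q y ∈ U),
      Z.presheaf.germ ((ψ ≫ π) ⁻¹ᵁ U) y hz ((ψ ≫ π).app U s) =
        Z.presheaf.germ (q ⁻¹ᵁ U) y hyq (q.app U s) := by
    rintro q rfl _; rfl
  have h2 : Z.presheaf.germ ((p ≫ hU.fromSpec) ⁻¹ᵁ U) y hz2 ((p ≫ hU.fromSpec).app U s) =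
      p.stalkMap y ((Spec Γ(Y, U)).presheaf.germ (hU.fromSpec ⁻¹ᵁ U) (p y) hz2
        (hU.fromSpec.app U s)) := by
    refine Eq.trans ?_ (Scheme.Hom.germ_stalkMap_apply p (hU.fromSpec ⁻¹ᵁ U) y hz2 _).symm
    rw [Scheme.Hom.comp_app]; rfl
  have h3 : (Spec Γ(Y, U)).presheaf.germ (hU.fromSpec ⁻¹ᵁ U) (p y) hz2 (hU.fromSpec.app U s) =
      (Spec Γ(Y, U)).presheaf.germ ⊤ (p y) trivial ((Scheme.ΓSpecIso Γ(Y, U)).inv s) := by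
    rw [IsAffineOpen.fromSpec_app_self]
    exact TopCat.Presheaf.germ_res_apply _ (eqToHom hU.fromSpec_preimage_self) _ _ _
  rw [h0, h1 _ h hz2, h2, h3]
  exact Scheme.Hom.germ_stalkMap_apply p ⊤ y trivial _

end ChartStalk

/-! ### Units and codimension at points of Proj of the Rees algebra. -/

section ReesStalk

variable {A : Type u} [CommRing A] [IsDomain A] {I : Ideal A}

lemma algebraMap_rees_ne_zero {s : A} (hs : s ≠ 0) :
    algebraMap _ (FractionRing (reesAlgebra I)) (algebraMap A (reesAlgebra I) s) ≠ 0 := by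
  rwa [Ne, FaithfulSMul.algebraMap_eq_zero_iff, algebraMap_eq_reesMonomial,
    reesMonomial_eq_zero_iff]

lemma isUnit_iff_notMem_of_stalkToFrac_eq {y : affineBlowup I} {s : A}
    {t : (affineBlowup I).presheaf.stalk y} (ht : stalkToFrac (reesGrading I) y t =
      algebraMap _ (FractionRing (reesAlgebra I)) (algebraMap A (reesAlgebra I) s)) :
    IsUnit t ↔ algebraMap A (reesAlgebra I) s ∉ y.asHomogeneousIdeal := by
  have hs : algebraMap A (reesAlgebra I) s ∈ reesGrading I 0 := by
    rw [algebraMap_eq_reesMonomial]; exact reesMonomial_mem _ _ _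
  have h1 : (1 : reesAlgebra I) ∈ reesGrading I 0 := SetLike.one_mem_graded _
  constructor
  · intro h hmem
    obtain ⟨r, hr⟩ := h.exists_right_inv
    have h3 := congrArg (stalkToFrac (reesGrading I) y) hr
    rw [RingHom.map_mul, RingHom.map_one] at h3
    obtain ⟨n, F, G, hF, hG, hGy, h4⟩ := exists_stalkToFrac_eq (reesGrading I) y r
    have hG0 : algebraMap _ (FractionRing (reesAlgebra I)) G ≠ 0 := by
      rw [Ne, FaithfulSMul.algebraMap_eq_zero_iff]
      rintro rfl
      exact hGy (zero_mem _)
    rw [h4, ht, ← mul_div_assoc, div_eq_one_iff_eq hG0, ← RingHom.map_mul] at h3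
    have h7 := IsFractionRing.injective _ _ h3
    rw [← h7] at hGy
    exact hGy (Ideal.mul_mem_right _ _ hmem)
  · intro h
    refine IsUnit.of_mul_eq_one (stalkMk (reesGrading I) y h1 hs h)
      (stalkToFrac_injective (reesGrading I) y ?_)
    rw [RingHom.map_mul, stalkToFrac_stalkMk, ht, RingHom.map_one, RingHom.map_one,
      mul_one_div_cancel]
    refine algebraMap_rees_ne_zero fun h0 => ?_
    rw [h0, RingHom.map_zero] at h
    exact h (zero_mem _)

namespace AdicValuation

variable (V : AdicValuation I)

lemma ne_zero_of_stalkToFrac_eq {n : ℕ} {w : A} (hw : V.val w = n)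
    {t : (affineBlowup I).presheaf.stalk V.exceptionalPoint}
    (ht : stalkToFrac (reesGrading I) _ t =
      algebraMap _ (FractionRing (reesAlgebra I)) (algebraMap A (reesAlgebra I) w)) : t ≠ 0 := by
  rintro rfl
  rw [RingHom.map_zero] at ht
  exact algebraMap_rees_ne_zero (V.ne_zero_of_val_eq hw) ht.symm

lemma germMk_mul_of_stalkToFrac_eq {n : ℕ} {w w' : A} (hw : w ∈ I ^ n) (hw' : V.val w' = n)
    {t t' : (affineBlowup I).presheaf.stalk V.exceptionalPoint}
    (ht : stalkToFrac (reesGrading I) _ t =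
      algebraMap _ (FractionRing (reesAlgebra I)) (algebraMap A (reesAlgebra I) w))
    (ht' : stalkToFrac (reesGrading I) _ t' =
      algebraMap _ (FractionRing (reesAlgebra I)) (algebraMap A (reesAlgebra I) w')) :
    V.germMk hw hw' * t' = t := by
  refine stalkToFrac_injective (reesGrading I) _ ?_
  rw [RingHom.map_mul, stalkToFrac_germMk, ht, ht',
    div_mul_cancel₀ _ (algebraMap_rees_ne_zero (V.ne_zero_of_val_eq hw'))]

lemma coheight_exceptionalPoint [IsNoetherianRing A] : Order.coheight V.exceptionalPoint = 1 := by
  obtain ⟨h1, h2⟩ := finiteType_projToSpec I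
  have h3 : IsLocallyNoetherian (affineBlowup I) :=
    LocallyOfFiniteType.isLocallyNoetherian (projToSpec (reesGrading I))
  have h4 : IsIntegral (affineBlowup I) := isIntegral_proj (reesGrading I) one_pos
    (reesMonomial_mem 1 V.unif V.unif_mem)
    (by rw [Ne, reesMonomial_eq_zero_iff]; exact V.unif_ne_zero)
  have h5 : IsDiscreteValuationRing ((affineBlowup I).presheaf.stalk V.exceptionalPoint) := by
    refine isDiscreteValuationRing_of_dvd_total V.dvd_total (r := V.germOf V.unif) ?_
      V.not_isUnit_germOf_unif
    refine V.ne_zero_of_stalkToFrac_eq (n := 1) (w := V.unif) (by rw [V.val_unif]; rfl) ?_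
    rw [AdicValuation.germOf, stalkToFrac_germMk, RingHom.map_one, RingHom.map_one, div_one]
  have h6 := IsPrincipalIdealRing.ringKrullDim_eq_one
    ((affineBlowup I).presheaf.stalk V.exceptionalPoint) (IsDiscreteValuationRing.not_isField _)
  rw [ringKrullDim_stalk_eq_coheight] at h6
  exact_mod_cast h6

end AdicValuation

end ReesStalk

/-! ### The exceptional point as a point of the blowup. -/

section ExceptionalChart

variable {X Y : Scheme.{u}} [IsIntegral Y] {π : X ⟶ Y} {U : Y.affineOpens} [Nonempty U.1]
  {I : Ideal Γ(Y, U)} {ψ : affineBlowup I ⟶ X}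

lemma stalkToFrac_chart (hψ : ψ ≫ π = projToSpec (reesGrading I) ≫ U.2.fromSpec)
    (y : affineBlowup I) (hz : π (ψ y) ∈ U.1) (s : Γ(Y, U)) :
    stalkToFrac (reesGrading I) y (ψ.stalkMap y (π.stalkMap (ψ y) (Y.presheaf.germ U.1 _ hz s))) =
      algebraMap _ (FractionRing (reesAlgebra I)) (algebraMap _ (reesAlgebra I) s) := by
  rw [← stalkToFrac_projToSpec (reesGrading I)]
  exact congrArg _ (stalkMap_chart U.2 ψ _ hψ y hz s)

lemma mem_basicOpen_iff_notMem (hψ : ψ ≫ π = projToSpec (reesGrading I) ≫ U.2.fromSpec)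
    (y : affineBlowup I) (hz : π (ψ y) ∈ U.1) (s : Γ(Y, U)) :
    π (ψ y) ∈ Y.basicOpen s ↔ algebraMap _ (reesAlgebra I) s ∉ y.asHomogeneousIdeal := by
  rw [Scheme.mem_basicOpen (hx := hz), ← isUnit_iff_notMem_of_stalkToFrac_eq
    (stalkToFrac_chart hψ y hz s)]
  refine ⟨fun h => (h.map (π.stalkMap (ψ y)).hom).map (ψ.stalkMap y).hom, fun h => ?_⟩
  exact isUnit_of_map_unit (π.stalkMap (ψ y)).hom _ (isUnit_of_map_unit (ψ.stalkMap y).hom _ h)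

lemma eq_chart_exceptionalPoint [IsOpenImmersion ψ]
    (hψ : ψ ≫ π = projToSpec (reesGrading I) ≫ U.2.fromSpec)
    (V : AdicValuation I) {z : X} (hz : Order.coheight z = 1)
    (hzψ : z ∈ ψ.opensRange) (hzU : π z ∈ U.1) (h : ∀ s ∈ I, π z ∉ Y.basicOpen s) :
    z = ψ V.exceptionalPoint := by
  obtain ⟨y, rfl⟩ := hzψ
  rw [coheight_eq_of_isIso_stalkMap ψ y |>.symm] at hz
  refine congrArg ψ (V.eq_exceptionalPoint hz fun s hs => ?_)
  by_contra hcon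
  exact h s hs ((mem_basicOpen_iff_notMem hψ y hzU s).2 hcon)

lemma chart_exceptionalPoint_notMem_basicOpen
    (hψ : ψ ≫ π = projToSpec (reesGrading I) ≫ U.2.fromSpec) (V : AdicValuation I)
    (hz : π (ψ V.exceptionalPoint) ∈ U.1) {s : Γ(Y, U)} (hs : s ∈ I) :
    π (ψ V.exceptionalPoint) ∉ Y.basicOpen s := by
  rw [mem_basicOpen_iff_notMem hψ _ hz, not_not, algebraMap_eq_reesMonomial]
  exact (reesMonomial_mem_exceptionalIdeal _).2 (by simpa using hs)

lemma coheight_chart_exceptionalPoint [IsOpenImmersion ψ] [IsNoetherian Y] (V : AdicValuation I) :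
    Order.coheight (ψ V.exceptionalPoint) = 1 := by
  have : IsNoetherianRing Γ(Y, U.1) := IsLocallyNoetherian.component_noetherian U
  rw [← coheight_eq_of_isIso_stalkMap ψ]
  exact V.coheight_exceptionalPoint

end ExceptionalChart

/-! ### The local ring along the exceptional divisor. -/

section ExceptionalRange

variable {B : Type u} [CommRing B] [IsDomain B] {R : Type u} [CommRing R] [Algebra R B]
  (ℬ : ℕ → Submodule R B) [GradedAlgebra ℬ] [IsIntegral (Proj ℬ)] {X : Scheme.{u}} [IsIntegral X]
  (π : X ⟶ Proj ℬ) [IsIso (π.stalkMap (genericPoint X))]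
  {U : (Proj ℬ).affineOpens} [Nonempty U.1] {I : Ideal Γ(Proj ℬ, U)} {ψ : affineBlowup I ⟶ X}
  [IsOpenImmersion ψ]

/-- Germs there are the quotients w/w' with w ∈ Iⁿ and w' of value n. The condition is stated as a
product because the Rees algebra and B have different fields of fractions; both sides are compared
through the injective maps out of the stalks. -/
lemma mem_range_chart_exceptionalPoint
    (hψ : ψ ≫ π = projToSpec (reesGrading I) ≫ U.2.fromSpec) (V : AdicValuation I)
    (hz : π (ψ V.exceptionalPoint) ∈ U.1) (f : X.functionField) :
    f ∈ Set.range (algebraMap (X.presheaf.stalk (ψ V.exceptionalPoint)) X.functionField) ↔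
      ∃ (n : ℕ) (w w' : Γ(Proj ℬ, U)), w ∈ I ^ n ∧ V.val w' = n ∧
        fracMap ℬ π f * stalkToFrac ℬ _ ((Proj ℬ).presheaf.germ U.1 _ hz w') =
          stalkToFrac ℬ _ ((Proj ℬ).presheaf.germ U.1 _ hz w) := by
  have key : ∀ w : Γ(Proj ℬ, U), stalkToFrac ℬ _ ((Proj ℬ).presheaf.germ U.1 _ hz w) =
      fracMap ℬ π (algebraMap (X.presheaf.stalk (ψ V.exceptionalPoint)) X.functionField
        (π.stalkMap _ ((Proj ℬ).presheaf.germ U.1 _ hz w))) := fun w =>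
    (fracMap_algebraMap_stalkMap ℬ π _ _).symm
  have hinj : Function.Injective (ψ.stalkMap V.exceptionalPoint) :=
    (asIso (ψ.stalkMap V.exceptionalPoint)).commRingCatIsoToRingEquiv.injective
  have key2 : ∀ w : Γ(Proj ℬ, U), stalkToFrac (reesGrading I) V.exceptionalPoint
      (ψ.stalkMap _ (π.stalkMap _ ((Proj ℬ).presheaf.germ U.1 _ hz w))) =
      algebraMap _ (FractionRing (reesAlgebra I)) (algebraMap _ (reesAlgebra I) w) := fun w =>
    stalkToFrac_chart hψ _ hz w
  have key3 : ∀ {n : ℕ} {w w' : Γ(Proj ℬ, U)} (hw : w ∈ I ^ n) (hw' : V.val w' = n)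
      (s : X.presheaf.stalk (ψ V.exceptionalPoint)), ψ.stalkMap _ s = V.germMk hw hw' →
      s * π.stalkMap _ ((Proj ℬ).presheaf.germ U.1 _ hz w') =
        π.stalkMap _ ((Proj ℬ).presheaf.germ U.1 _ hz w) := by
    intro n w w' hw hw' s hs
    refine hinj (Eq.trans ?_ (V.germMk_mul_of_stalkToFrac_eq hw hw' (key2 w) (key2 w')))
    rw [← hs]
    exact RingHom.map_mul (ψ.stalkMap _).hom _ _
  constructor
  · rintro ⟨s, rfl⟩
    obtain ⟨n, w, w', hw, hw', hs⟩ := V.exists_germMk_eq (ψ.stalkMap _ s)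
    refine ⟨n, w, w', hw, hw', ?_⟩
    rw [key, key, ← RingHom.map_mul, ← RingHom.map_mul]
    exact congrArg _ (congrArg _ (key3 hw hw' s hs))
  · rintro ⟨n, w, w', hw, hw', h⟩
    obtain ⟨s, hs⟩ := (asIso (ψ.stalkMap V.exceptionalPoint)).commRingCatIsoToRingEquiv.surjective
      (V.germMk hw hw')
    refine ⟨s, fracMap_injective ℬ π ?_⟩
    have h2 := congrArg (fun t => fracMap ℬ π
      (algebraMap (X.presheaf.stalk (ψ V.exceptionalPoint)) X.functionField t)) (key3 hw hw' s hs)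
    dsimp only at h2
    rw [RingHom.map_mul, RingHom.map_mul, ← key, ← key, ← h] at h2
    refine mul_right_cancel₀ ?_ h2
    intro h0
    rw [key, map_eq_zero_iff _ (fracMap_injective ℬ π),
      map_eq_zero_iff _ (IsFractionRing.injective _ _)] at h0
    refine V.ne_zero_of_stalkToFrac_eq hw' (key2 w') ?_
    exact (congrArg (ψ.stalkMap _).hom h0).trans (RingHom.map_zero _)

end ExceptionalRange

/-! ### The torus as an affine open neighbourhood of t₀. -/

section TorusOpen

open MvPolynomial

variable (k : Type u) [Field k] (b c : ℕ) {a : ℕ}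

/-- The torus `D₊(xyz)` of the weighted projective plane. -/
def torusOpen (ha : 0 < a) : (weightedPlane k a b c).affineOpens :=
  ⟨Proj.basicOpen (wGrading k a b c) (X 0 * X 1 * X 2),
    Proj.isAffineOpen_basicOpen _ _ torusEq_mem (by omega)⟩

lemma t₀_mem_torusOpen (ha : 0 < a) : t₀ k b c ha ∈ (torusOpen k b c ha).1 := by
  refine (Proj.mem_basicOpen _ _ _).2 fun h => ?_
  have := (mem_t₀_iff ha torusEq_mem).1 h
  simp at this

/-- The ideal sheaf of the identity of the torus. -/
abbrev pointIdeal (ha : 0 < a) : (weightedPlane k a b c).IdealSheafData :=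
  Scheme.IdealSheafData.vanishingIdeal (TopologicalSpace.Closeds.closure {t₀ k b c ha})

/-- The embedding of the ring of regular functions on the torus into the field of fractions of
`k[x, y, z]`. -/
def torusMap (ha : 0 < a) :
    Γ(weightedPlane k a b c, torusOpen k b c ha) →+* FractionRing (MvPolynomial (Fin 3) k) :=
  (stalkToFrac (wGrading k a b c) (t₀ k b c ha)).comp
    ((weightedPlane k a b c).presheaf.germ (torusOpen k b c ha).1 _ (t₀_mem_torusOpen k b c ha)).hom

variable {k b c}

lemma torusChart (ha : 0 < a) (hb : 0 < b) (hc : 0 < c) :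
    TorusChart a b c (torusMap k b c ha) ((pointIdeal k b c ha).ideal (torusOpen k b c ha)) where
  injective := by
    have := isIntegral_weightedPlane (k := k) (b := b) (c := c) ha
    exact (stalkToFrac_injective (wGrading k a b c) _).comp
      (germ_injective_of_isIntegral _ _ _)
  exists_preimage := by
    intro n F hF
    obtain ⟨s, hs⟩ := exists_section_basicOpen (wGrading k a b c) torusEq_mem hF
    exact ⟨s, hs _ (t₀_mem_torusOpen k b c ha)⟩
  exists_eq := by
    intro s
    obtain ⟨n, F, hF, hs⟩ := exists_stalkToFrac_germ_eq (wGrading k a b c) torusEq_mem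
      (by omega) s
    exact ⟨n, F, hF, hs _ (t₀_mem_torusOpen k b c ha)⟩
  mem_ideal_iff := by
    intro s n F hF hs
    have hx : (X 0 * X 1 * X 2 : MvPolynomial (Fin 3) k) ^ n ∈
        wGrading k a b c (n • (a + b + c)) := SetLike.pow_mem_graded n torusEq_mem
    have hx0 : ∀ m, algebraMap (MvPolynomial (Fin 3) k) (FractionRing (MvPolynomial (Fin 3) k))
        (X 0 * X 1 * X 2) ^ m ≠ 0 := fun m => pow_ne_zero _ (TorusChart.torusEq_ne_zero k)
    rw [mem_vanishingIdeal_point_iff (isClosed_t₀ ha hb hc), ← mem_t₀_iff ha hF]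
    have hbo := Scheme.mem_basicOpen (weightedPlane k a b c) s (t₀ k b c ha)
      (t₀_mem_torusOpen k b c ha)
    rw [forall_prop_of_true (t₀_mem_torusOpen k b c ha), hbo, not_iff_comm]
    constructor
    · intro hF0
      have hne : algebraMap _ (FractionRing (MvPolynomial (Fin 3) k)) F ≠ 0 := by
        rw [Ne, FaithfulSMul.algebraMap_eq_zero_iff]
        rintro rfl
        exact hF0 (zero_mem _)
      refine IsUnit.of_mul_eq_one (stalkMk (wGrading k a b c) _ hx hF hF0)
        (stalkToFrac_injective (wGrading k a b c) _ ?_)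
      rw [RingHom.map_mul, stalkToFrac_stalkMk, RingHom.map_one, RingHom.map_pow]
      refine Eq.trans (congrArg (· * _) hs) ?_
      rw [div_mul_div_comm, mul_comm, div_self (mul_ne_zero (hx0 n) hne)]
    · intro hu hF0
      obtain ⟨r, hr⟩ := hu.exists_right_inv
      have h3 := congrArg (stalkToFrac (wGrading k a b c) _) hr
      rw [RingHom.map_mul, RingHom.map_one] at h3
      obtain ⟨m, F', G, hF', hG, hGy, h4⟩ := exists_stalkToFrac_eq (wGrading k a b c) _ r
      have hG0 : algebraMap _ (FractionRing (MvPolynomial (Fin 3) k)) G ≠ 0 := by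
        rw [Ne, FaithfulSMul.algebraMap_eq_zero_iff]
        rintro rfl
        exact hGy (zero_mem _)
      rw [h4] at h3
      replace h3 := (congrArg (· * _) hs).symm.trans h3
      rw [div_mul_div_comm, div_eq_one_iff_eq (mul_ne_zero (hx0 n) hG0), ← RingHom.map_pow,
        ← RingHom.map_mul, ← RingHom.map_mul] at h3
      have h7 := IsFractionRing.injective _ _ h3
      have h8 : (X 0 * X 1 * X 2 : MvPolynomial (Fin 3) k) ^ n * G ∈
          (t₀ k b c ha).asHomogeneousIdeal := by
        rw [← h7]
        exact Ideal.mul_mem_right _ _ hF0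
      rcases (t₀ k b c ha).isPrime.mem_or_mem h8 with h | h
      · have h9 := (mem_t₀_iff ha torusEq_mem).1 (mem_of_pow_mem h)
        simp at h9
      · exact hGy h

lemma exists_affineOpens_notMem (ha : 0 < a) (hb : 0 < b) (hc : 0 < c) {y : weightedPlane k a b c}
    (hy : y ≠ t₀ k b c ha) : ∃ U : (weightedPlane k a b c).affineOpens, y ∈ U.1 ∧
      (pointIdeal k b c ha).ideal U = ⊤ := by
  obtain ⟨_, ⟨U, hU, rfl⟩, hxU, hU'⟩ :=
    (weightedPlane k a b c).isBasis_affineOpens.exists_subset_of_mem_open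
      (show y ∈ ({t₀ k b c ha} : Set (weightedPlane k a b c))ᶜ from hy)
      (isClosed_t₀ ha hb hc).isOpen_compl
  exact ⟨⟨U, hU⟩, hxU, vanishingIdeal_point_eq_top (isClosed_t₀ ha hb hc) ⟨U, hU⟩
    fun h => hU' h rfl⟩

lemma exists_mem_basicOpen (ha : 0 < a) (hb : 0 < b) (hc : 0 < c) {y : weightedPlane k a b c}
    (hy : y ≠ t₀ k b c ha) (hyU : y ∈ (torusOpen k b c ha).1) :
    ∃ s ∈ (pointIdeal k b c ha).ideal (torusOpen k b c ha),
      y ∈ (weightedPlane k a b c).basicOpen s := by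
  obtain ⟨F, d, hF, hF1, hFy⟩ : ∃ (F : MvPolynomial (Fin 3) k) (d : ℕ), F ∈ wGrading k a b c d ∧
      eval (fun _ => (1 : k)) F = 0 ∧ F ∉ y.asHomogeneousIdeal := by
    by_contra! hcon
    refine hy (eq_t₀_of_le ha hb hc fun p hp => ?_)
    classical
    rw [← DirectSum.sum_support_decompose (wGrading k a b c) p]
    refine sum_mem fun n _ => hcon _ n (SetLike.coe_mem _) ?_
    exact (mem_t₀_iff ha (SetLike.coe_mem _)).1
      ((t₀ k b c ha).asHomogeneousIdeal.isHomogeneous n hp)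
  have hF' : F ^ (a + b + c) ∈ wGrading k a b c (d • (a + b + c)) := by
    simpa [mul_comm] using SetLike.pow_mem_graded (a + b + c) hF
  have hx : (X 0 * X 1 * X 2 : MvPolynomial (Fin 3) k) ^ d ∈
      wGrading k a b c (d • (a + b + c)) := SetLike.pow_mem_graded d torusEq_mem
  obtain ⟨s, hs⟩ := exists_section_basicOpen (wGrading k a b c) torusEq_mem hF'
  refine ⟨s, ((torusChart ha hb hc).mem_ideal_iff hF' (hs _ (t₀_mem_torusOpen k b c ha))).2 ?_, ?_⟩
  · rw [RingHom.map_pow, hF1, zero_pow (by omega)]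
  · have hF0 : F ^ (a + b + c) ∉ y.asHomogeneousIdeal := fun h => hFy (mem_of_pow_mem h)
    have hne : algebraMap _ (FractionRing (MvPolynomial (Fin 3) k)) (F ^ (a + b + c)) ≠ 0 := by
      rw [Ne, FaithfulSMul.algebraMap_eq_zero_iff]
      intro h0
      rw [h0] at hF0
      exact hF0 (zero_mem _)
    refine (Scheme.mem_basicOpen (weightedPlane k a b c) s y hyU).2 (IsUnit.of_mul_eq_one
      (stalkMk (wGrading k a b c) _ hx hF' hF0) (stalkToFrac_injective (wGrading k a b c) _ ?_))
    rw [RingHom.map_mul, stalkToFrac_stalkMk, RingHom.map_one, RingHom.map_pow _ (X 0 * X 1 * X 2)]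
    refine Eq.trans (congrArg (· * _) (hs y hyU)) ?_
    rw [div_mul_div_comm, mul_comm, div_self
      (mul_ne_zero (pow_ne_zero _ (TorusChart.torusEq_ne_zero k)) hne)]

end TorusOpen

/-! ### A criterion for discrete valuation rings. -/

section Discrete

lemma MultiplicativeFun.comp_ringHom {K L : Type*} [Field K] [Field L] {v : L → ℤ}
    (hv : MultiplicativeFun v) (φ : K →+* L) : MultiplicativeFun fun f => v (φ f) where
  map_mul hf hg := by
    rw [RingHom.map_mul]
    exact hv.map_mul (by simpa using hf) (by simpa using hg)

lemma isDiscreteValuationRing_stalk {X : Scheme.{u}} [IsIntegral X] [IsLocallyNoetherian X] {z : X}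
    (hz : Order.coheight z = 1) {v : X.functionField → ℤ} (hv : MultiplicativeFun v)
    (hR : ∀ f : X.functionField, f ≠ 0 →
      (0 ≤ v f ↔ f ∈ Set.range (algebraMap (X.presheaf.stalk z) X.functionField))) :
    IsDiscreteValuationRing (X.presheaf.stalk z) := by
  have h1 : ¬ IsField (X.presheaf.stalk z) := by
    intro h
    have h2 := ringKrullDim_eq_zero_of_isField h
    rw [ringKrullDim_stalk_eq_coheight, hz] at h2
    norm_num at h2
  have h2 : IsLocalRing.maximalIdeal (X.presheaf.stalk z) ≠ ⊥ := fun h =>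
    h1 (IsLocalRing.isField_iff_maximalIdeal_eq.2 h)
  obtain ⟨r, hr, hr0⟩ := Submodule.exists_mem_ne_zero_of_ne_bot h2
  exact isDiscreteValuationRing_of_dvd_total (hv.dvd_total hR) hr0
    ((IsLocalRing.mem_maximalIdeal _).1 hr)

end Discrete

/-! ### The blowup of the weighted plane at t₀. -/

section BlowupPoint

open MvPolynomial

variable {k : Type u} [Field k] {a b c : ℕ} {X : Scheme.{u}} {π : X ⟶ weightedPlane k a b c}

lemma torusMap_eq (ha : 0 < a) (s : Γ(weightedPlane k a b c, torusOpen k b c ha))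
    {y : weightedPlane k a b c} (hy : y ∈ (torusOpen k b c ha).1) :
    stalkToFrac (wGrading k a b c) y ((weightedPlane k a b c).presheaf.germ _ y hy s) =
      torusMap k b c ha s := by
  obtain ⟨n, F, hF, h⟩ := exists_stalkToFrac_germ_eq (wGrading k a b c) torusEq_mem (by omega) s
  exact (h y hy).trans (h _ (t₀_mem_torusOpen k b c ha)).symm

lemma genericPoint_ne_t₀ (ha : 0 < a) (hb : 0 < b) {y : weightedPlane k a b c}
    (hy : y.asHomogeneousIdeal = ⊥) : y ≠ t₀ k b c ha := by
  rintro rfl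
  have h1 : (X 0 ^ b - X 1 ^ a : MvPolynomial (Fin 3) k) ∈ (t₀ k b c ha).asHomogeneousIdeal := by
    refine (mem_t₀_iff ha (d := b * a) (sub_mem ?_ ?_)).2 (by simp)
    · simpa using SetLike.pow_mem_graded b (X0_mem_wGrading (k := k) (a := a) (b := b) (c := c))
    · simpa [mul_comm] using SetLike.pow_mem_graded a
        (X1_mem_wGrading (k := k) (a := a) (b := b) (c := c))
  rw [hy, ← HomogeneousIdeal.mem_iff, HomogeneousIdeal.toIdeal_bot, Ideal.mem_bot] at h1
  have h2 := congrArg (eval (Function.update (fun _ => (1 : k)) 0 0)) h1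
  simp [zero_pow hb.ne'] at h2

section Birational

variable (ha : 0 < a) (hb : 0 < b) (hc : 0 < c) (habc : Nat.gcd (Nat.gcd a b) c = 1)

lemma specializes_genericPoint [IsIntegral (weightedPlane k a b c)] [IsIntegral X]
    (hgen : ∃ z, π z = genericPoint (weightedPlane k a b c)) (y : weightedPlane k a b c) :
    π (genericPoint X) ⤳ y := by
  obtain ⟨z, hz⟩ := hgen
  have h1 : genericPoint X ⤳ z := (genericPoint_spec X).specializes trivial
  have h2 := h1.map π.continuous
  rw [hz] at h2
  exact h2.trans ((genericPoint_spec _).specializes trivial)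

lemma IsBlowupAt.exists_genericPoint (ha : 0 < a) (hb : 0 < b) (hc : 0 < c)
    (hπ : IsBlowupAt π (t₀ k b c ha)) [IsIntegral (weightedPlane k a b c)] :
    ∃ z, π z = genericPoint (weightedPlane k a b c) := by
  obtain ⟨U, hyU, hU⟩ := exists_affineOpens_notMem ha hb hc (genericPoint_ne_t₀ ha hb
    (asHomogeneousIdeal_genericPoint (wGrading k a b c) ha X0_mem_wGrading (X_ne_zero 0)
      (y := genericPoint (weightedPlane k a b c))
      fun y' => (genericPoint_spec _).specializes trivial))
  exact IsBlowup.exists_preimage hπ U hU _ hyU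

lemma IsBlowupAt.isIntegral [CharZero k] (ha : 0 < a) (hb : 0 < b) (hc : 0 < c)
    (habc : Nat.gcd (Nat.gcd a b) c = 1) (hπ : IsBlowupAt π (t₀ k b c ha)) : IsIntegral X := by
  have := isIntegral_weightedPlane (k := k) (b := b) (c := c) ha
  refine IsBlowup.isIntegral hπ (fun y => ?_) (hπ.exists_genericPoint ha hb hc)
  by_cases hy : y = t₀ k b c ha
  · subst hy
    refine ⟨torusOpen k b c ha, t₀_mem_torusOpen k b c ha, fun h => ?_⟩
    have V := (torusChart (k := k) ha hb hc).adicValuation habc hb hc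
    have h1 := V.unif_mem
    rw [pow_one] at h1
    exact V.unif_ne_zero ((Submodule.mem_bot _).1 (h.le h1))
  · obtain ⟨U, hyU, hU⟩ := exists_affineOpens_notMem ha hb hc hy
    have : Nonempty U.1 := ⟨y, hyU⟩
    exact ⟨U, hyU, fun h => top_ne_bot (hU.symm.trans h)⟩

lemma IsBlowupAt.isIso_stalkMap (ha : 0 < a) (hb : 0 < b) (hc : 0 < c)
    (hπ : IsBlowupAt π (t₀ k b c ha)) {z : X} (hz : π z ≠ t₀ k b c ha) :
    IsIso (π.stalkMap z) := by
  obtain ⟨U, hyU, hU⟩ := exists_affineOpens_notMem ha hb hc hz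
  exact IsBlowup.isIso_stalkMap hπ U hU z hyU

lemma IsBlowupAt.exists_preimage (ha : 0 < a) (hb : 0 < b) (hc : 0 < c)
    (hπ : IsBlowupAt π (t₀ k b c ha)) {y : weightedPlane k a b c} (hy : y ≠ t₀ k b c ha) :
    ∃ z, π z = y := by
  obtain ⟨U, hyU, hU⟩ := exists_affineOpens_notMem ha hb hc hy
  exact IsBlowup.exists_preimage hπ U hU y hyU

lemma IsBlowupAt.eq_of_eq (ha : 0 < a) (hb : 0 < b) (hc : 0 < c)
    (hπ : IsBlowupAt π (t₀ k b c ha)) {z z' : X} (hz : π z ≠ t₀ k b c ha) (h : π z = π z') :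
    z = z' := by
  obtain ⟨U, hyU, hU⟩ := exists_affineOpens_notMem ha hb hc hz
  have := IsBlowup.exists_chart_of_eq_top hπ U hU
  have h1 : (π ∣_ U.1) ⟨z, hyU⟩ = (π ∣_ U.1) ⟨z', show π z' ∈ U.1 from h ▸ hyU⟩ := by
    exact Subtype.ext ((morphismRestrict_base_coe π U.1 ⟨z, hyU⟩).trans
      (h.trans (morphismRestrict_base_coe π U.1 ⟨z', _⟩).symm))
  exact congrArg Subtype.val ((π ∣_ U.1).homeomorph.injective h1)

end Birational

/-- Multiplying both terms of F/G by G^(a+b+c-1) brings the degree to n(a+b+c), so that both become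
numerators of functions on the torus. The order at (1,1,1) is insensitive to the denominators
(xyz)^n. -/
lemma TorusChart.toNat_ordOne_le_iff [CharZero k] {A : Type u} [CommRing A]
    {j : A →+* FractionRing (MvPolynomial (Fin 3) k)} {I : Ideal A} (h : TorusChart a b c j I)
    (habc : Nat.gcd (Nat.gcd a b) c = 1) (hb : 0 < b) (V : AdicValuation I) {n : ℕ}
    {F G : MvPolynomial (Fin 3) k} (hF : F ∈ wGrading k a b c n) (hG : G ∈ wGrading k a b c n)
    (hF0 : F ≠ 0) (hG0 : G ≠ 0) : (ordOne G).toNat ≤ (ordOne F).toNat ↔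
      ∃ (m : ℕ) (w w' : A), w ∈ I ^ m ∧ V.val w' = m ∧
        algebraMap _ (FractionRing (MvPolynomial (Fin 3) k)) F / algebraMap _ _ G * j w' = j w := by
  have hne : ∀ {H : MvPolynomial (Fin 3) k}, H ≠ 0 →
      algebraMap _ (FractionRing (MvPolynomial (Fin 3) k)) H ≠ 0 := fun h => by
    rwa [Ne, FaithfulSMul.algebraMap_eq_zero_iff]
  have hV : ∀ s, V.val s = h.val s := fun s => ENat.eq_of_forall_natCast_le_iff fun m =>
    (V.mem_pow_iff m s).symm.trans ⟨h.le_val_of_mem_pow m s, h.mem_pow_of_le_val habc m s⟩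
  have hσ := pow_ne_zero n (TorusChart.torusEq_ne_zero k)
  constructor
  · intro hle
    have h1 : F * G ^ (a + b + c - 1) ∈ wGrading k a b c (n • (a + b + c)) := by
      have := SetLike.mul_mem_graded hF (SetLike.pow_mem_graded (a + b + c - 1) hG)
      convert this using 2
      obtain ⟨N, hN⟩ : ∃ N, a + b + c = N + 1 := ⟨a + b + c - 1, by omega⟩
      rw [hN, Nat.add_sub_cancel, smul_eq_mul, smul_eq_mul]; ring
    have h2 : G * G ^ (a + b + c - 1) ∈ wGrading k a b c (n • (a + b + c)) := by
      have := SetLike.mul_mem_graded hG (SetLike.pow_mem_graded (a + b + c - 1) hG)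
      convert this using 2
      obtain ⟨N, hN⟩ : ∃ N, a + b + c = N + 1 := ⟨a + b + c - 1, by omega⟩
      rw [hN, Nat.add_sub_cancel, smul_eq_mul, smul_eq_mul]; ring
    have hG1 := pow_ne_zero (a + b + c - 1) hG0
    obtain ⟨w, hw⟩ := h.exists_preimage h1
    obtain ⟨w', hw'⟩ := h.exists_preimage h2
    refine ⟨(ordOne (G * G ^ (a + b + c - 1))).toNat, w, w', ?_, ?_, ?_⟩
    · refine h.mem_pow_of_le_val habc _ _ ?_
      rw [h.val_eq hw, ← natCast_toNat_ordOne (mul_ne_zero hF0 hG1), Nat.cast_le,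
        toNat_ordOne_mul hF0 hG1, toNat_ordOne_mul hG0 hG1]
      omega
    · exact (hV w').trans <| (h.val_eq hw').trans (natCast_toNat_ordOne (mul_ne_zero hG0 hG1)).symm
    · rw [hw, hw', RingHom.map_mul _ F, RingHom.map_mul _ G]
      have := hne hG0
      field_simp
  · rintro ⟨m, w, w', hw, hw', he⟩
    obtain ⟨i, H, -, hi⟩ := h.exists_eq w
    obtain ⟨i', H', -, hi'⟩ := h.exists_eq w'
    have h1 := h.le_val_of_mem_pow m w hw
    have h2 : h.val w' = m := (hV w').symm.trans hw'
    rw [h.val_eq hi] at h1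
    rw [h.val_eq hi'] at h2
    have hσi := pow_ne_zero i (TorusChart.torusEq_ne_zero k)
    have hσi' := pow_ne_zero i' (TorusChart.torusEq_ne_zero k)
    rw [hi, hi', div_mul_div_comm, div_eq_div_iff (mul_ne_zero (hne hG0) hσi') hσi, ← map_pow,
      ← map_pow, ← map_mul, ← map_mul, ← map_mul, ← map_mul] at he
    have h3 := congrArg ordOne (IsFractionRing.injective _ _ he)
    have h4 : ∀ m, ordOne ((X 0 * X 1 * X 2 : MvPolynomial (Fin 3) k) ^ m) = 0 := fun m =>
      ordOne_eq_zero (by simp)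
    rw [ordOne_mul, ordOne_mul, ordOne_mul, ordOne_mul, h4, h4, add_zero, add_zero, h2,
      ← natCast_toNat_ordOne hF0, ← natCast_toNat_ordOne hG0] at h3
    have h5 : ((m + (ordOne G).toNat : ℕ) : ℕ∞) ≤ ((ordOne F).toNat + m : ℕ) := by
      rw [Nat.cast_add, Nat.cast_add, h3]
      gcongr
    rw [Nat.cast_le] at h5
    omega

section Values

variable [IsIntegral X] [IsIso (π.stalkMap (genericPoint X))]

lemma exists_prime_valuation (ha : 0 < a) (hb : 0 < b) {z : X} (hz : Order.coheight z = 1)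
    [IsIso (π.stalkMap z)] : ∃ (p : MvPolynomial (Fin 3) k) (m : ℕ), Prime p ∧
      p ∈ wGrading k a b c m ∧ (π z).asHomogeneousIdeal.toIdeal = Ideal.span {p} ∧
      ∀ f : X.functionField, f ≠ 0 → (0 ≤ fracVal (multiplicity p) (fracMap _ π f) ↔
        f ∈ Set.range (algebraMap (X.presheaf.stalk z) X.functionField)) := by
  rw [coheight_eq_of_isIso_stalkMap π] at hz
  obtain ⟨p, m, hp, hpm, hy⟩ := exists_prime_of_coheight_eq_one hz ha hb
  refine ⟨p, m, hp, hpm, hy, fun f hf => ?_⟩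
  obtain ⟨n, F, G, hF, hG, hG0, h⟩ := exists_fracMap_eq (wGrading k a b c) π f
  have hF0 : F ≠ 0 := by
    rintro rfl
    rw [map_zero, zero_div, map_eq_zero] at h
    exact hf h
  rw [mem_range_algebraMap_iff (wGrading k a b c) π z, h, mem_range_stalkToFrac_iff hp hpm hy hF hG
    hF0 hG0, fracVal_div (multiplicity_mul_of_ne_zero hp) hF0 hG0]
  omega

lemma exceptional_valuation [CharZero k] (ha : 0 < a) (hb : 0 < b) (hc : 0 < c)
    (habc : Nat.gcd (Nat.gcd a b) c = 1)
    {ψ : affineBlowup ((pointIdeal k b c ha).ideal (torusOpen k b c ha)) ⟶ X} [IsOpenImmersion ψ]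
    (hψ : ψ ≫ π = projToSpec (reesGrading ((pointIdeal k b c ha).ideal (torusOpen k b c ha))) ≫
      (torusOpen k b c ha).2.fromSpec) [IsIntegral (weightedPlane k a b c)]
    [Nonempty (torusOpen k b c ha).1]
    (V : AdicValuation ((pointIdeal k b c ha).ideal (torusOpen k b c ha)))
    (hz : π (ψ V.exceptionalPoint) ∈ (torusOpen k b c ha).1) (f : X.functionField) (hf : f ≠ 0) :
    0 ≤ fracVal (fun F : MvPolynomial (Fin 3) k => (ordOne F).toNat) (fracMap _ π f) ↔
      f ∈ Set.range (algebraMap (X.presheaf.stalk (ψ V.exceptionalPoint)) X.functionField) := by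
  obtain ⟨n, F, G, hF, hG, hG0, hFG⟩ := exists_fracMap_eq (wGrading k a b c) π f
  have hF0 : F ≠ 0 := by
    rintro rfl
    rw [map_zero, zero_div, map_eq_zero] at hFG
    exact hf hFG
  have h1 : 0 ≤ fracVal (fun F : MvPolynomial (Fin 3) k => (ordOne F).toNat) (fracMap _ π f) ↔
      (ordOne G).toNat ≤ (ordOne F).toNat := by
    rw [hFG, fracVal_div toNat_ordOne_mul hF0 hG0, sub_nonneg, Nat.cast_le]
  have h2 := (torusChart ha hb hc).toNat_ordOne_le_iff habc hb V hF hG hF0 hG0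
  refine (h1.trans h2).trans
    (Iff.trans ?_ (mem_range_chart_exceptionalPoint (wGrading k a b c) π hψ V hz f).symm)
  refine exists_congr fun m => exists_congr fun w => exists_congr fun w' =>
    and_congr_right' (and_congr_right' ?_)
  have h3 := torusMap_eq ha w hz
  have h4 := torusMap_eq ha w' hz
  exact Eq.to_iff (congrArg₂ (· = ·) (congrArg₂ (· * ·) hFG.symm h4.symm) h3.symm)

end Values

end BlowupPoint

open MvPolynomial in
/-- A description of the prime divisors of a scheme `X` that is birational to the weighted
projective plane: apart from the exceptional divisor `E`, whose valuation is a multiple of the order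
of vanishing at `(1, 1, 1)`, they correspond to the homogeneous prime elements of `k[x, y, z]`. -/
structure PlaneModel (k : Type u) [Field k] (a b c : ℕ) (X : Scheme.{u}) [RegularInCodimOne X] where
  /-- the embedding of the function field -/
  frac : X.functionField →+* FractionRing (MvPolynomial (Fin 3) k)
  exists_frac_eq : ∀ u, ∃ (n : ℕ) (F G : MvPolynomial (Fin 3) k), F ∈ wGrading k a b c n ∧
    G ∈ wGrading k a b c n ∧ G ≠ 0 ∧ frac u = algebraMap _ _ F / algebraMap _ _ G
  exists_preimage : ∀ {n : ℕ} {F G : MvPolynomial (Fin 3) k}, F ∈ wGrading k a b c n →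
    G ∈ wGrading k a b c n → G ≠ 0 → ∃ u, frac u = algebraMap _ _ F / algebraMap _ _ G
  /-- the exceptional divisor -/
  exc : PrimeDivisor X
  /-- the index of the order along `E` in the order of vanishing at `(1, 1, 1)` -/
  excIndex : ℕ
  excIndex_pos : 0 < excIndex
  ord_exc : ∀ {u : X.functionField} {F G : MvPolynomial (Fin 3) k}, F ≠ 0 → G ≠ 0 →
    frac u = algebraMap _ _ F / algebraMap _ _ G →
    (excIndex : ℤ) * Scheme.ord u exc.1 = (ordOne F).toNat - (ordOne G).toNat
  /-- the prime element that corresponds to a prime divisor -/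
  prime : PrimeDivisor X → MvPolynomial (Fin 3) k
  /-- the ramification index at a prime divisor -/
  index : PrimeDivisor X → ℕ
  prime_prime : ∀ z, z ≠ exc → Prime (prime z)
  prime_mem : ∀ z, z ≠ exc → ∃ m, prime z ∈ wGrading k a b c m
  index_pos : ∀ z, z ≠ exc → 0 < index z
  ord_eq : ∀ {z}, z ≠ exc → ∀ {u : X.functionField} {F G : MvPolynomial (Fin 3) k}, F ≠ 0 → G ≠ 0 →
    frac u = algebraMap _ _ F / algebraMap _ _ G →
    (index z : ℤ) * Scheme.ord u z.1 = multiplicity (prime z) F - multiplicity (prime z) G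
  eq_of_associated : ∀ {z z'}, z ≠ exc → z' ≠ exc → Associated (prime z) (prime z') → z = z'
  exists_associated : ∀ {p : MvPolynomial (Fin 3) k} {m : ℕ}, Prime p → p ∈ wGrading k a b c m →
    ∃ z, z ≠ exc ∧ Associated p (prime z)

/-! ### Construction of the model of X. -/

section Model

open MvPolynomial

variable {k : Type u} [Field k] [CharZero k] {a b c : ℕ} {X : Scheme.{u}}
  {π : X ⟶ weightedPlane k a b c}

/-- Away from t₀ the map π induces isomorphisms on stalks, so codimension-one points correspond to
homogeneous primes. Over t₀ only the exceptional point has codimension one, and its valuation is the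
order of vanishing at (1,1,1) up to an index. -/
theorem IsBlowupAt.exists_planeModel (ha : 0 < a) (hb : 0 < b) (hc : 0 < c)
    (habc : Nat.gcd (Nat.gcd a b) c = 1) (hπ : IsBlowupAt π (t₀ k b c ha)) :
    ∃ _ : RegularInCodimOne X, Nonempty (PlaneModel k a b c X) := by
  have hPi := isIntegral_weightedPlane (k := k) (b := b) (c := c) ha
  have hPn := isNoetherian_weightedPlane (k := k) ha hb hc
  have hXi := hπ.isIntegral ha hb hc habc
  have hXn : IsNoetherian X := IsBlowup.isNoetherian hπ
  have hbot : (π (genericPoint X)).asHomogeneousIdeal = ⊥ :=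
    asHomogeneousIdeal_genericPoint (wGrading k a b c) ha X0_mem_wGrading (X_ne_zero 0)
      (specializes_genericPoint (hπ.exists_genericPoint ha hb hc))
  have hiso := hπ.isIso_stalkMap ha hb hc (genericPoint_ne_t₀ ha hb hbot)
  have hU : Nonempty (torusOpen k b c ha).1 := ⟨_, t₀_mem_torusOpen k b c ha⟩
  obtain ⟨ψ, hψ1, hψ2, hψ3⟩ := IsBlowup.exists_chart hπ (torusOpen k b c ha)
  let V := (torusChart (k := k) ha hb hc).adicValuation habc hb hc
  have hEU : π (ψ V.exceptionalPoint) ∈ (torusOpen k b c ha).1 := by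
    change ψ V.exceptionalPoint ∈ π ⁻¹ᵁ (torusOpen k b c ha).1
    rw [← hψ2]
    exact ⟨_, rfl⟩
  -- Functions in the ideal of t₀ vanish at the image of the exceptional point, whereas every other
  -- point of the torus is avoided by one of them.
  have hEt : π (ψ V.exceptionalPoint) = t₀ k b c ha := by
    by_contra hne
    obtain ⟨s, hs, hs'⟩ := exists_mem_basicOpen ha hb hc hne hEU
    exact chart_exceptionalPoint_notMem_basicOpen hψ3 V hEU hs hs'
  have hE1 : Order.coheight (ψ V.exceptionalPoint) = 1 := coheight_chart_exceptionalPoint V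
  have hEeq : ∀ z : X, Order.coheight z = 1 → π z = t₀ k b c ha → z = ψ V.exceptionalPoint := by
    intro z hz hzt
    have hzU : π z ∈ (torusOpen k b c ha).1 := by rw [hzt]; exact t₀_mem_torusOpen k b c ha
    refine eq_chart_exceptionalPoint hψ3 V hz (by rw [hψ2]; exact hzU) hzU fun s hs => ?_
    rw [hzt]
    exact (mem_vanishingIdeal_point_iff (isClosed_t₀ ha hb hc) _ s).1 hs
      (t₀_mem_torusOpen k b c ha)
  have hvE := multiplicativeFun_fracVal (w := fun F : MvPolynomial (Fin 3) k => (ordOne F).toNat)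
    toNat_ordOne_mul |>.comp_ringHom (fracMap (wGrading k a b c) π)
  have hRE := exceptional_valuation (π := π) ha hb hc habc hψ3 V hEU
  have hvp : ∀ {p : MvPolynomial (Fin 3) k}, Prime p →
      MultiplicativeFun fun f => fracVal (multiplicity p) (fracMap (wGrading k a b c) π f) :=
    fun hp => (multiplicativeFun_fracVal (multiplicity_mul_of_ne_zero hp)).comp_ringHom _
  have hp : ∀ z : X, Order.coheight z = 1 → z ≠ ψ V.exceptionalPoint →
      ∃ (p : MvPolynomial (Fin 3) k) (m : ℕ), Prime p ∧
      p ∈ wGrading k a b c m ∧ (π z).asHomogeneousIdeal.toIdeal = Ideal.span {p} ∧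
      ∀ f : X.functionField, f ≠ 0 → (0 ≤ fracVal (multiplicity p) (fracMap _ π f) ↔
        f ∈ Set.range (algebraMap (X.presheaf.stalk z) X.functionField)) := by
    intro z hz hzE
    have := hπ.isIso_stalkMap ha hb hc fun h => hzE (hEeq z hz h)
    exact exists_prime_valuation ha hb hz
  have hreg : RegularInCodimOne X :=
    { isDiscreteValuationRing := fun z hz => by
        by_cases hzE : z = ψ V.exceptionalPoint
        · subst hzE
          exact isDiscreteValuationRing_stalk hz hvE hRE
        · obtain ⟨p, m, hp1, -, -, hp2⟩ := hp z hz hzE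
          exact isDiscreteValuationRing_stalk hz (hvp hp1) hp2 }
  have hindex : ∀ z : PrimeDivisor X, z ≠ ⟨_, hE1⟩ → ∃ (p : MvPolynomial (Fin 3) k) (m e : ℕ),
      Prime p ∧ p ∈ wGrading k a b c m ∧ (π z.1).asHomogeneousIdeal.toIdeal = Ideal.span {p} ∧
      0 < e ∧ ∀ f : X.functionField, f ≠ 0 →
        fracVal (multiplicity p) (fracMap _ π f) = e * Scheme.ord f z.1 := by
    intro z hz
    obtain ⟨p, m, hp1, hp2, hp3, hp4⟩ := hp z.1 z.2 fun h => hz (Subtype.ext h)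
    have := hreg.isDiscreteValuationRing z.1 z.2
    obtain ⟨e, he, he'⟩ := exists_eq_mul_ord z.2 (hvp hp1) hp4
    exact ⟨p, m, e, hp1, hp2, hp3, he, he'⟩
  have := hreg.isDiscreteValuationRing _ hE1
  obtain ⟨eE, heE, heE'⟩ := exists_eq_mul_ord hE1 hvE hRE
  classical
  choose! p m e hp1 hp2 hp3 he he' using hindex
  have hne0 : ∀ {u : X.functionField} {F G : MvPolynomial (Fin 3) k}, F ≠ 0 → G ≠ 0 →
      fracMap (wGrading k a b c) π u = algebraMap _ _ F / algebraMap _ _ G → u ≠ 0 := by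
    rintro u F G hF hG h rfl
    rw [map_zero, eq_comm, div_eq_zero_iff, FaithfulSMul.algebraMap_eq_zero_iff,
      FaithfulSMul.algebraMap_eq_zero_iff] at h
    exact h.elim hF hG
  refine ⟨hreg, ⟨⟨fracMap (wGrading k a b c) π, exists_fracMap_eq _ π,
    fun hF hG hG0 => exists_fracMap_preimage _ π hbot hF hG hG0, ⟨_, hE1⟩, eE, heE, ?_, p, e, hp1,
    fun z hz => ⟨m z, hp2 z hz⟩, he, ?_, ?_, ?_⟩⟩⟩
  · intro u F G hF hG h
    rw [← heE' u (hne0 hF hG h), h, fracVal_div toNat_ordOne_mul hF hG]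
  · intro z hz u F G hF hG h
    rw [← he' z hz u (hne0 hF hG h), h, fracVal_div (multiplicity_mul_of_ne_zero (hp1 z hz)) hF hG]
  · intro z z' hz hz' h
    refine Subtype.ext (hπ.eq_of_eq ha hb hc (fun h0 => hz (Subtype.ext (hEeq _ z.2 h0)))
      (ProjectiveSpectrum.ext (HomogeneousIdeal.toIdeal_injective ?_)))
    rw [hp3 z hz, hp3 z' hz']
    exact Ideal.span_singleton_eq_span_singleton.2 h
  · intro q n hq hqn
    obtain ⟨y, hy⟩ := exists_point_of_prime hq hqn ha hb
    have hyt : y ≠ t₀ k b c ha := by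
      rintro rfl
      exact span_ne_t₀ ha hb hc hq hy
    obtain ⟨z, rfl⟩ := hπ.exists_preimage ha hb hc hyt
    have := hπ.isIso_stalkMap ha hb hc hyt
    have hz1 : Order.coheight z = 1 := by
      rw [coheight_eq_of_isIso_stalkMap π]
      exact coheight_eq_one_of_span ha hb hc hq hqn hy
    have hzE : (⟨z, hz1⟩ : PrimeDivisor X) ≠ ⟨_, hE1⟩ := fun h =>
      hyt ((congrArg π (congrArg Subtype.val h)).trans hEt)
    refine ⟨⟨z, hz1⟩, hzE, Ideal.span_singleton_eq_span_singleton.1 ?_⟩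
    rw [← hp3 _ hzE, ← hy]

end Model

/-! ### Finite generation of the class group. -/

namespace PlaneModel

open MvPolynomial

variable {k : Type u} [Field k] {a b c : ℕ} {X : Scheme.{u}} [RegularInCodimOne X]
  (M : PlaneModel k a b c X)

lemma X_mem_wGrading (i : Fin 3) :
    (MvPolynomial.X i : MvPolynomial (Fin 3) k) ∈ wGrading k a b c (![a, b, c] i) := by
  fin_cases i
  · exact X0_mem_wGrading
  · exact X1_mem_wGrading
  · exact X2_mem_wGrading

/-- The prime divisor of `X` that lies over the divisor of a coordinate. -/
def coordDivisor (i : Fin 3) : PrimeDivisor X :=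
  (M.exists_associated (MvPolynomial.X_prime (i := i)) (X_mem_wGrading i)).choose

lemma coordDivisor_ne_exc (i : Fin 3) : M.coordDivisor i ≠ M.exc :=
  (M.exists_associated (MvPolynomial.X_prime (i := i)) (X_mem_wGrading i)).choose_spec.1

lemma associated_coordDivisor (i : Fin 3) :
    Associated (MvPolynomial.X i) (M.prime (M.coordDivisor i)) :=
  (M.exists_associated (MvPolynomial.X_prime (i := i)) (X_mem_wGrading i)).choose_spec.2

lemma prime_dvd_X_iff {z : PrimeDivisor X} (hz : z ≠ M.exc) (i : Fin 3) :
    M.prime z ∣ MvPolynomial.X i ↔ z = M.coordDivisor i := by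
  constructor
  · intro h
    refine M.eq_of_associated hz (M.coordDivisor_ne_exc i) ?_
    exact ((M.prime_prime z hz).irreducible.associated_of_dvd
      MvPolynomial.X_prime.irreducible h).trans (M.associated_coordDivisor i)
  · rintro rfl
    exact (M.associated_coordDivisor i).symm.dvd

open scoped Classical in
lemma multiplicity_prime {z w : PrimeDivisor X} (hz : z ≠ M.exc) (hw : w ≠ M.exc) :
    multiplicity (M.prime w) (M.prime z) = if w = z then 1 else 0 := by
  split_ifs with h
  · subst h
    have := multiplicity_pow_self (M.prime_prime w hw).ne_zero (M.prime_prime w hw).not_isUnit 1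
    rwa [pow_one] at this
  · refine multiplicity_eq_zero.2 fun hd => h (M.eq_of_associated hw hz ?_)
    exact (M.prime_prime w hw).irreducible.associated_of_dvd (M.prime_prime z hz).irreducible hd

lemma ne_zero_of_frac_eq {u : X.functionField} {F G : MvPolynomial (Fin 3) k} (hF : F ≠ 0)
    (hG : G ≠ 0) (h : M.frac u = algebraMap _ _ F / algebraMap _ _ G) : u ≠ 0 := by
  rintro rfl
  rw [map_zero, eq_comm, div_eq_zero_iff, FaithfulSMul.algebraMap_eq_zero_iff,
    FaithfulSMul.algebraMap_eq_zero_iff] at h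
  exact h.elim hF hG

open scoped Classical in
-- The prime form of z, of degree m, times a Laurent monomial of degree -m is a rational function;
-- off E and the coordinate divisors it has only the zero z.
lemma exists_ord_eq_one (habc : Nat.gcd (Nat.gcd a b) c = 1) {z : PrimeDivisor X} (hz : z ≠ M.exc) :
    ∃ u : X.functionField, u ≠ 0 ∧ ∀ w : PrimeDivisor X, w ≠ M.exc →
      (∀ i, w ≠ M.coordDivisor i) → Scheme.ord u w.1 = if w = z then 1 else 0 := by
  obtain ⟨m, hm⟩ := M.prime_mem z hz
  obtain ⟨α, β, γ, hαβγ⟩ : ∃ α β γ : ℤ, a * α + b * β + c * γ = 1 := by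
    have h1 := Nat.gcd_eq_gcd_ab a b
    have h2 := Nat.gcd_eq_gcd_ab (Nat.gcd a b) c
    rw [habc, h1] at h2
    exact ⟨Nat.gcdA a b * Nat.gcdA (Nat.gcd a b) c, Nat.gcdB a b * Nat.gcdA (Nat.gcd a b) c,
      Nat.gcdB (Nat.gcd a b) c, by push_cast at h2; linear_combination -h2⟩
  have hmon := fun i j l => monomial_mem_wGrading (k := k) (a := a) (b := b) (c := c) i j l
  have hmon0 : ∀ i j l : ℕ, (MvPolynomial.X 0 ^ i * MvPolynomial.X 1 ^ j * MvPolynomial.X 2 ^ l :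
      MvPolynomial (Fin 3) k) ≠ 0 := fun i j l => mul_ne_zero (mul_ne_zero
    (pow_ne_zero _ (X_ne_zero _)) (pow_ne_zero _ (X_ne_zero _))) (pow_ne_zero _ (X_ne_zero _))
  -- The exponents -mα, -mβ, -mγ are split into positive and negative parts; the latter go to the
  -- denominator.
  have hF := SetLike.mul_mem_graded hm (hmon (-(m * α)).toNat (-(m * β)).toNat (-(m * γ)).toNat)
  have hG := hmon (m * α).toNat (m * β).toNat (m * γ).toNat
  have hdeg : m + (a * (-(m * α)).toNat + b * (-(m * β)).toNat + c * (-(m * γ)).toNat) =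
      a * (m * α).toNat + b * (m * β).toNat + c * (m * γ).toNat := by
    have h := fun x : ℤ => Int.toNat_sub_toNat_neg x
    zify
    linear_combination (-(m : ℤ)) * hαβγ - a * h (m * α) - b * h (m * β) - c * h (m * γ)
  rw [hdeg] at hF
  obtain ⟨u, hu⟩ := M.exists_preimage hF hG (hmon0 _ _ _)
  have hF0 := mul_ne_zero (M.prime_prime z hz).ne_zero
    (hmon0 (-(m * α)).toNat (-(m * β)).toNat (-(m * γ)).toNat)
  refine ⟨u, M.ne_zero_of_frac_eq hF0 (hmon0 _ _ _) hu, fun w hw hwi => ?_⟩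
  have hp := M.prime_prime w hw
  have h0 : ∀ i j l : ℕ, multiplicity (M.prime w) (MvPolynomial.X 0 ^ i * MvPolynomial.X 1 ^ j *
      MvPolynomial.X 2 ^ l) = 0 := fun i j l => by
    have hX : ∀ (i : Fin 3) (n : ℕ), ¬ M.prime w ∣ MvPolynomial.X i ^ n := fun i n h =>
      hwi i ((M.prime_dvd_X_iff hw i).1 (hp.dvd_of_dvd_pow h))
    refine multiplicity_eq_zero.2 fun h => ?_
    rcases hp.dvd_or_dvd h with h | h
    · rcases hp.dvd_or_dvd h with h | h
      · exact hX _ _ h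
      · exact hX _ _ h
    · exact hX _ _ h
  have h1 := M.ord_eq hw hF0 (hmon0 _ _ _) hu
  rw [multiplicity_mul_of_ne_zero hp (M.prime_prime z hz).ne_zero (hmon0 _ _ _), h0, h0, add_zero,
    M.multiplicity_prime hz hw] at h1
  have h2 := M.index_pos w hw
  split_ifs at h1 ⊢ with h
  · rw [Nat.cast_one, Nat.cast_zero, sub_zero] at h1
    rcases Int.mul_eq_one_iff_eq_one_or_neg_one.1 h1 with h3 | h3
    · exact h3.2
    · omega
  · rw [sub_self, mul_eq_zero] at h1
    exact h1.resolve_left (by omega)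

/-- By the preceding lemma every prime divisor is equivalent to a combination of E and the three
coordinate divisors. -/
lemma fg_divisorClassGroup (M : PlaneModel k a b c X) (habc : Nat.gcd (Nat.gcd a b) c = 1) :
    AddGroup.FG (DivisorClassGroup X) := by
  classical
  set T : Finset (PrimeDivisor X) := insert M.exc (Finset.univ.image M.coordDivisor) with hT
  set cls : PrimeDivisor X → DivisorClassGroup X := fun z =>
    QuotientAddGroup.mk (Finsupp.single z 1) with hcls
  set S := AddSubgroup.closure (cls '' T) with hS
  have hsum : ∀ D : WeilDivisor X, (∀ z ∈ D.support, cls z ∈ S) →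
      (QuotientAddGroup.mk D : DivisorClassGroup X) ∈ S := by
    intro D hD
    have h1 : (QuotientAddGroup.mk D : DivisorClassGroup X) = ∑ z ∈ D.support, D z • cls z := by
      conv_lhs => rw [← D.sum_single, Finsupp.sum]
      refine (map_sum (QuotientAddGroup.mk' (principalDivisors X)) _ _).trans ?_
      refine Finset.sum_congr rfl fun z _ => ?_
      rw [hcls]
      dsimp only
      rw [← QuotientAddGroup.mk_zsmul, Finsupp.smul_single, smul_eq_mul, mul_one]
      rfl
    rw [h1]
    exact sum_mem fun z hz => S.zsmul_mem (hD z hz) _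
  have hTS : ∀ z ∈ T, cls z ∈ S := fun z hz => AddSubgroup.subset_closure ⟨z, hz, rfl⟩
  have hall : ∀ z, cls z ∈ S := by
    intro z
    by_cases hz : z ∈ T
    · exact hTS z hz
    have hzE : z ≠ M.exc := fun h => hz (by rw [hT, h]; exact Finset.mem_insert_self _ _)
    obtain ⟨u, hu, hord⟩ := M.exists_ord_eq_one habc hzE
    have hord' : ∀ w, w ∉ T → Scheme.ord u w.1 = if w = z then 1 else 0 := by
      intro w hw
      refine hord w (fun h => hw ?_) fun i h => hw ?_
      · rw [hT, h]; exact Finset.mem_insert_self _ _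
      · rw [hT, h]; exact Finset.mem_insert_of_mem (Finset.mem_image_of_mem _ (Finset.mem_univ _))
    set D : WeilDivisor X := Finsupp.onFinset (insert z T) (fun w => Scheme.ord u w.1) (by
      intro w hw
      by_contra hcon
      rw [Finset.mem_insert, not_or] at hcon
      exact hw (by rw [hord' w hcon.2, if_neg hcon.1])) with hD
    have hD0 : (QuotientAddGroup.mk D : DivisorClassGroup X) = 0 :=
      (QuotientAddGroup.eq_zero_iff D).2 ⟨u, hu, fun w => rfl⟩
    have h1 : cls z = (QuotientAddGroup.mk (Finsupp.single z 1 - D) : DivisorClassGroup X) := by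
      rw [QuotientAddGroup.mk_sub, hD0, sub_zero]
    rw [h1]
    refine hsum _ fun w hw => hTS w ?_
    by_contra hwT
    refine Finsupp.mem_support_iff.1 hw ?_
    rw [Finsupp.sub_apply, hD, Finsupp.onFinset_apply, hord' w hwT, Finsupp.single_apply]
    by_cases h : w = z
    · rw [if_pos h, if_pos h.symm, sub_self]
    · rw [if_neg h, if_neg (Ne.symm h), sub_self]
  rw [AddGroup.fg_iff]
  refine ⟨cls '' T, ?_, T.finite_toSet.image _⟩
  rw [eq_top_iff]
  intro x _
  obtain ⟨D, rfl⟩ := QuotientAddGroup.mk_surjective x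
  exact hsum D fun z _ => hall z

end PlaneModel

/-! ### Sections of αZ - βE as forms vanishing at (1, 1, 1). -/

namespace PlaneModel

open MvPolynomial

variable {k : Type u} [Field k] {a b c : ℕ} {X : Scheme.{u}} [RegularInCodimOne X]
  (M : PlaneModel k a b c X)

/-- The divisor `α Z - β E`, where `Z` lies over the divisor of the first coordinate and `E` is
exceptional. -/
def pencilDivisor (α β : ℕ) : WeilDivisor X :=
  Finsupp.single (M.coordDivisor 0) (α : ℤ) - Finsupp.single M.exc (β : ℤ)

lemma pencilDivisor_exc (α β : ℕ) : M.pencilDivisor α β M.exc = -β := by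
  rw [pencilDivisor, Finsupp.sub_apply, Finsupp.single_eq_of_ne (M.coordDivisor_ne_exc 0).symm,
    Finsupp.single_eq_same, zero_sub]

lemma index_mul_pencilDivisor (α β : ℕ) {z : PrimeDivisor X} (hz : z ≠ M.exc) :
    (M.index z : ℤ) * M.pencilDivisor α β z =
      multiplicity (M.prime z) (MvPolynomial.X 0 ^ (M.index (M.coordDivisor 0) * α)) := by
  classical
  rw [pencilDivisor, Finsupp.sub_apply, Finsupp.single_eq_of_ne hz, sub_zero]
  have hp := M.prime_prime z hz
  by_cases h : z = M.coordDivisor 0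
  · subst h
    rw [Finsupp.single_eq_same, multiplicity_eq_of_associated_right
      ((M.associated_coordDivisor 0).pow_pow), multiplicity_pow_self hp.ne_zero hp.not_isUnit]
    push_cast
    ring
  · rw [Finsupp.single_eq_of_ne h, mul_zero, multiplicity_eq_zero.2 fun hd => h
      ((M.prime_dvd_X_iff hz 0).1 (hp.dvd_of_dvd_pow hd)), Nat.cast_zero]

lemma ordOne_X_pow (s : ℕ) : ordOne (MvPolynomial.X 0 ^ s : MvPolynomial (Fin 3) k) = 0 :=
  ordOne_eq_zero (by simp)

/-- Off E a section has poles only along x = 0, of bounded order, so unique factorisation gives u =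
F/x^s with F a form; the condition along E is then an order of vanishing. The indices convert orders
on X into multiplicities of polynomials. -/
theorem mem_divisorSections_pencilDivisor (α β : ℕ) (u : X.functionField) :
    u ∈ divisorSections (M.pencilDivisor α β) ↔ ∃ F : MvPolynomial (Fin 3) k,
      F ∈ wGrading k a b c (a * (M.index (M.coordDivisor 0) * α)) ∧
      VanishesToOrder (M.excIndex * β) F ∧
      M.frac u = algebraMap _ _ F / algebraMap (MvPolynomial (Fin 3) k) _
        (MvPolynomial.X 0 ^ (M.index (M.coordDivisor 0) * α)) := by
  set s := M.index (M.coordDivisor 0) * α with hs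
  have hX0 : (MvPolynomial.X 0 ^ s : MvPolynomial (Fin 3) k) ≠ 0 := pow_ne_zero _ (X_ne_zero _)
  have hXs : (MvPolynomial.X 0 ^ s : MvPolynomial (Fin 3) k) ∈ wGrading k a b c (a * s) := by
    have := SetLike.pow_mem_graded s (X0_mem_wGrading (k := k) (a := a) (b := b) (c := c))
    rwa [smul_eq_mul, mul_comm] at this
  constructor
  · intro hu
    by_cases hu0 : u = 0
    · refine ⟨0, zero_mem _, fun β _ => by rw [map_zero, coeff_zero], ?_⟩
      rw [hu0, map_zero, map_zero, zero_div]
    replace hu := hu hu0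
    obtain ⟨n, F, G, hF, hG, hG0, hFG⟩ := M.exists_frac_eq u
    have hF0 : F ≠ 0 := by
      rintro rfl
      rw [map_zero, zero_div] at hFG
      exact hu0 ((map_eq_zero_iff _ M.frac.injective).1 hFG)
    -- Only homogeneous primes divide the form G, and each of them comes from a prime divisor of X
    -- other than E, where the order of u is controlled.
    have hdvd : G ∣ F * MvPolynomial.X 0 ^ s := by
      rw [UniqueFactorizationMonoid.dvd_iff_emultiplicity_le hG0]
      intro p hp
      by_cases hpG : p ∣ G
      · obtain ⟨m, hm⟩ := exists_mem_wGrading_of_dvd hG hG0 hpG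
        obtain ⟨z, hz, hpz⟩ := M.exists_associated hp hm
        have hz' := M.prime_prime z hz
        rw [(finiteMultiplicity hp hG0).emultiplicity_eq_multiplicity,
          (finiteMultiplicity hp (mul_ne_zero hF0 hX0)).emultiplicity_eq_multiplicity,
          Nat.cast_le, ← multiplicity_eq_of_associated_left hpz,
          ← multiplicity_eq_of_associated_left hpz, multiplicity_mul_of_ne_zero hz' hF0 hX0]
        have h1 := M.ord_eq hz hF0 hG0 hFG
        have h2 := M.index_mul_pencilDivisor α β hz
        have h3 := mul_nonneg (Int.natCast_nonneg (M.index z)) (hu z)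
        rw [mul_add, h1, h2, ← hs] at h3
        omega
      · rw [emultiplicity_eq_zero.2 hpG]
        exact zero_le
    obtain ⟨H, hH⟩ := hdvd
    have hFX := SetLike.mul_mem_graded hF hXs
    have hH0 : H ≠ 0 := by
      rintro rfl
      rw [mul_zero] at hH
      exact mul_ne_zero hF0 hX0 hH
    obtain ⟨m, hm⟩ := exists_mem_wGrading_of_dvd hFX (mul_ne_zero hF0 hX0)
      (Dvd.intro_left _ hH.symm)
    have hdeg : n + a * s = n + m := by
      refine eq_of_mem_wGrading hFX ?_ (mul_ne_zero hF0 hX0)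
      rw [hH]
      exact SetLike.mul_mem_graded hG hm
    have hfrac : M.frac u = algebraMap _ _ H / algebraMap (MvPolynomial (Fin 3) k) _
        (MvPolynomial.X 0 ^ s) := by
      rw [hFG, div_eq_div_iff, ← map_mul, ← map_mul, hH, mul_comm]
      · rwa [Ne, FaithfulSMul.algebraMap_eq_zero_iff]
      · rwa [Ne, FaithfulSMul.algebraMap_eq_zero_iff]
    refine ⟨H, by rwa [Nat.add_left_cancel hdeg], ?_, hfrac⟩
    rw [← le_ordOne_iff, ← natCast_toNat_ordOne hH0, Nat.cast_le]
    have h1 := M.ord_exc hH0 hX0 hfrac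
    have h2 := hu M.exc
    rw [ordOne_X_pow, ENat.toNat_zero, Nat.cast_zero, sub_zero] at h1
    rw [pencilDivisor_exc] at h2
    have h3 := mul_le_mul_of_nonneg_left (show (β : ℤ) ≤ Scheme.ord u M.exc.1 by omega)
      (Int.natCast_nonneg M.excIndex)
    rw [h1] at h3
    exact_mod_cast h3
  · rintro ⟨F, hF, hFv, hfrac⟩ hu0 z
    have hF0 : F ≠ 0 := by
      rintro rfl
      rw [map_zero, zero_div] at hfrac
      exact hu0 ((map_eq_zero_iff _ M.frac.injective).1 hfrac)
    by_cases hz : z = M.exc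
    · subst hz
      have h1 := M.ord_exc hF0 hX0 hfrac
      rw [ordOne_X_pow, ENat.toNat_zero, Nat.cast_zero, sub_zero] at h1
      rw [← le_ordOne_iff, ← natCast_toNat_ordOne hF0, Nat.cast_le] at hFv
      rw [pencilDivisor_exc]
      have h3 : (M.excIndex : ℤ) * β ≤ M.excIndex * Scheme.ord u M.exc.1 := by
        rw [h1]; exact_mod_cast hFv
      have h4 := le_of_mul_le_mul_left h3 (by exact_mod_cast M.excIndex_pos)
      omega
    · have h1 := M.ord_eq hz hF0 hX0 hfrac
      have h2 := M.index_mul_pencilDivisor α β hz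
      have h3 : 0 ≤ (M.index z : ℤ) * (Scheme.ord u z.1 + M.pencilDivisor α β z) := by
        rw [mul_add, h1, h2, ← hs]
        omega
      exact nonneg_of_mul_nonneg_right h3 (by exact_mod_cast M.index_pos z hz)

end PlaneModel

/-! ### Divisors that span the class group rationally. -/

section Span

variable {X : Scheme.{u}} [RegularInCodimOne X]

/-- Denominators are cleared by d; since ℚ ⊗ A is the localization of A at the nonzero integers, the
remaining discrepancy in A is killed by some t ≠ 0. -/
lemma exists_zsmul_eq_of_span_tmul {A : Type*} [AddCommGroup A] {r : ℕ} {x : Fin r → A}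
    (h : Submodule.span ℚ (Set.range fun i => TensorProduct.tmul ℤ (1 : ℚ) (x i)) = ⊤) (y : A) :
    ∃ (q : ℕ) (m : Fin r → ℤ), 0 < q ∧ ∑ i, m i • x i = q • y := by
  have hy : TensorProduct.tmul ℤ (1 : ℚ) y ∈
      Submodule.span ℚ (Set.range fun i => TensorProduct.tmul ℤ (1 : ℚ) (x i)) := by
    rw [h]; exact Submodule.mem_top
  obtain ⟨w, hw⟩ := (Submodule.mem_span_range_iff_exists_fun ℚ).1 hy
  obtain ⟨⟨d, hd⟩, hdw⟩ := IsLocalization.exist_integer_multiples_of_finite (nonZeroDivisors ℤ) w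
  choose m hm using hdw
  have hmk : IsLocalizedModule (nonZeroDivisors ℤ) (TensorProduct.mk ℤ ℚ A 1) :=
    (isLocalizedModule_iff_isBaseChange (nonZeroDivisors ℤ) ℚ _).2
    (TensorProduct.isBaseChange ℤ A ℚ)
  have hz : TensorProduct.mk ℤ ℚ A 1 (∑ i, m i • x i - d • y) = 0 := by
    rw [map_sub, map_sum, map_zsmul]
    have h1 : ∀ i, TensorProduct.mk ℤ ℚ A 1 (m i • x i) =
        d • w i • TensorProduct.tmul ℤ (1 : ℚ) (x i) := by
      intro i
      have h2 : ((m i : ℤ) : ℚ) = d * w i := by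
        have := hm i
        rw [zsmul_eq_mul] at this
        exact this
      rw [map_zsmul, ← Int.cast_smul_eq_zsmul ℚ, h2, mul_smul, Int.cast_smul_eq_zsmul]
      rfl
    rw [Finset.sum_congr rfl fun i _ => h1 i, ← Finset.smul_sum, hw]
    exact sub_self _
  obtain ⟨⟨t, ht⟩, htz⟩ := (IsLocalizedModule.eq_zero_iff (nonZeroDivisors ℤ) _).1 hz
  rw [Submonoid.mk_smul, smul_sub, sub_eq_zero, Finset.smul_sum, smul_smul] at htz
  have hq : t * d ≠ 0 := mul_ne_zero (nonZeroDivisors.ne_zero ht) (nonZeroDivisors.ne_zero hd)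
  -- The integer td may be negative; its square is a positive multiple.
  refine ⟨((t * d) * (t * d)).toNat, fun i => (t * d) * (t * m i), ?_, ?_⟩
  · have := mul_self_pos.2 hq
    omega
  · rw [← natCast_zsmul, Int.toNat_of_nonneg (mul_self_nonneg _), mul_smul, ← htz, Finset.smul_sum]
    exact Finset.sum_congr rfl fun i _ => by
      simp only [smul_smul, mul_assoc]

lemma SpansClassGroup.exists_eq {r : ℕ} {D : Fin r → WeilDivisor X} (hD : SpansClassGroup D)
    (N : WeilDivisor X) :
    ∃ (q : ℕ) (m : Fin r → ℤ) (v : X.functionField), 0 < q ∧ v ≠ 0 ∧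
      ∀ z : PrimeDivisor X, divisorComb D m z = q * N z + Scheme.ord v z.1 := by
  obtain ⟨q, m, hq, h⟩ := exists_zsmul_eq_of_span_tmul hD (QuotientAddGroup.mk N)
  have h1 : (QuotientAddGroup.mk (divisorComb D m) : DivisorClassGroup X) =
      QuotientAddGroup.mk (q • N) := by
    refine Eq.trans ?_ (h.trans (QuotientAddGroup.mk_nsmul _ _ _).symm)
    exact map_sum (QuotientAddGroup.mk' (principalDivisors X)) _ _
  obtain ⟨v, hv, hv'⟩ := QuotientAddGroup.eq.1 h1.symm
  refine ⟨q, m, v, hq, hv, fun z => ?_⟩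
  rw [← hv' z, Finsupp.add_apply, Finsupp.neg_apply, Finsupp.smul_apply, nsmul_eq_mul]
  ring

lemma ord_pow {v : X.functionField} (hv : v ≠ 0) (j : ℕ) (z : X) :
    Scheme.ord (v ^ j) z = j * Scheme.ord v z := by
  induction j with
  | zero => rw [pow_zero, ord_one, Nat.cast_zero, zero_mul]
  | succ j ih =>
    rw [pow_succ, Scheme.ord_mul (pow_ne_zero _ hv) hv, ih]
    push_cast
    ring

lemma mem_divisorSections_iff_mul_mem {D E : WeilDivisor X} {v : X.functionField} (hv : v ≠ 0)
    (h : ∀ z : PrimeDivisor X, D z = E z + Scheme.ord v z.1) (u : X.functionField) :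
    u ∈ divisorSections D ↔ u * v ∈ divisorSections E := by
  by_cases hu : u = 0
  · rw [hu, zero_mul]
    exact ⟨fun _ => zero_mem _, fun _ => zero_mem _⟩
  · constructor
    · intro h' _ z
      have := h' hu z
      rw [h] at this
      rw [Scheme.ord_mul hu hv]
      linarith
    · intro h' _ z
      have := h' (mul_ne_zero hu hv) z
      rw [Scheme.ord_mul hu hv] at this
      rw [h]
      linarith

end Span

/-! ### Gordan's lemma for products of generators. -/

section FiniteType

variable {L Γ ι : Type*} [Field L] [AddCommGroup Γ]

/-- The additive group generated by the multiples of the products of elements `v i` of degrees `d i`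
that have total degree `γ`. -/
def productSpan [Fintype ι] (C : Set L) (d : ι → Γ) (v : ι → L) (γ : Γ) : AddSubgroup L :=
  AddSubgroup.closure {x | ∃ s ∈ C, ∃ n : ι → ℕ, ∑ i, n i • d i = γ ∧ x = s * ∏ i, v i ^ n i}

lemma mul_mem_productSpan [Fintype ι] {C : Set L} (hC : ∀ s ∈ C, ∀ s' ∈ C, s * s' ∈ C) {d : ι → Γ}
    {v : ι → L} {γ γ' : Γ} {x y : L} (hx : x ∈ productSpan C d v γ)
    (hy : y ∈ productSpan C d v γ') : x * y ∈ productSpan C d v (γ + γ') := by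
  induction hx using AddSubgroup.closure_induction with
  | mem x hx =>
    induction hy using AddSubgroup.closure_induction with
    | mem y hy =>
      obtain ⟨s, hs, n, hn, rfl⟩ := hx
      obtain ⟨s', hs', n', hn', rfl⟩ := hy
      refine AddSubgroup.subset_closure ⟨s * s', hC s hs s' hs', n + n', ?_, ?_⟩
      · rw [← hn, ← hn', ← Finset.sum_add_distrib]
        exact Finset.sum_congr rfl fun i _ => add_smul _ _ _
      · simp only [Pi.add_apply, pow_add, Finset.prod_mul_distrib]
        ring
    | zero => rw [mul_zero]; exact zero_mem _
    | add y y' _ _ h h' => rw [mul_add]; exact add_mem h h'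
    | neg y _ h => rw [mul_neg]; exact neg_mem h
  | zero => rw [zero_mul]; exact zero_mem _
  | add y y' _ _ h h' => rw [add_mul]; exact add_mem h h'
  | neg y _ h => rw [neg_mul]; exact neg_mem h

/-- The pairs (n, j) with Σ nᵢdᵢ = jm form a finitely generated monoid. A product of degree jm
therefore splits into products of degrees j'm with j' < J, so at least j/J of these have j' > 0, and
each of those contributes one step of the filtration. -/
lemma exists_le_mul_of_fg [Fintype ι] {d : ι → Γ} {v : ι → L} {m : Γ} {V : Γ → AddSubgroup L}
    (h1 : (1 : L) ∈ V 0)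
    (hmul : ∀ {γ γ' x y}, x ∈ V γ → y ∈ V γ' → x * y ∈ V (γ + γ')) (hv : ∀ i, v i ∈ V (d i))
    {I : ℕ → ℕ → AddSubgroup L} (hI0 : ∀ x ∈ V 0, x ∈ I 0 0)
    (hI1 : ∀ j, 0 < j → ∀ x ∈ V (j • m), x ∈ I j 1)
    (hImul : ∀ {j j' t t' x y}, x ∈ I j t → y ∈ I j' t' → x * y ∈ I (j + j') (t + t')) :
    ∃ J : ℕ, 0 < J ∧ ∀ (n : ι → ℕ) (j : ℕ), ∑ i, n i • d i = j • m →
      ∃ t, j ≤ J * t ∧ ∏ i, v i ^ n i ∈ I j t := by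
  classical
  let φ : (ι → ℕ) × ℕ →+ Γ :=
    { toFun := fun p => ∑ i, p.1 i • d i
      map_zero' := by simp
      map_add' := fun p q => by simp [add_smul, Finset.sum_add_distrib] }
  let ψ : (ι → ℕ) × ℕ →+ Γ :=
    { toFun := fun p => p.2 • m
      map_zero' := by simp
      map_add' := fun p q => by simp [add_smul] }
  obtain ⟨S, hS⟩ := AddSubmonoid.fg_eqLocusM φ ψ
  -- The added 1 keeps J positive even if all generators have j = 0.
  refine ⟨S.sup Prod.snd + 1, by omega, fun n j hnj => ?_⟩
  have hprod : ∀ n : ι → ℕ, ∏ i, v i ^ n i ∈ V (∑ i, n i • d i) := by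
    intro n
    have hpow : ∀ i, ∀ l : ℕ, v i ^ l ∈ V (l • d i) := by
      intro i l
      induction l with
      | zero => rw [pow_zero, zero_smul]; exact h1
      | succ l ih => rw [pow_succ, succ_nsmul]; exact hmul ih (hv i)
    have : ∀ s : Finset ι, ∏ i ∈ s, v i ^ n i ∈ V (∑ i ∈ s, n i • d i) := by
      intro s
      induction s using Finset.induction_on with
      | empty => rw [Finset.prod_empty, Finset.sum_empty]; exact h1
      | insert i s hi ih =>
        rw [Finset.prod_insert hi, Finset.sum_insert hi]
        exact hmul (hpow i _) ih
    exact this _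
  have hmem : ((n, j) : (ι → ℕ) × ℕ) ∈ AddSubmonoid.closure (S : Set ((ι → ℕ) × ℕ)) := by
    rw [hS]; exact hnj
  clear hnj
  suffices h : ∀ p ∈ AddSubmonoid.closure (S : Set ((ι → ℕ) × ℕ)),
      ∃ t, p.2 ≤ (S.sup Prod.snd + 1) * t ∧ ∏ i, v i ^ p.1 i ∈ I p.2 t from h _ hmem
  intro p hp
  induction hp using AddSubmonoid.closure_induction with
  | mem p hp =>
    have hp' : ∑ i, p.1 i • d i = p.2 • m := by
      have : p ∈ φ.eqLocusM ψ := by rw [← hS]; exact AddSubmonoid.subset_closure hp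
      exact this
    have hV := hprod p.1
    rw [hp'] at hV
    rcases Nat.eq_zero_or_pos p.2 with h0 | h0
    · rw [h0] at hV ⊢
      rw [zero_smul] at hV
      exact ⟨0, le_rfl, hI0 _ hV⟩
    · refine ⟨1, ?_, hI1 _ h0 _ hV⟩
      have := Finset.le_sup (f := Prod.snd) (Finset.mem_coe.1 hp)
      omega
  | zero =>
    refine ⟨0, le_rfl, ?_⟩
    simpa using hI0 1 h1
  | add p q _ _ hp hq =>
    obtain ⟨t, ht, hpt⟩ := hp
    obtain ⟨t', ht', hqt⟩ := hq
    refine ⟨t + t', ?_, ?_⟩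
    · rw [mul_add]; exact add_le_add ht ht'
    · have := hImul hpt hqt
      simpa only [Prod.fst_add, Prod.snd_add, Pi.add_apply, pow_add, Finset.prod_mul_distrib]

end FiniteType

lemma divisorComb_zero {X : Scheme.{u}} {r : ℕ} (D : Fin r → WeilDivisor X) :
    divisorComb D 0 = 0 := by
  simp [divisorComb]

/-! ### Consequences of finite generation of a section ring. -/

section SectionRing

variable {X : Scheme.{u}} [RegularInCodimOne X] {k : Type u} [Field k]

lemma constants_mem_divisorSections (s : X ⟶ Spec (.of k)) (x : k) :
    constants s x ∈ divisorSections (0 : WeilDivisor X) := by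
  have h := (constantsToSectionRing s (fun i : Fin 0 => (0 : WeilDivisor X)) x).2 0
  rw [divisorComb_zero] at h
  have h2 : ((constantsToSectionRing s (fun i : Fin 0 => (0 : WeilDivisor X)) x :
      AddMonoidAlgebra X.functionField (Fin 0 → ℤ))).coeff 0 = constants s x := by
    change (AddMonoidAlgebra.single 0 (constants s x)).coeff 0 = _
    rw [AddMonoidAlgebra.coeff_single, Finsupp.single_eq_same]
  rwa [h2] at h

open scoped Classical in
/-- The homogeneous components of finitely many elements of a section ring. -/
lemma exists_homogeneous_generators (s : X ⟶ Spec (.of k)) {r : ℕ} {D : Fin r → WeilDivisor X}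
    (h : (constantsToSectionRing s D).FiniteType) :
    ∃ S : Finset ((Fin r → ℤ) × X.functionField),
      (∀ p ∈ S, p.2 ∈ divisorSections (divisorComb D p.1)) ∧
      ∀ γ, ∀ x ∈ divisorSections (divisorComb D γ),
        x ∈ productSpan (Set.range (constants s)) (fun p : S => p.1.1) (fun p : S => p.1.2) γ := by
  let _ := (constantsToSectionRing s D).toAlgebra
  obtain ⟨T, hT⟩ : ∃ T : Finset (sectionRing D), Algebra.adjoin k (T : Set (sectionRing D)) = ⊤ :=
    h.out
  set S : Finset ((Fin r → ℤ) × X.functionField) := T.biUnion fun F =>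
    F.1.coeff.support.image fun γ => (γ, F.1.coeff γ) with hS
  refine ⟨S, ?_, ?_⟩
  · intro p hp
    obtain ⟨F, -, hF⟩ := Finset.mem_biUnion.1 hp
    obtain ⟨γ, -, rfl⟩ := Finset.mem_image.1 hF
    exact F.2 γ
  have hC : ∀ x ∈ Set.range (constants s), ∀ y ∈ Set.range (constants s),
      x * y ∈ Set.range (constants s) := by
    rintro _ ⟨x, rfl⟩ _ ⟨y, rfl⟩
    exact ⟨x * y, map_mul _ _ _⟩
  have hall : ∀ F ∈ Algebra.adjoin k (T : Set (sectionRing D)), ∀ γ, F.1.coeff γ ∈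
      productSpan (Set.range (constants s)) (fun p : S => p.1.1) (fun p : S => p.1.2) γ := by
    intro F hF
    induction hF using Algebra.adjoin_induction with
    | mem F hF =>
      intro γ
      by_cases h0 : F.1.coeff γ = 0
      · rw [h0]; exact zero_mem _
      have hmem : (γ, F.1.coeff γ) ∈ S := Finset.mem_biUnion.2 ⟨F, hF,
        Finset.mem_image.2 ⟨γ, Finsupp.mem_support_iff.2 h0, rfl⟩⟩
      refine AddSubgroup.subset_closure ⟨1, ⟨1, map_one _⟩,
        fun p => if p = ⟨_, hmem⟩ then 1 else 0, ?_, ?_⟩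
      · rw [Finset.sum_eq_single ⟨_, hmem⟩]
        · dsimp only; rw [if_pos rfl, one_smul]
        · intro p _ hp
          dsimp only; rw [if_neg hp, zero_smul]
        · intro h
          exact absurd (Finset.mem_univ _) h
      · rw [Finset.prod_eq_single ⟨_, hmem⟩]
        · dsimp only; rw [if_pos rfl, pow_one, one_mul]
        · intro p _ hp
          dsimp only; rw [if_neg hp, pow_zero]
        · intro h
          exact absurd (Finset.mem_univ _) h
    | algebraMap x =>
      intro γ
      have h1 : (algebraMap k (sectionRing D) x).1.coeff γ =
          (Finsupp.single 0 (constants s x) : (Fin r → ℤ) →₀ X.functionField) γ := rfl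
      rw [h1]
      by_cases hγ : γ = 0
      · subst hγ
        rw [Finsupp.single_eq_same]
        exact AddSubgroup.subset_closure ⟨_, ⟨x, rfl⟩, 0, by simp, by simp⟩
      · rw [Finsupp.single_eq_of_ne hγ]
        exact zero_mem _
    | add F G _ _ hF hG =>
      intro γ
      exact add_mem (hF γ) (hG γ)
    | mul F G _ _ hF hG =>
      intro γ
      change (F.1 * G.1).coeff γ ∈ _
      rw [AddMonoidAlgebra.coeff_mul]
      refine sum_mem fun m₁ _ => sum_mem fun m₂ _ => ?_
      dsimp only
      split_ifs with h
      · rw [← h]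
        exact mul_mem_productSpan hC (hF m₁) (hG m₂)
      · exact zero_mem _
  intro γ x hx
  have hmem : AddMonoidAlgebra.single γ x ∈ sectionRing D := by
    intro γ'
    rw [AddMonoidAlgebra.coeff_single]
    by_cases hγ : γ' = γ
    · subst hγ
      rwa [Finsupp.single_eq_same]
    · rw [Finsupp.single_eq_of_ne hγ]
      exact zero_mem _
  have h1 := hall ⟨_, hmem⟩ (by rw [hT]; exact Algebra.mem_top) γ
  rwa [show (AddMonoidAlgebra.single γ x).coeff γ = x by
    rw [AddMonoidAlgebra.coeff_single, Finsupp.single_eq_same]] at h1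

/-- If a section ring is finitely generated, then the elements of large degree in a direction `m`
are sums of products of many elements of smaller degree in that direction: they lie deep in every
multiplicative filtration. -/
theorem exists_mem_of_finiteType (s : X ⟶ Spec (.of k)) {r : ℕ} {D : Fin r → WeilDivisor X}
    (h : (constantsToSectionRing s D).FiniteType) (m : Fin r → ℤ)
    {I : ℕ → ℕ → AddSubgroup X.functionField} (hanti : ∀ {j t t'}, t ≤ t' → I j t' ≤ I j t)
    (hI0 : ∀ x ∈ divisorSections (0 : WeilDivisor X), x ∈ I 0 0)
    (hI1 : ∀ j, 0 < j → ∀ x ∈ divisorSections (divisorComb D (j • m)), x ∈ I j 1)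
    (hImul : ∀ {j j' t t' x y}, x ∈ I j t → y ∈ I j' t' → x * y ∈ I (j + j') (t + t')) :
    ∃ J : ℕ, 0 < J ∧ ∀ t, ∀ x ∈ divisorSections (divisorComb D ((J * t) • m)), x ∈ I (J * t) t := by
  classical
  obtain ⟨S, hS1, hS2⟩ := exists_homogeneous_generators s h
  obtain ⟨J, hJ, hJt⟩ := exists_le_mul_of_fg (d := fun p : S => p.1.1) (v := fun p : S => p.1.2)
    (m := m) (V := fun γ => divisorSections (divisorComb D γ)) (I := I)
    (by rw [divisorComb_zero]; exact one_mem_divisorSections)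
    (fun hx hy => by rw [divisorComb_add]; exact mul_mem_divisorSections hx hy)
    (fun p => hS1 p.1 p.2) (by rw [divisorComb_zero]; exact hI0) hI1 hImul
  refine ⟨J, hJ, fun t x hx => ?_⟩
  have hx' := hS2 _ x hx
  refine (AddSubgroup.closure_le (I (J * t) t)).2 ?_ hx'
  rintro _ ⟨_, ⟨y, rfl⟩, n, hn, rfl⟩
  obtain ⟨t', ht', hmem⟩ := hJt n _ hn
  have h1 := hImul (hI0 _ (constants_mem_divisorSections s y)) hmem
  rw [zero_add, zero_add] at h1
  exact hanti (Nat.le_of_mul_le_mul_left ht' hJ) h1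

end SectionRing

/-! ### Non-finite generation of the Cox ring. -/

section NotFinitelyGenerated

open MvPolynomial

variable {k : Type u} [Field k] {a b c : ℕ} {X : Scheme.{u}} [RegularInCodimOne X]
  {s : X ⟶ Spec (.of k)}

/-- A Cox ring of `X` is not finitely generated if a polynomial `h` divides all polynomials of
degree `K j a b` that vanish to order `K j g` at `(1, 1, 1)`, but its multiplicity in some of these is
bounded. -/
theorem PlaneModel.not_hasFinitelyGeneratedCoxRing (M : PlaneModel k a b c X)
    {g K T : ℕ} {h : MvPolynomial (Fin 3) k}
    (hdvd : ∀ j : ℕ, 0 < j → ∀ F ∈ wGrading k a b c (K * j * (a * b)),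
      VanishesToOrder (g * (K * j)) F → h ∣ F)
    (hndvd : ∀ j : ℕ, 0 < j → ∃ F ∈ wGrading k a b c (K * j * (a * b)),
      VanishesToOrder (g * (K * j)) F ∧ ¬ h ^ T ∣ F) :
    ¬ HasFinitelyGeneratedCoxRing s := by
  classical
  rintro ⟨r, D, hD, hfin⟩
  set ex := M.index (M.coordDivisor 0) with hex
  have hex0 : 0 < ex := M.index_pos _ (M.coordDivisor_ne_exc 0)
  have hE0 := M.excIndex_pos
  -- Chosen so that, after multiplication by v^j, the sections in degree jm are exactly the forms of
  -- degree Kj'ab vanishing to order gKj', divided by a power of x, where j' = ex · `M.excIndex` · q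
  -- · j; the indices drop out.
  set α := K * M.excIndex * b with hα
  set β := g * K * ex with hβ
  obtain ⟨q, m, v, hq, hv, hm⟩ := hD.exists_eq (M.pencilDivisor α β)
  have hsec : ∀ (j : ℕ) (u : X.functionField), u ∈ divisorSections (divisorComb D (j • m)) ↔
      ∃ F ∈ wGrading k a b c (K * (ex * M.excIndex * q * j) * (a * b)),
        VanishesToOrder (g * (K * (ex * M.excIndex * q * j))) F ∧
        M.frac (u * v ^ j) = algebraMap _ _ F / algebraMap (MvPolynomial (Fin 3) k) _
          (MvPolynomial.X 0 ^ (ex * α * q * j)) := by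
    intro j u
    have h1 : ∀ z : PrimeDivisor X, divisorComb D (j • m) z =
        M.pencilDivisor (α * q * j) (β * q * j) z + Scheme.ord (v ^ j) z.1 := by
      intro z
      have h2 : divisorComb D (j • m) = j • divisorComb D m := by
        rw [divisorComb, divisorComb, Finset.smul_sum]
        exact Finset.sum_congr rfl fun i _ => by
          rw [Pi.smul_apply, nsmul_eq_mul, mul_smul, natCast_zsmul]
      have h3 : M.pencilDivisor (α * q * j) (β * q * j) z = j * q * M.pencilDivisor α β z := by
        simp only [PlaneModel.pencilDivisor, Finsupp.sub_apply, Finsupp.single_apply]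
        split_ifs <;> push_cast <;> ring
      rw [h2, Finsupp.smul_apply, hm, ord_pow hv, h3, nsmul_eq_mul]
      ring
    rw [mem_divisorSections_iff_mul_mem (pow_ne_zero j hv) h1, M.mem_divisorSections_pencilDivisor,
      show a * (M.index (M.coordDivisor 0) * (α * q * j)) =
        K * (ex * M.excIndex * q * j) * (a * b) by rw [hα, hex]; ring,
      show M.excIndex * (β * q * j) = g * (K * (ex * M.excIndex * q * j)) by rw [hβ]; ring,
      show M.index (M.coordDivisor 0) * (α * q * j) = ex * α * q * j by rw [hex]; ring]
  -- The filtration by powers of h, in the normalisation where a section of degree jm becomes a form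
  -- over a fixed power of x. No degree or vanishing condition is kept, so it is closed under
  -- products at once.
  let I : ℕ → ℕ → AddSubgroup X.functionField := fun j t =>
    { carrier := {u | ∃ F : MvPolynomial (Fin 3) k, h ^ t ∣ F ∧
        M.frac (u * v ^ j) = algebraMap _ _ F / algebraMap (MvPolynomial (Fin 3) k) _
          (MvPolynomial.X 0 ^ (ex * α * q * j))}
      zero_mem' := ⟨0, dvd_zero _, by rw [zero_mul, map_zero, map_zero, zero_div]⟩
      add_mem' := by
        rintro u u' ⟨F, hF, h1⟩ ⟨F', hF', h2⟩
        exact ⟨F + F', dvd_add hF hF', by rw [add_mul, map_add, h1, h2, map_add, add_div]⟩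
      neg_mem' := by
        rintro u ⟨F, hF, h1⟩
        exact ⟨-F, (dvd_neg).2 hF, by rw [neg_mul, map_neg, h1, map_neg, neg_div]⟩ }
  have hanti : ∀ {j t t'}, t ≤ t' → I j t' ≤ I j t := by
    rintro j t t' htt' u ⟨F, hF, h1⟩
    exact ⟨F, (pow_dvd_pow _ htt').trans hF, h1⟩
  have hI0 : ∀ x ∈ divisorSections (0 : WeilDivisor X), x ∈ I 0 0 := by
    intro u hu
    have h1 := hsec 0 u
    rw [zero_smul, divisorComb_zero] at h1
    obtain ⟨F, -, -, h2⟩ := h1.1 hu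
    exact ⟨F, by rw [pow_zero]; exact one_dvd _, h2⟩
  have hI1 : ∀ j, 0 < j → ∀ x ∈ divisorSections (divisorComb D (j • m)), x ∈ I j 1 := by
    intro j hj u hu
    obtain ⟨F, hF, hFv, h1⟩ := (hsec j u).1 hu
    exact ⟨F, by rw [pow_one]; exact hdvd _ (by positivity) F hF hFv, h1⟩
  have hImul : ∀ {j j' t t' x y}, x ∈ I j t → y ∈ I j' t' → x * y ∈ I (j + j') (t + t') := by
    rintro j j' t t' u u' ⟨F, hF, h1⟩ ⟨F', hF', h2⟩
    refine ⟨F * F', by rw [pow_add]; exact mul_dvd_mul hF hF', ?_⟩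
    rw [pow_add, mul_mul_mul_comm, map_mul, h1, h2, div_mul_div_comm, ← map_mul, ← map_mul,
      ← pow_add, ← mul_add]
  obtain ⟨J, hJ, hJt⟩ := exists_mem_of_finiteType s hfin m (I := I) hanti hI0 hI1 hImul
  rcases Nat.eq_zero_or_pos T with rfl | hT
  · obtain ⟨F, -, -, hF⟩ := hndvd 1 one_pos
    exact hF (by rw [pow_zero]; exact one_dvd _)
  have hpos : 0 < ex * M.excIndex * q * (J * T) := by positivity
  obtain ⟨F, hF, hFv, hFT⟩ := hndvd _ hpos
  have hX : (MvPolynomial.X 0 ^ (ex * α * q * (J * T)) : MvPolynomial (Fin 3) k) ∈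
      wGrading k a b c (K * (ex * M.excIndex * q * (J * T)) * (a * b)) := by
    -- The denominator has the same degree as F, so F over it is a rational function on X. In degree
    -- JTm finite generation forces h^T to divide F, contrary to the choice of F.
    have := SetLike.pow_mem_graded (ex * α * q * (J * T))
      (X0_mem_wGrading (k := k) (a := a) (b := b) (c := c))
    rwa [smul_eq_mul, show ex * α * q * (J * T) * a =
      K * (ex * M.excIndex * q * (J * T)) * (a * b) by rw [hα]; ring] at this
  have hX0 : algebraMap (MvPolynomial (Fin 3) k) (FractionRing (MvPolynomial (Fin 3) k))
      (MvPolynomial.X 0 ^ (ex * α * q * (J * T))) ≠ 0 := by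
    rw [Ne, FaithfulSMul.algebraMap_eq_zero_iff]
    exact pow_ne_zero _ (X_ne_zero _)
  obtain ⟨u, hu⟩ := M.exists_preimage hF hX (pow_ne_zero _ (X_ne_zero _))
  have huv : u / v ^ (J * T) * v ^ (J * T) = u := div_mul_cancel₀ _ (pow_ne_zero _ hv)
  obtain ⟨F', hF', h1⟩ := hJt T (u / v ^ (J * T)) ((hsec _ _).2 ⟨F, hF, hFv, by rw [huv, hu]⟩)
  rw [huv, hu, div_left_inj' hX0] at h1
  rw [FaithfulSMul.algebraMap_injective _ _ h1] at hFT
  exact hFT hF'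

end NotFinitelyGenerated

end BlowupCox

end

theorem theorem3 {k : Type u} [Field k] [IsAlgClosed k] [CharZero k]
    (a b c : ℕ) (ha : 0 < a) (hb : 0 < b) (hc : 0 < c) (habc : Nat.gcd (Nat.gcd a b) c = 1)
    (e f g : ℕ) (he : 0 < e) (hf : 0 < f) (hg : 0 < g) (hefg : Nat.gcd (Nat.gcd e f) g = 1)
    (hrel : a * e + b * f = c * g)
    (hw : ((g : ℚ) ^ 2 * c) / (a * b) < 1)
    (n : ℕ)
    (hn : {δ : ℤ | δ ≤ 0 ∧ 0 ≤ (b : ℤ) + δ * e ∧ 0 ≤ (a : ℤ) - δ * f ∧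
      (g : ℤ) ∣ (b : ℤ) + δ * e ∧ (g : ℤ) ∣ (a : ℤ) - δ * f}.ncard = n)
    (hn' : {γ : ℤ | 0 ≤ γ ∧ 0 ≤ ((n : ℤ) - 1) * b + γ * e ∧ 0 ≤ ((n : ℤ) - 1) * a - γ * f ∧
      (g : ℤ) ∣ ((n : ℤ) - 1) * b + γ * e ∧ (g : ℤ) ∣ ((n : ℤ) - 1) * a - γ * f}.ncard = n)
    (hmod : ¬ (g ∣ n * b ∧ g ∣ n * a))
    (X : AlgebraicGeometry.Scheme.{u}) (π : X ⟶ BlowupCox.weightedPlane k a b c)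
    (hπ : BlowupCox.IsBlowupAt π (BlowupCox.t₀ k b c ha)) :
    ∃ _ : BlowupCox.RegularInCodimOne X,
      AddGroup.FG (BlowupCox.DivisorClassGroup X) ∧
      ¬ BlowupCox.HasFinitelyGeneratedCoxRing
        (π ≫ BlowupCox.projToSpec (BlowupCox.wGrading k a b c)) := by
  obtain ⟨hX, ⟨M⟩⟩ := hπ.exists_planeModel ha hb hc habc
  obtain ⟨K, T, -, hKT⟩ := BlowupCox.exists_multiple_curve_dvd (k := k) ha hb hc habc he hf hg hefg
    hrel hw n hn hn' hmod
  exact ⟨hX, M.fg_divisorClassGroup habc, M.not_hasFinitelyGeneratedCoxRing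
    (fun j hj => (hKT j hj).1) fun j hj => (hKT j hj).2⟩
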